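/- Let $(M,g)$ be a compact smooth Riemannian manifold with smooth boundary $\partial M$ and interior $M^{\circ}$, of dimension $m\ge 1$, with tangent bundle $TM$ and unit sphere bundle $SM$, and let $n\ge 0$. A smooth Hermitian connection on $M\times\mathbb C^n$ is a smooth one-form $A$ on $M$ with values in the skew-Hermitian $n\times n$ matrices. For a smooth curve $\gamma:[0,\tau]\to M$ let $P^A_\gamma=W(\tau)$, where $W:[0,\tau]\to\mathbb C^{n\times n}$ solves $\dot W+A_{\gamma}(\dot\gamma)W=0$, $W(0)=I$. For $(x,v)\in SM$ with $x\in M^{\circ}$, call $(x,v)$ nontangential if the geodesic $\gamma_{x,v}$ with $\gamma_{x,v}(0)=x$, $\dot\gamma_{x,v}(0)=v$ is a smooth geodesic $[0,\tau]\to M$ for some $\tau=\tau(x,v)>0$, with $\gamma_{x,v}([0,\tau))\subset M^{\circ}$, $\gamma_{x,v}(\tau)\in\partial M$ and $\dot\gamma_{x,v}(\tau)\notin T\partial M$; put $\alpha(x,v)=\gamma_{x,v}(\tau(x,v))$ and write $P^A_{\gamma_{x,v}}$ for the transport along $\gamma_{x,v}:[0,\tau(x,v)]\to M$. A geodesic graph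 structure $(\mathcal V,\mathcal E)$ on $(M,g)$ consists, for every $x\in M^{\circ}$, of a set $\mathcal V(x)\subset S_xM$ of nontangential directions and a set $\mathcal E(x)\subset\{(v,w)\in\mathcal V(x)\times\mathcal V(x): v\ne\pm w\}$; $\mathcal V=\bigcup_x\mathcal V(x)\subset SM$ and $\mathcal E=\bigcup_x\mathcal E(x)$. It is complete if $\alpha(\mathcal V)$ is dense in $\partial M$ and, for every $x\in M^{\circ}$: (i) the directed graph $(\mathcal V(x),\mathcal E(x))$ is connected, that is, for all distinct $v,w\in\mathcal V(x)$ there are $v=v_0,v_1,\dots,v_k=w$ in $\mathcal V(x)$ with $(v_{j-1},v_j)\in\mathcal E(x)$ for $1\le j\le k$; (ii) there is an embedded submanifold $U_x$ of $SM$ with $U_x\subset\mathcal V$ such that $x$ lies in the interior of the image of $U_x$ under the projection $SM\to M$; (iii) there are $v_1,\dots,v_m\in\mathcal V(x)$ that span $T_xM$ and such that, for each $i$, $\phi_t(x,v_i)\in\mathcal V$ for all $t$ in a neighbourhood of $0$, where $\phi_t$ is the geodesic flow. For $(v,w)\in\mathcal E(x)$ put $S^A(x,v,w)=P^A_{\gamma_{x,w}}\,(P^A_{\gamma_{x,v}})^{-1}$.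 Let $\mathrm U_\pm(n)=\mathrm U(n)/\{\pm I\}$, with classes $[u]$. A map $\psi:M\to\mathrm U_\pm(n)$ is smooth if and only if near every point of $M$ it has the form $\psi=[\varphi]$ with $\varphi$ smooth and $\mathrm U(n)$-valued; then $A\triangleleft\psi$ denotes the one-form given locally by $\varphi^{-1}d\varphi+\varphi^{-1}A\varphi$, which does not depend on the choice of $\varphi$. Corollary. Let $A_1,A_2$ be smooth Hermitian connections on $M\times\mathbb C^n$ and let $(\mathcal V,\mathcal E)$ be a complete geodesic graph structure on $(M,g)$. Then the following are equivalent: (a) for every $x\in M^{\circ}$ and every $(v,w)\in\mathcal E(x)$, $S^{A_1}(x,v,w)=S^{A_2}(x,v,w)$ or $S^{A_1}(x,v,w)=-S^{A_2}(x,v,w)$ (the sign may depend on $(x,v,w)$); (b) there is a smooth map $\psi:M\to\mathrm U_\pm(n)$ such that $A_2=A_1\triangleleft\psi$ on $M$ and $\psi|_{\partial M}=[I]$. -/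

import Mathlib

open Set Filter Topology Bundle
open scoped Manifold ContDiff Matrix Matrix.Norms.L2Operator

noncomputable section

namespace BrokenXRay

/-- The model vector space `ℝᵐ`. -/
abbrev Model (m : ℕ) : Type := EuclideanSpace ℝ (Fin m)

/-- The group `U(n)`. -/
abbrev U (n : ℕ) : Type := Matrix.unitaryGroup (Fin n) ℂ

/-- The subgroup `{I, -I}` of `U(n)`. -/
def signSubgroup (n : ℕ) : Subgroup (U n) where
  carrier := {u | u = 1 ∨ u = -1}
  one_mem' := Or.inl rfl
  mul_mem' := by
    rintro a b (rfl | rfl) (rfl | rfl) <;> simp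
  inv_mem' := by
    rintro a (rfl | rfl) <;> simp

/-- The quotient `U(n) / {±I}`. -/
abbrev Upm (n : ℕ) : Type := U n ⧸ signSubgroup n

/-- The class `[u]` of `u` in `U(n) / {±I}`. -/
def cls {n : ℕ} (u : U n) : Upm n := QuotientGroup.mk u

section Manifold

variable {m : ℕ} [NeZero m] {M : Type*} [TopologicalSpace M]
  [ChartedSpace (EuclideanHalfSpace m) M] [IsManifold (𝓡∂ m) ∞ M]

/-! ### Riemannian metrics and geodesics -/

variable (m M) in
/-- Smooth Riemannian metrics on the manifold with boundary `M`. -/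
abbrev SmoothMetric : Type _ :=
  ContMDiffRiemannianMetric (𝓡∂ m) ∞ (Model m) (fun x : M => TangentSpace (𝓡∂ m) x)

/-- The metric in the coordinates of the chart around `x₀`: the value at the coordinate point `y`
on the pair of coordinate vectors `a, b`. -/
def metricInChart (g : SmoothMetric m M) (x₀ : M) (y a b : Model m) : ℝ :=
  g.inner ((extChartAt (𝓡∂ m) x₀).symm y)
    (mfderivWithin 𝓘(ℝ, Model m) (𝓡∂ m) (extChartAt (𝓡∂ m) x₀).symm (range (𝓡∂ m)) y a)
    (mfderivWithin 𝓘(ℝ, Model m) (𝓡∂ m) (extChartAt (𝓡∂ m) x₀).symm (range (𝓡∂ m)) y b)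

/-- The Christoffel symbols of the first kind in the chart around `x₀`, contracted with constant
coordinate vector fields:
`Γ(a, b; c) = (∂_a g(b, c) + ∂_b g(a, c) - ∂_c g(a, b)) / 2`. -/
def christoffel (g : SmoothMetric m M) (x₀ : M) (y a b c : Model m) : ℝ :=
  (fderivWithin ℝ (fun z => metricInChart g x₀ z b c) (range (𝓡∂ m)) y a
    + fderivWithin ℝ (fun z => metricInChart g x₀ z a c) (range (𝓡∂ m)) y b
    - fderivWithin ℝ (fun z => metricInChart g x₀ z a b) (range (𝓡∂ m)) y c) / 2

/-- The point `(γ(t), γ'(t))` of `TM`, for a curve `γ` parametrised by the set `s ⊆ ℝ`. -/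
def velocity (γ : ℝ → M) (s : Set ℝ) (t : ℝ) : TangentBundle (𝓡∂ m) M :=
  ⟨γ t, mfderivWithin 𝓘(ℝ, ℝ) (𝓡∂ m) γ s t (1 : ℝ)⟩

/-- `γ : s → M` is a smooth geodesic (`s` is an interval): in every chart the coordinate curve `c`
satisfies the geodesic equation `g_{kl} c̈^l + Γ_{kij} ċ^i ċ^j = 0` (with the index lowered). -/
structure IsGeodesicOn (g : SmoothMetric m M) (γ : ℝ → M) (s : Set ℝ) : Prop where
  smooth : ContMDiffOn 𝓘(ℝ, ℝ) (𝓡∂ m) ∞ γ s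
  geodesic_eq : ∀ x₀ : M, ∀ t ∈ s, γ t ∈ (extChartAt (𝓡∂ m) x₀).source →
    ∀ w : Model m,
      let c : ℝ → Model m := fun r => extChartAt (𝓡∂ m) x₀ (γ r)
      metricInChart g x₀ (c t) (derivWithin (derivWithin c s) s t) w
        + christoffel g x₀ (c t) (derivWithin c s t) (derivWithin c s t) w = 0

/-- The vector `p`, based at a boundary point `y`, is tangent to the boundary: its image under the
differential of a chart at `y`, with values in the half-space `{z₀ ≥ 0}`, lies in `{z₀ = 0}`. -/
def IsTangentToBoundary (p : TangentBundle (𝓡∂ m) M) : Prop :=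
  let u : Model m := mfderiv (𝓡∂ m) 𝓘(ℝ, Model m) (extChartAt (𝓡∂ m) p.proj) p.proj p.snd
  u 0 = 0

/-- `γ : [0, τ] → M` is a unit speed nontangential geodesic with initial condition `p = (x, v)`:
it stays in the interior of `M` on `[0, τ)`, and reaches the boundary transversally at time `τ`.
-/
structure IsNontangentialGeodesic (g : SmoothMetric m M) (p : TangentBundle (𝓡∂ m) M)
    (γ : ℝ → M) (τ : ℝ) : Prop where
  pos : 0 < τ
  unit : g.inner p.proj p.snd p.snd = 1
  geodesic : IsGeodesicOn g γ (Icc 0 τ)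
  initial : velocity γ (Icc 0 τ) 0 = p
  interior : ∀ t ∈ Ico 0 τ, γ t ∈ (𝓡∂ m).interior M
  boundary : γ τ ∈ (𝓡∂ m).boundary M
  transversal : ¬ IsTangentToBoundary (m := m) (velocity γ (Icc 0 τ) τ)

/-- `p = (x, v)` is the initial condition of a unit speed nontangential geodesic. -/
def IsNontangential (g : SmoothMetric m M) (p : TangentBundle (𝓡∂ m) M) : Prop :=
  ∃ (γ : ℝ → M) (τ : ℝ), IsNontangentialGeodesic g p γ τ

open Classical in
/-- The nontangential geodesic `γ_{x,v}`, with its exit time `τ(x, v)`, for nontangential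
`p = (x, v)`. On `[0, τ(x, v)]` it is determined by `p`. For other `p` the value is irrelevant. -/
def exitGeodesic (g : SmoothMetric m M) (p : TangentBundle (𝓡∂ m) M) : (ℝ → M) × ℝ :=
  if h : IsNontangential g p then (h.choose, h.choose_spec.choose) else (fun _ => p.proj, 0)

/-- The geodesic `γ_{x,v}`. -/
def geo (g : SmoothMetric m M) (p : TangentBundle (𝓡∂ m) M) : ℝ → M := (exitGeodesic g p).1

/-- The exit time `τ(x, v)`. -/
def exitTime (g : SmoothMetric m M) (p : TangentBundle (𝓡∂ m) M) : ℝ := (exitGeodesic g p).2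

theorem isNontangentialGeodesic_geo {g : SmoothMetric m M} {p : TangentBundle (𝓡∂ m) M}
    (h : IsNontangential g p) : IsNontangentialGeodesic g p (geo g p) (exitTime g p) := by
  simpa [geo, exitTime, exitGeodesic, h] using h.choose_spec.choose_spec

/-- The scattering map `α(x, v) = γ_{x,v}(τ(x, v))`. -/
def scatteringMap (g : SmoothMetric m M) (p : TangentBundle (𝓡∂ m) M) : M := geo g p (exitTime g p)

/-! ### Geodesic graph structures -/

/-- A geodesic graph structure: for each interior point `x`, a set `V x` of initial directions of
unit speed nontangential geodesics from `x` and a set `E x` of pairs `(v, w)` in `V x` with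
`v ≠ ±w`. (The condition `nontangential` forces `V x = ∅` for `x ∈ ∂M`.) -/
structure GeodesicGraph (g : SmoothMetric m M) where
  V : ∀ x : M, Set (TangentSpace (𝓡∂ m) x)
  E : ∀ x : M, Set (TangentSpace (𝓡∂ m) x × TangentSpace (𝓡∂ m) x)
  nontangential : ∀ (x : M), ∀ v ∈ V x, IsNontangential g ⟨x, v⟩
  edges : ∀ (x : M), ∀ e ∈ E x, e.1 ∈ V x ∧ e.2 ∈ V x ∧ e.1 ≠ e.2 ∧ e.1 ≠ -e.2

/-- The union of the sets `V x`, as a subset of `TM` (in fact of the unit sphere bundle `SM`). -/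
def GeodesicGraph.total {g : SmoothMetric m M} (G : GeodesicGraph g) :
    Set (TangentBundle (𝓡∂ m) M) :=
  {p | p.snd ∈ G.V p.proj}

/-- `S ⊆ TM` is a (boundaryless) smooth embedded submanifold. For subsets of the unit sphere bundle
`SM`, itself an embedded submanifold of `TM`, this is the same as being an embedded submanifold of
`SM`. -/
def IsEmbeddedSubmanifold (S : Set (TangentBundle (𝓡∂ m) M)) : Prop :=
  ∃ (k : ℕ) (_ : ChartedSpace (EuclideanSpace ℝ (Fin k)) S),
    IsManifold (𝓡 k) ∞ S ∧
    Manifold.IsSmoothEmbedding (𝓡 k) (𝓡∂ m).tangent ∞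
      (Subtype.val : S → TangentBundle (𝓡∂ m) M)

/-- A complete geodesic graph structure. -/
structure GeodesicGraph.IsComplete {g : SmoothMetric m M} (G : GeodesicGraph g) : Prop where
  dense : (𝓡∂ m).boundary M ⊆ closure (scatteringMap g '' G.total)
  connected : ∀ x ∈ (𝓡∂ m).interior M, ∀ v ∈ G.V x, ∀ w ∈ G.V x,
    Relation.ReflTransGen (fun a b => (a, b) ∈ G.E x) v w
  submanifold : ∀ x ∈ (𝓡∂ m).interior M, ∃ S : Set (TangentBundle (𝓡∂ m) M),
    IsEmbeddedSubmanifold S ∧ S ⊆ G.total ∧ x ∈ interior (TotalSpace.proj '' S)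
  /-- The curve `t ↦ velocity γ (Ioo (-ε) ε) t` is the orbit of `(x, v i)` under the geodesic flow
  for small times. -/
  spanning : ∀ x ∈ (𝓡∂ m).interior M, ∃ v : Fin m → TangentSpace (𝓡∂ m) x,
    (∀ i, v i ∈ G.V x) ∧ Submodule.span ℝ (range v) = ⊤ ∧
    ∀ i, ∃ ε > 0, ∃ γ : ℝ → M, IsGeodesicOn g γ (Ioo (-ε) ε) ∧
      velocity γ (Ioo (-ε) ε) 0 = (⟨x, v i⟩ : TangentBundle (𝓡∂ m) M) ∧
      ∀ t ∈ Ioo (-ε) ε, velocity γ (Ioo (-ε) ε) t ∈ G.total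

/-! ### Connections, parallel transport and scattering data -/

variable (m M) in
/-- A smooth Hermitian connection on `M × ℂⁿ`, that is, a smooth one-form on `M` with values in the
skew-Hermitian matrices. Smoothness is that of the associated function on `TM`. -/
structure HermitianConnection (n : ℕ) where
  form : ∀ x : M, TangentSpace (𝓡∂ m) x →L[ℝ] Matrix (Fin n) (Fin n) ℂ
  skew : ∀ (x : M) (v : TangentSpace (𝓡∂ m) x), (form x v)ᴴ = -form x v
  smooth : ContMDiff (𝓡∂ m).tangent 𝓘(ℝ, Matrix (Fin n) (Fin n) ℂ) ∞
    (fun p : TangentBundle (𝓡∂ m) M => form p.proj p.snd)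

variable {n : ℕ}

/-- `W : [0, τ] → ℂ^{n × n}` solves `W' + A_γ(γ') W = 0` and `W(0) = I`. -/
def IsTransportSolution (A : HermitianConnection m M n) (γ : ℝ → M) (τ : ℝ)
    (W : ℝ → Matrix (Fin n) (Fin n) ℂ) : Prop :=
  W 0 = 1 ∧ ∀ t ∈ Icc 0 τ,
    HasDerivWithinAt W
      (-(A.form (γ t) (mfderivWithin 𝓘(ℝ, ℝ) (𝓡∂ m) γ (Icc 0 τ) t (1 : ℝ)) * W t)) (Icc 0 τ) t

open Classical in
/-- Parallel transport `P^A_γ = W(τ)` along `γ : [0, τ] → M`, where `W` is the solution (unique on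
`[0, τ]`, and existing for all smooth `γ`) of the transport equation. -/
def parallelTransport (A : HermitianConnection m M n) (γ : ℝ → M) (τ : ℝ) :
    Matrix (Fin n) (Fin n) ℂ :=
  if h : ∃ W, IsTransportSolution A γ τ W then h.choose τ else 1

/-- `P^A` along the geodesic `γ_{x,v}` up to its exit time. -/
def geodesicTransport (g : SmoothMetric m M) (A : HermitianConnection m M n)
    (p : TangentBundle (𝓡∂ m) M) : Matrix (Fin n) (Fin n) ℂ :=
  parallelTransport A (geo g p) (exitTime g p)

/-- The broken non-abelian X-ray transform
`S^A(x, v, w) = P^A_{γ_{x,w}} (P^A_{γ_{x,v}})⁻¹`. -/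
def scatteringData (g : SmoothMetric m M) (A : HermitianConnection m M n) (x : M)
    (v w : TangentSpace (𝓡∂ m) x) : Matrix (Fin n) (Fin n) ℂ :=
  geodesicTransport g A ⟨x, w⟩ * (geodesicTransport g A ⟨x, v⟩)⁻¹

/-! ### Gauge transformations -/

/-- The differential `dφ` of `φ : M → U(n)`, seen as a matrix-valued map, at `x` on `v`. -/
def matrixDifferential (φ : M → U n) (x : M) (v : TangentSpace (𝓡∂ m) x) :
    Matrix (Fin n) (Fin n) ℂ :=
  mfderiv (𝓡∂ m) 𝓘(ℝ, Matrix (Fin n) (Fin n) ℂ)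
    (fun y => (φ y : Matrix (Fin n) (Fin n) ℂ)) x v

/-- The one-form `A ◁ φ = φ⁻¹ dφ + φ⁻¹ A φ`, at the point `x` and on the tangent vector `v`. -/
def gaugeAct (A : HermitianConnection m M n) (φ : M → U n) (x : M) (v : TangentSpace (𝓡∂ m) x) :
    Matrix (Fin n) (Fin n) ℂ :=
  (φ x : Matrix (Fin n) (Fin n) ℂ)⁻¹ * matrixDifferential φ x v
    + (φ x : Matrix (Fin n) (Fin n) ℂ)⁻¹ * A.form x v * (φ x : Matrix (Fin n) (Fin n) ℂ)

/-- On a neighbourhood of `x`, `φ` is a smooth lift to `U(n)` of `ψ : M → U(n)/{±I}`. -/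
def IsSmoothLiftAt (ψ : M → Upm n) (x : M) (φ : M → U n) : Prop :=
  ∃ O : Set M, IsOpen O ∧ x ∈ O ∧
    ContMDiffOn (𝓡∂ m) 𝓘(ℝ, Matrix (Fin n) (Fin n) ℂ) ∞
      (fun y => (φ y : Matrix (Fin n) (Fin n) ℂ)) O ∧
    ∀ y ∈ O, cls (φ y) = ψ y

/-- Smoothness of `ψ : M → U(n)/{±I}`. As `U(n) → U(n)/{±I}` is a covering map and a local
diffeomorphism, this is the existence of local smooth lifts. -/
def IsSmoothUpm (ψ : M → Upm n) : Prop := ∀ x : M, ∃ φ, IsSmoothLiftAt (m := m) ψ x φ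

open Classical in
/-- The one-form `A ◁ ψ` for `ψ : M → U(n)/{±I}`: at `x` it is `A ◁ φ` for any local smooth
lift `φ` of `ψ` near `x`. -/
def gaugeActPm (A : HermitianConnection m M n) (ψ : M → Upm n) (x : M)
    (v : TangentSpace (𝓡∂ m) x) : Matrix (Fin n) (Fin n) ℂ :=
  if h : ∃ φ, IsSmoothLiftAt (m := m) ψ x φ then gaugeAct A h.choose x v else 0

theorem cls_eq_iff {u w : U n} : cls u = cls w ↔ w = u ∨ w = -u := by
  unfold cls
  rw [QuotientGroup.eq]
  change (u⁻¹ * w = 1 ∨ u⁻¹ * w = -1) ↔ _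
  rw [inv_mul_eq_iff_eq_mul, inv_mul_eq_iff_eq_mul]
  simp

theorem gaugeAct_congr (A : HermitianConnection m M n) {x : M} {φ φ' : M → U n}
    (h : φ' =ᶠ[𝓝 x] φ) (v : TangentSpace (𝓡∂ m) x) :
    gaugeAct A φ' x v = gaugeAct A φ x v := by
  have h1 : (fun y => (φ' y : Matrix (Fin n) (Fin n) ℂ)) =ᶠ[𝓝 x]
      (fun y => (φ y : Matrix (Fin n) (Fin n) ℂ)) := h.fun_comp Subtype.val
  unfold gaugeAct matrixDifferential
  rw [h1.mfderiv_eq, h.eq_of_nhds]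

theorem unitary_neg_coe (u : U n) :
    ((-u : U n) : Matrix (Fin n) (Fin n) ℂ) = -(u : Matrix (Fin n) (Fin n) ℂ) := rfl

theorem gaugeAct_neg (A : HermitianConnection m M n) {x : M} (φ : M → U n)
    (v : TangentSpace (𝓡∂ m) x) :
    gaugeAct A (fun y => -φ y) x v = gaugeAct A φ x v := by
  have h1 : (fun y => ((-φ y : U n) : Matrix (Fin n) (Fin n) ℂ)) =
      -(fun y => (φ y : Matrix (Fin n) (Fin n) ℂ)) := rfl
  have h2 : ((-φ x : U n) : Matrix (Fin n) (Fin n) ℂ)⁻¹ =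
      -(φ x : Matrix (Fin n) (Fin n) ℂ)⁻¹ := by
    apply Matrix.inv_eq_left_inv
    have h3 : (φ x : Matrix (Fin n) (Fin n) ℂ)⁻¹ * (φ x : Matrix (Fin n) (Fin n) ℂ) = 1 := by
      apply Matrix.nonsing_inv_mul
      exact Matrix.UnitaryGroup.det_isUnit (φ x)
    rw [unitary_neg_coe, neg_mul_neg, h3]
  have h4 : matrixDifferential (fun y => -φ y) x v = -matrixDifferential φ x v := by
    unfold matrixDifferential
    rw [h1, mfderiv_neg]
    rfl
  unfold gaugeAct
  rw [h4, h2, unitary_neg_coe, neg_mul_neg, neg_mul, neg_mul_neg]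

/-- `A ◁ ψ` does not depend on the choice of the local lift. -/
theorem gaugeActPm_eq (A : HermitianConnection m M n) {ψ : M → Upm n} {x : M} {φ : M → U n}
    (hφ : IsSmoothLiftAt (m := m) ψ x φ) (v : TangentSpace (𝓡∂ m) x) :
    gaugeActPm A ψ x v = gaugeAct A φ x v := by
  have h : ∃ φ, IsSmoothLiftAt (m := m) ψ x φ := ⟨φ, hφ⟩
  rw [gaugeActPm, dif_pos h]
  generalize hf : h.choose = f
  have hf' : IsSmoothLiftAt (m := m) ψ x f := hf ▸ h.choose_spec
  obtain ⟨O, hO, hxO, hs, hl⟩ := hφ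
  obtain ⟨O', hO', hxO', hs', hl'⟩ := hf'
  have hc : ContinuousAt (fun y => (φ y : Matrix (Fin n) (Fin n) ℂ)) x :=
    (hs.continuousOn x hxO).continuousAt (hO.mem_nhds hxO)
  have hc' : ContinuousAt (fun y => (f y : Matrix (Fin n) (Fin n) ℂ)) x :=
    (hs'.continuousOn x hxO').continuousAt (hO'.mem_nhds hxO')
  have key : ∀ᶠ y in 𝓝 x, f y = φ y ∨ f y = -φ y := by
    filter_upwards [hO.mem_nhds hxO, hO'.mem_nhds hxO'] with y hy hy'
    exact cls_eq_iff.1 ((hl y hy).trans (hl' y hy').symm)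
  -- near `x`, only one of the two signs can occur, by continuity
  have hne : ∀ u : U n, (u : Matrix (Fin n) (Fin n) ℂ) = -u → n = 0 := by
    intro u hu
    by_contra hn
    have h0 : (u : Matrix (Fin n) (Fin n) ℂ) = 0 := by
      ext i j
      exact self_eq_neg.1 (congr_fun (congr_fun hu i) j)
    have h1 := Matrix.UnitaryGroup.star_mul_self u
    rw [h0, mul_zero] at h1
    have := congr_fun (congr_fun h1 ⟨0, Nat.pos_of_ne_zero hn⟩) ⟨0, Nat.pos_of_ne_zero hn⟩
    simp at this
  by_cases hn : n = 0
  · subst hn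
    ext i
    exact i.elim0
  rcases key.self_of_nhds with hx | hx
  · refine gaugeAct_congr A ?_ v
    have hsum : ∀ᶠ y in 𝓝 x, (f y : Matrix (Fin n) (Fin n) ℂ) + φ y ≠ 0 := by
      refine (hc'.add hc).eventually_ne fun h0 => hn (hne (φ x) ?_)
      change (f x : Matrix (Fin n) (Fin n) ℂ) + φ x = 0 at h0
      rw [hx] at h0
      exact eq_neg_of_add_eq_zero_left h0
    filter_upwards [key, hsum] with y hy hy'
    rcases hy with hy | hy
    · exact hy
    · exact absurd (by rw [hy]; exact neg_add_cancel _) hy'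
  · rw [← gaugeAct_neg A φ v]
    refine gaugeAct_congr A ?_ v
    have hsum : ∀ᶠ y in 𝓝 x, (f y : Matrix (Fin n) (Fin n) ℂ) - φ y ≠ 0 := by
      refine (hc'.sub hc).eventually_ne fun h0 => hn (hne (φ x) ?_)
      change (f x : Matrix (Fin n) (Fin n) ℂ) - φ x = 0 at h0
      rw [hx] at h0
      exact (sub_eq_zero.1 h0).symm
    filter_upwards [key, hsum] with y hy hy'
    rcases hy with hy | hy
    · exact absurd (by rw [hy]; exact sub_self _) hy'
    · exact hy

end Manifold

end BrokenXRay

end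

open BrokenXRay

/-!
# Broken X-ray data determine a Hermitian connection up to gauge and signs

Signs are removed by the tensor square `tsq u = u ⊗ u`: since `tsq (-u) = tsq u` and `tsq u`
determines `u` up to sign (`tsq_eq_iff`), a `U(n)/{±1}`-valued map is the same thing as a
matrix-valued map of the form `tsq φ`. The equation `A₂ = A₁ ◁ φ` becomes the linear parallel
equation `dQ = Q (A₂ ⊗ 1 + 1 ⊗ A₂) - (A₁ ⊗ 1 + 1 ⊗ A₁) Q` for `Q = tsq φ`
(`isParallelAt_tsq_iff_gaugeActPm`). Write `Pᵢ(v)` for the transport of `Aᵢ` along the geodesic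
from `x` in direction `v`.

*Equal data give a gauge.* On an edge `(v, w)` at `x`, the data agree up to sign if and only if
`P₁(v)⁻¹ P₂(v) = ± P₁(w)⁻¹ P₂(w)` (`scatteringData_eq_or_eq_neg_iff`). As the graph at `x` is
connected, `Q(x) = tsq (P₁(v)⁻¹ P₂(v))` does not depend on `v` (`exists_isRelativeGauge`). It
remains to see that `Q` is smooth and parallel, and equal to `1` at the boundary.

* Transports factor along geodesics, so `Q` satisfies the parallel equation along every geodesic
  which stays in the graph (`IsRelativeGauge.hasDerivAt`). At each interior point there are such
  geodesics in spanning directions, but they are chosen independently at different points, and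
  this alone does not make `Q` continuous.
* Geodesics and transports depend continuously on the initial condition, up to a transversal
  exit (`tendsto_exit`, `continuousOn_geodesicTransport`). So `Q` is continuous on the image in
  `M` of every compact subset of the submanifolds `Uₓ`, and each `x` has a neighbourhood covered
  by countably many such images. A Baire category argument, using the prescribed derivatives
  along the geodesics, then makes `Q` continuous (`continuousAt_of_hasSpanningDerivAt`).
* A continuous function with continuous prescribed derivatives in spanning directions is
  differentiable: for a real function `f` with derivatives close to zero, compare with the cone
  `ε ‖x - y‖` plus a quadratic term; a local maximum of the difference contradicts the prescribed
  derivatives (`hasFDerivAt_of_hasSpanningDerivAt`). Hence `Q` is parallel in the interior.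
* The parallel equation bounds the derivative of `Q`, so `Q` is Lipschitz near the boundary.
  At an end point of a geodesic of the graph, `Q` tends to `1` along the geodesic; since these
  end points are dense in `∂M`, `Q` tends to `1` everywhere at the boundary. So `Q` is continuous
  on `M`, is parallel up to the boundary (`IsRelativeGauge.isParallelAt`), and is smooth by
  bootstrapping (`IsRelativeGauge.contMDiff`). Locally `u` is a smooth function of `tsq u`, up to
  sign, which yields smooth `U(n)`-valued lifts (`exists_isSmoothLiftAt`).

*A gauge gives equal data.* If `Q` is parallel with `Q = 1` on `∂M`, then along a geodesic to the
boundary the conjugate of `Q` by the transports is constant, so `Q(x) = tsq (P₁(v)⁻¹ P₂(v))` for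
every nontangential direction `v` at `x` (`tsq_eq_of_isParallelAt`), and the data on an edge agree
up to sign by the same equivalence as before.

The geodesic flow is treated in charts, jointly with the parallel transport, as a first order
system on the half space (`stateField`); only uniqueness and continuous dependence of solutions
are needed.
-/

noncomputable section

namespace BrokenXRay

section
open Metric
open scoped NNReal

/-! ### Linear differential equations and continuation -/

theorem exists_linearODE_step {V : Type*} [NormedAddCommGroup V] [NormedSpace ℝ V] [CompleteSpace V]
    {B : ℝ → V →L[ℝ] V} (hB : Continuous B) {C : ℝ≥0} (hC : ∀ t, ‖B t‖ ≤ C) {h : ℝ} (h0 : 0 ≤ h)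
    (hCh : C * h ≤ 1 / 2) (t₀ : ℝ) (w : V) :
    ∃ W : ℝ → V, W t₀ = w ∧
      ∀ t ∈ Icc t₀ (t₀ + h), HasDerivWithinAt W (B t (W t)) (Icc t₀ (t₀ + h)) t := by
  have hP : IsPicardLindelof (fun t x => B t x)
      (⟨t₀, ⟨le_refl _, by linarith⟩⟩ : Icc t₀ (t₀ + h)) w (‖w‖₊ + 1) 0 (C * (2 * ‖w‖₊ + 1)) C := by
    refine ⟨fun t _ => ?_, fun x _ => ?_, fun t _ x hx => ?_, ?_⟩
    · exact ((B t).lipschitz.weaken (by exact_mod_cast hC t)).lipschitzOnWith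
    · exact (hB.clm_apply continuous_const).continuousOn
    · refine ((B t).le_of_opNorm_le (hC t) x).trans ?_
      have : ‖x‖ ≤ 2 * ‖w‖ + 1 := by
        have h1 : ‖x - w‖ ≤ ‖w‖ + 1 := by simpa [dist_eq_norm] using hx
        have h2 := norm_add_le (x - w) w
        rw [sub_add_cancel] at h2
        linarith
      push_cast
      exact mul_le_mul_of_nonneg_left this C.2
    · have : max (t₀ + h - t₀) (t₀ - t₀) = h := by simp [h0]
      simp only [this]
      push_cast
      nlinarith [norm_nonneg w]
  obtain ⟨α, h1, h2⟩ := hP.exists_eq_forall_mem_Icc_hasDerivWithinAt₀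
  exact ⟨α, h1, h2⟩

/-- Solutions of a linear equation with bounded continuous coefficients exist on every interval:
solutions on intervals of a fixed length are concatenated. -/
theorem exists_linearODE_nat {V : Type*} [NormedAddCommGroup V] [NormedSpace ℝ V] [CompleteSpace V]
    {B : ℝ → V →L[ℝ] V} (hB : Continuous B) {C : ℝ≥0} (hC : ∀ t, ‖B t‖ ≤ C) {h : ℝ} (h0 : 0 ≤ h)
    (hCh : C * h ≤ 1 / 2) (w : V) (k : ℕ) :
    ∃ W : ℝ → V, W 0 = w ∧
      ∀ t ∈ Icc 0 (k * h), HasDerivWithinAt W (B t (W t)) (Icc 0 (k * h)) t := by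
  induction k with
  | zero =>
    refine ⟨fun _ => w, rfl, fun t ht => ?_⟩
    have : Icc (0 : ℝ) ((0 : ℕ) * h) = {0} := by simp
    rw [this] at ht ⊢
    rw [ht]
    exact HasFDerivWithinAt.of_subsingleton subsingleton_singleton
  | succ k ih =>
    obtain ⟨W₁, hw, h₁⟩ := ih
    set T : ℝ := k * h with hT
    have hT0 : 0 ≤ T := by positivity
    obtain ⟨W₂, hw₂, h₂⟩ := exists_linearODE_step hB hC h0 hCh T (W₁ T)
    have hT' : ((k + 1 : ℕ) : ℝ) * h = T + h := by push_cast; ring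
    rw [hT']
    set W : ℝ → V := fun t => if t ≤ T then W₁ t else W₂ t with hW
    have e₁ : ∀ t ∈ Icc 0 T, W t = W₁ t := fun t ht => if_pos ht.2
    have e₂ : ∀ t ∈ Icc T (T + h), W t = W₂ t := by
      intro t ht
      rcases ht.1.eq_or_lt with rfl | h'
      · rw [hW]; simp [hw₂]
      · exact if_neg (not_le.2 h')
    refine ⟨W, by rw [e₁ 0 ⟨le_refl _, hT0⟩, hw], fun t ht => ?_⟩
    have d₁ : HasDerivWithinAt W (B t (W t)) (Icc 0 T) t := by
      by_cases h' : t ≤ T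
      · rw [e₁ t ⟨ht.1, h'⟩]
        exact (h₁ t ⟨ht.1, h'⟩).congr e₁ (e₁ t ⟨ht.1, h'⟩)
      · exact HasFDerivWithinAt.of_notMem_closure
          (by rw [isClosed_Icc.closure_eq]; exact fun h'' => h' h''.2)
    have d₂ : HasDerivWithinAt W (B t (W t)) (Icc T (T + h)) t := by
      by_cases h' : T ≤ t
      · rw [e₂ t ⟨h', ht.2⟩]
        exact (h₂ t ⟨h', ht.2⟩).congr e₂ (e₂ t ⟨h', ht.2⟩)
      · exact HasFDerivWithinAt.of_notMem_closure
          (by rw [isClosed_Icc.closure_eq]; exact fun h'' => h' h''.1)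
    rw [← Icc_union_Icc_eq_Icc hT0 (by linarith : T ≤ T + h)]
    exact d₁.union d₂

theorem exists_linearODE {V : Type*} [NormedAddCommGroup V] [NormedSpace ℝ V] [CompleteSpace V]
    {τ : ℝ} (hτ : 0 ≤ τ) {B : ℝ → V →L[ℝ] V} (hB : ContinuousOn B (Icc 0 τ)) (w : V) :
    ∃ W : ℝ → V, W 0 = w ∧ ∀ t ∈ Icc 0 τ, HasDerivWithinAt W (B t (W t)) (Icc 0 τ) t := by
  set B' : ℝ → V →L[ℝ] V := IccExtend hτ ((Icc 0 τ).domRestrict B) with hB'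
  have hc : Continuous B' := (continuousOn_iff_continuous_domRestrict.1 hB).Icc_extend'
  obtain ⟨C, hC⟩ := isCompact_Icc.exists_bound_of_continuousOn hB
  have hC' : ∀ t, ‖B' t‖ ≤ C.toNNReal := fun t =>
    (hC _ (projIcc 0 τ hτ t).2).trans (Real.le_coe_toNNReal C)
  set h : ℝ := 1 / (2 * (C.toNNReal + 1)) with hh
  have hpos : 0 < h := by positivity
  have hCh : C.toNNReal * h ≤ 1 / 2 := by
    rw [hh, mul_one_div, div_le_div_iff₀ (by positivity) (by norm_num)]
    linarith
  obtain ⟨k, hk⟩ := exists_nat_ge (τ / h)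
  rw [div_le_iff₀ hpos] at hk
  obtain ⟨W, hw, hW⟩ := exists_linearODE_nat hc hC' hpos.le hCh w k
  refine ⟨W, hw, fun t ht => ?_⟩
  have := (hW t ⟨ht.1, ht.2.trans hk⟩).mono (Icc_subset_Icc_right hk)
  rwa [hB', IccExtend_of_mem hτ _ ht, domRestrict_apply] at this

/-- Continuation: a path starting in `R'` stays there if it does so as long as it stays in
`R ⊇ R'`. -/
theorem forall_mem_Icc_of_confined {T : Type*} [TopologicalSpace T] {Y : ℝ → T} {a b : ℝ}
    {R R' : Set T} (hY : ContinuousOn Y (Icc a b)) (hR : IsClosed R) (hR' : IsOpen R')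
    (hsub : R' ⊆ R) (h0 : Y a ∈ R')
    (h : ∀ t ∈ Icc a b, (∀ u ∈ Icc a t, Y u ∈ R) → Y t ∈ R') :
    ∀ t ∈ Icc a b, Y t ∈ R' := by
  rcases lt_or_ge b a with hba | hab
  · intro t ht; exact absurd (ht.1.trans ht.2) (not_le.2 hba)
  suffices Icc a b ⊆ {t | ∀ u ∈ Icc a t, Y u ∈ R} from fun t ht => h t ht (this ht)
  refine IsClosed.Icc_subset_of_forall_exists_gt ?_ ?_ ?_
  · have h1 : IsClosed (Icc a b ∩ Y ⁻¹' R) := hY.preimage_isClosed_of_isClosed isClosed_Icc hR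
    refine isClosed_of_closure_subset fun t ht => ?_
    have htI : t ∈ Icc a b := isClosed_Icc.closure_subset_iff.2 inter_subset_right ht
    refine ⟨fun u hu => ?_, htI⟩
    rcases hu.2.eq_or_lt with rfl | hut
    · have : ({t | ∀ u ∈ Icc a t, Y u ∈ R} ∩ Icc a b) ⊆ Icc a b ∩ Y ⁻¹' R := fun s hs =>
        ⟨hs.2, hs.1 s ⟨hs.2.1, le_rfl⟩⟩
      exact (h1.closure_subset_iff.2 this ht).2
    · obtain ⟨s, hs, hus⟩ := (mem_closure_iff.1 ht (Ioi u) isOpen_Ioi hut)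
      exact hus.1 u ⟨hu.1, le_of_lt hs⟩
  · intro u hu
    have : u = a := le_antisymm hu.2 hu.1
    rw [this]; exact hsub h0
  · rintro t ⟨ht, htI⟩ y hy
    have htY : Y t ∈ R' := h t ⟨htI.1, htI.2.le⟩ ht
    have h1 : ∀ᶠ u in 𝓝[Icc a b] t, Y u ∈ R' :=
      (hY t ⟨htI.1, htI.2.le⟩).eventually (hR'.mem_nhds htY)
    rw [eventually_nhdsWithin_iff] at h1
    obtain ⟨δ, hδ, H⟩ := Metric.eventually_nhds_iff_ball.1 h1
    set s := min (min y b) (t + δ / 2) with hs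
    have hts : t < s := lt_min (lt_min hy htI.2) (by linarith)
    refine ⟨s, fun u hu => ?_, hts, (min_le_left _ _).trans (min_le_left _ _)⟩
    rcases le_or_gt u t with hut | hut
    · exact ht u ⟨hu.1, hut⟩
    · refine hsub (H u ?_ ⟨hu.1, hu.2.trans ((min_le_left _ _).trans (min_le_right _ _))⟩)
      have : u ≤ t + δ / 2 := hu.2.trans (min_le_right _ _)
      rw [mem_ball, Real.dist_eq, abs_lt]
      constructor <;> linarith

/-! ### Functions with prescribed derivatives along curves -/

/-- `L` prescribes the derivative of `f` along curves through `x` in spanning directions. This is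
much weaker than differentiability of `f` at `x`: the curves depend on `x` in an arbitrary way. -/
def HasSpanningDerivAt {E V : Type*} [NormedAddCommGroup E] [NormedSpace ℝ E]
    [NormedAddCommGroup V] [NormedSpace ℝ V] (f : E → V) (L : E →L[ℝ] V) (x : E) : Prop :=
  ∃ S : Set E, Submodule.span ℝ S = ⊤ ∧ ∀ v ∈ S, ∃ c : ℝ → E,
    c 0 = x ∧ HasDerivAt c v 0 ∧ HasDerivAt (fun t => f (c t)) (L v) 0

section
variable {E V V' : Type*} [NormedAddCommGroup E] [InnerProductSpace ℝ E]
    [NormedAddCommGroup V] [NormedSpace ℝ V] [NormedAddCommGroup V'] [NormedSpace ℝ V']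

theorem HasSpanningDerivAt.clm_comp {f : E → V} {L : E →L[ℝ] V} {x : E}
    (h : HasSpanningDerivAt f L x) (T : V →L[ℝ] V') :
    HasSpanningDerivAt (fun y => T (f y)) (T.comp L) x := by
  obtain ⟨S, hS, h⟩ := h
  refine ⟨S, hS, fun v hv => ?_⟩
  obtain ⟨c, h0, h1, h2⟩ := h v hv
  exact ⟨c, h0, h1, T.hasFDerivAt.comp_hasDerivAt 0 h2⟩

theorem HasSpanningDerivAt.sub_clm {f : E → V} {L : E →L[ℝ] V} {x : E}
    (h : HasSpanningDerivAt f L x) (T : E →L[ℝ] V) :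
    HasSpanningDerivAt (fun y => f y - T y) (L - T) x := by
  obtain ⟨S, hS, h⟩ := h
  refine ⟨S, hS, fun v hv => ?_⟩
  obtain ⟨c, h0, h1, h2⟩ := h v hv
  exact ⟨c, h0, h1, h2.sub (T.hasFDerivAt.comp_hasDerivAt 0 h1)⟩

variable [FiniteDimensional ℝ E]

/-- The comparison principle behind `hasFDerivAt_of_hasSpanningDerivAt`. At a maximum `p ≠ y` of
`f - φ`, where `φ x = ε' ‖x - y‖ + N ‖x - y‖²`, the derivatives of `f` in spanning directions
agree with those of `φ`, but the slope of `φ` exceeds the bound `ε` for the slope of `f`. -/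
theorem le_of_hasSpanningDerivAt {f : E → ℝ} {a : E → E →L[ℝ] ℝ} {y : E} {ρ ε ε' : ℝ} (hρ : 0 < ρ)
    (hf : ContinuousOn f (closedBall y ρ))
    (ha : ∀ x ∈ ball y ρ, HasSpanningDerivAt f (a x) x) (hε : ∀ x ∈ ball y ρ, ‖a x‖ ≤ ε)
    (hεε' : ε < ε') :
    ∃ N : ℝ, 0 ≤ N ∧ ∀ x ∈ closedBall y ρ, f x ≤ f y + ε' * ‖x - y‖ + N * ‖x - y‖ ^ 2 := by
  obtain ⟨C, hC⟩ := (isCompact_closedBall y ρ).exists_bound_of_continuousOn hf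
  have hyb : y ∈ closedBall y ρ := mem_closedBall_self hρ.le
  have hC0 : 0 ≤ C := (norm_nonneg _).trans (hC y hyb)
  have hε0 : 0 ≤ ε := (norm_nonneg _).trans (hε y (mem_ball_self hρ))
  set N : ℝ := (2 * C + 1) / ρ ^ 2 with hN
  have hN0 : 0 ≤ N := by positivity
  have hNρ : N * ρ ^ 2 = 2 * C + 1 := by rw [hN]; field_simp
  refine ⟨N, hN0, ?_⟩
  obtain ⟨p, hp, hmax⟩ := (isCompact_closedBall y ρ).exists_isMaxOn ⟨y, hyb⟩
    (f := fun x => f x - (ε' * ‖x - y‖ + N * ‖x - y‖ ^ 2))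
    (hf.sub (by fun_prop))
  have hmax' : ∀ x ∈ closedBall y ρ, f x - (ε' * ‖x - y‖ + N * ‖x - y‖ ^ 2) ≤
      f p - (ε' * ‖p - y‖ + N * ‖p - y‖ ^ 2) := fun x hx => hmax hx
  by_cases hpy : p = y
  · intro x hx
    have := hmax' x hx
    simp only [hpy, sub_self, norm_zero] at this
    linarith
  exfalso
  have hpb : p ∈ ball y ρ := by
    by_contra hpb
    have h1 : ‖p - y‖ = ρ := by
      rw [← dist_eq_norm]
      exact le_antisymm hp (not_lt.1 hpb)
    have h2 := hmax' y hyb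
    simp only [sub_self, norm_zero, h1] at h2
    have h3 := abs_le.1 (hC y hyb)
    have h4 := abs_le.1 (hC p hp)
    nlinarith
  set s : ℝ := ‖p - y‖ with hs
  have hs0 : 0 < s := norm_pos_iff.2 (sub_ne_zero.2 hpy)
  have key : a p = (ε' / s + 2 * N) • innerSL ℝ (p - y) := by
    obtain ⟨S, hS, h⟩ := ha p hpb
    have : (a p : E →ₗ[ℝ] ℝ) = ((ε' / s + 2 * N) • innerSL ℝ (p - y) : E →L[ℝ] ℝ) := by
      refine LinearMap.ext_on hS fun v hv => ?_
      obtain ⟨c, h0, h1, h2⟩ := h v hv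
      have d1 : HasDerivAt (fun t => ‖c t - y‖ ^ 2) (2 * inner ℝ (p - y) v) 0 := by
        have := (h1.sub_const y).norm_sq
        rwa [h0] at this
      have d2 : HasDerivAt (fun t => ‖c t - y‖) (2 * inner ℝ (p - y) v / (2 * s)) 0 := by
        have := d1.sqrt (by rw [h0]; positivity)
        simp only [Real.sqrt_sq (norm_nonneg _), h0] at this
        exact this
      have d3 := h2.sub ((d2.const_mul ε').add (d1.const_mul N))
      have hloc : IsLocalMax ((fun t => f (c t)) -
        ((fun t => ε' * ‖c t - y‖) + fun t => N * ‖c t - y‖ ^ 2)) 0 := by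
        have : ∀ᶠ t in 𝓝 (0 : ℝ), c t ∈ ball y ρ :=
          h1.continuousAt.eventually (by rw [h0]; exact isOpen_ball.mem_nhds hpb)
        filter_upwards [this] with t ht
        have := hmax' (c t) (ball_subset_closedBall ht)
        simpa [h0] using this
      have h3 := hloc.hasDerivAt_eq_zero d3
      change a p v = (ε' / s + 2 * N) * inner ℝ (p - y) v
      have h4 : 2 * inner ℝ (p - y) v / (2 * s) = inner ℝ (p - y) v / s := by field_simp
      rw [h4] at h3
      have h5 : a p v = ε' * (inner ℝ (p - y) v / s) + N * (2 * inner ℝ (p - y) v) := by linarith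
      rw [h5]
      ring
    exact ContinuousLinearMap.coe_injective this
  have h1 : a p (p - y) = (ε' / s + 2 * N) * s ^ 2 := by
    rw [key]
    change (ε' / s + 2 * N) * inner ℝ (p - y) (p - y) = _
    rw [real_inner_self_eq_norm_sq]
  have h2 : a p (p - y) ≤ ε * s :=
    (le_abs_self _).trans ((a p).le_of_opNorm_le (hε p hpb) _)
  have h3 : (ε' / s + 2 * N) * s ^ 2 = ε' * s + 2 * N * s ^ 2 := by field_simp
  nlinarith [mul_pos hs0 (sub_pos.2 hεε'), mul_nonneg hN0 (sq_nonneg s)]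

theorem hasFDerivAt_real_of_hasSpanningDerivAt {f : E → ℝ} {a : E → E →L[ℝ] ℝ} {x₀ : E}
    (hf : ∀ᶠ x in 𝓝 x₀, ContinuousAt f x) (ha : ∀ᶠ x in 𝓝 x₀, HasSpanningDerivAt f (a x) x)
    (hc : ContinuousAt a x₀) : HasFDerivAt f (a x₀) x₀ := by
  rw [hasFDerivAt_iff_isLittleO, Asymptotics.isLittleO_iff]
  intro ε hε
  have h1 : ∀ᶠ x in 𝓝 x₀, ‖a x - a x₀‖ ≤ ε / 4 := by
    filter_upwards [Metric.tendsto_nhds.1 hc (ε / 4) (by positivity)] with x hx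
    rw [← dist_eq_norm]
    exact hx.le
  obtain ⟨ρ', hρ', H⟩ := Metric.eventually_nhds_iff_ball.1 ((hf.and ha).and h1)
  set ρ := ρ' / 2 with hρdef
  have hρ : 0 < ρ := by positivity
  have hsub : closedBall x₀ ρ ⊆ ball x₀ ρ' := closedBall_subset_ball (by linarith)
  have hsub' : ball x₀ ρ ⊆ ball x₀ ρ' := ball_subset_closedBall.trans hsub
  have cont : ContinuousOn (fun x => f x - a x₀ x) (closedBall x₀ ρ) := fun x hx =>
    ((H x (hsub hx)).1.1.sub (a x₀).continuous.continuousAt).continuousWithinAt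
  have sp : ∀ x ∈ ball x₀ ρ, HasSpanningDerivAt (fun x => f x - a x₀ x) (a x - a x₀) x :=
    fun x hx => (H x (hsub' hx)).1.2.sub_clm _
  obtain ⟨N₁, hN₁, B₁⟩ := le_of_hasSpanningDerivAt hρ cont sp
    (fun x hx => (H x (hsub' hx)).2) (by linarith : ε / 4 < ε / 2)
  obtain ⟨N₂, hN₂, B₂⟩ := le_of_hasSpanningDerivAt (f := fun x => -(f x - a x₀ x))
    (a := fun x => -(a x - a x₀)) hρ cont.neg
    (fun x hx => (sp x hx).clm_comp (-ContinuousLinearMap.id ℝ ℝ))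
    (fun x hx => by rw [norm_neg]; exact (H x (hsub' hx)).2) (by linarith : ε / 4 < ε / 2)
  have hδ : 0 < ε / (2 * (N₁ + N₂ + 1)) := by positivity
  filter_upwards [Metric.closedBall_mem_nhds x₀ hρ, Metric.closedBall_mem_nhds x₀ hδ] with x hx hx'
  have hx'' : (N₁ + N₂ + 1) * ‖x - x₀‖ ≤ ε / 2 := by
    rw [mem_closedBall, dist_eq_norm, le_div_iff₀ (by positivity)] at hx'
    linarith
  have hn := norm_nonneg (x - x₀)
  have e1 := B₁ x hx
  have e2 := B₂ x hx
  have q1 := mul_le_mul_of_nonneg_right hx'' hn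
  have q2 : 0 ≤ N₁ * ‖x - x₀‖ ^ 2 := by positivity
  have q3 : 0 ≤ N₂ * ‖x - x₀‖ ^ 2 := by positivity
  rw [Real.norm_eq_abs, abs_le, map_sub]
  constructor <;> nlinarith [sq_nonneg ‖x - x₀‖]

/-- A continuous function with continuous prescribed derivatives in spanning directions, along
curves chosen independently at each point, is differentiable. -/
theorem hasFDerivAt_of_hasSpanningDerivAt [FiniteDimensional ℝ V] {f : E → V} {a : E → E →L[ℝ] V}
    {x₀ : E} (hf : ∀ᶠ x in 𝓝 x₀, ContinuousAt f x)
    (ha : ∀ᶠ x in 𝓝 x₀, HasSpanningDerivAt f (a x) x)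
    (hc : ContinuousAt a x₀) : HasFDerivAt f (a x₀) x₀ := by
  let e : V ≃L[ℝ] (Fin (Module.finrank ℝ V) → ℝ) := ContinuousLinearEquiv.ofFinrankEq (by simp)
  rw [← e.comp_hasFDerivAt_iff, hasFDerivAt_pi']
  intro i
  let T : V →L[ℝ] ℝ := (ContinuousLinearMap.proj (R := ℝ) (φ := fun _ => ℝ) i).comp (e : V →L[ℝ] _)
  have := hasFDerivAt_real_of_hasSpanningDerivAt (f := fun x => T (f x))
    (a := fun x => T.comp (a x))
    (x₀ := x₀) (hf.mono fun x hx => T.continuous.continuousAt.comp hx)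
    (ha.mono fun x hx => hx.clm_comp T) (continuousAt_const.clm_comp hc)
  exact this

/-- If `f` has prescribed, locally bounded derivatives in spanning directions, and its domain is a
countable union of closed sets on which `f` is continuous, then `f` is continuous.
By Baire, `f` restricted to the set of bad points is continuous somewhere. A good point `q` is the
centre of a ball of good points touching the bad set at a point `p`; some curve through `p` enters
this ball, where `f` is Lipschitz, and therefore `f q` is close to `f p`. -/
theorem continuousAt_of_hasSpanningDerivAt [FiniteDimensional ℝ V] {Ω : Set E} (hΩ : IsOpen Ω)
    {f : E → V} {a : E → E →L[ℝ] V} (ha : ∀ x ∈ Ω, HasSpanningDerivAt f (a x) x)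
    (hbd : ∀ x ∈ Ω, ∃ C : ℝ, ∀ᶠ y in 𝓝 x, ‖a y‖ ≤ C)
    (hac : ∀ x ∈ Ω, ContinuousAt f x → ContinuousAt a x)
    {K : ℕ → Set E} (hK : ∀ j, IsClosed (K j)) (hΩK : Ω ⊆ ⋃ j, K j)
    (hfK : ∀ j, ContinuousOn f (K j)) : ∀ x ∈ Ω, ContinuousAt f x := by
  have : ProperSpace E := FiniteDimensional.proper ℝ E
  set O : Set E := {x | ∀ᶠ y in 𝓝 x, ContinuousAt f y} with hO
  have hOo : IsOpen O := isOpen_setOfPred_eventually_nhds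
  set N : Set E := Ω \ O with hN
  have hOc : ∀ x ∈ O, ContinuousAt f x := fun x hx => hx.self_of_nhds
  suffices N = ∅ by
    intro x hx
    by_contra h
    have hxN : x ∈ N := ⟨hx, fun h' => h (hOc x h')⟩
    rw [this] at hxN
    exact hxN
  by_contra hne
  have hNne : N.Nonempty := nonempty_iff_ne_empty.2 hne
  have hdiff : ∀ x ∈ Ω ∩ O, HasFDerivAt f (a x) x := fun x hx =>
    hasFDerivAt_of_hasSpanningDerivAt hx.2 (by filter_upwards [hΩ.mem_nhds hx.1] using ha)
      (hac x hx.1 (hOc x hx.2))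
  have hlc : IsLocallyClosed N := hΩ.isLocallyClosed.inter hOo.isClosed_compl.isLocallyClosed
  have : LocallyCompactSpace N := hlc.locallyCompactSpace
  have : Nonempty N := hNne.to_subtype
  obtain ⟨j, z, hz⟩ := nonempty_interior_of_iUnion_of_closed
    (f := fun j => (Subtype.val : N → E) ⁻¹' K j)
    (fun j => (hK j).preimage continuous_subtype_val) (by
      rw [← preimage_iUnion, preimage_eq_univ_iff, Subtype.range_val]
      exact sdiff_subset.trans hΩK)
  rw [mem_interior] at hz
  obtain ⟨W', hW', hW'o, hzW'⟩ := hz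
  obtain ⟨W, hWo, rfl⟩ := isOpen_induced_iff.1 hW'o
  have hWK : ∀ x ∈ W ∩ N, x ∈ K j := fun x hx =>
    hW' (show (⟨x, hx.2⟩ : N) ∈ Subtype.val ⁻¹' W from hx.1)
  refine z.2.2 ?_
  rw [hO, mem_ofPred_eq]
  filter_upwards [hWo.mem_nhds hzW', hΩ.mem_nhds z.2.1] with y hyW hyΩ
  by_cases hyO : y ∈ O
  · exact hOc y hyO
  have hyN : y ∈ N := ⟨hyΩ, hyO⟩
  have hcN : ContinuousWithinAt f N y := by
    have h1 : ContinuousWithinAt f (W ∩ N) y :=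
      ((hfK j) y (hWK y ⟨hyW, hyN⟩)).mono hWK
    exact h1.mono_of_mem_nhdsWithin (inter_mem (mem_nhdsWithin_of_mem_nhds (hWo.mem_nhds hyW))
      self_mem_nhdsWithin)
  rw [Metric.continuousAt_iff']
  intro ε hε
  obtain ⟨C, hC⟩ := hbd y hyΩ
  have hcN' := Metric.continuousWithinAt_iff'.1 hcN (ε / 2) (by positivity)
  rw [eventually_nhdsWithin_iff] at hcN'
  obtain ⟨r₀, hr₀, H⟩ := Metric.eventually_nhds_iff_ball.1 ((hC.and hcN').and (hΩ.mem_nhds hyΩ))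
  have hC0 : 0 ≤ C := (norm_nonneg _).trans (H y (mem_ball_self hr₀)).1.1
  set r : ℝ := min (r₀ / 4) (ε / (4 * (C + 1))) with hr
  have hrpos : 0 < r := by positivity
  have hrr : 4 * r ≤ r₀ := by have := min_le_left (r₀ / 4) (ε / (4 * (C + 1))); linarith
  have hCr : C * r ≤ ε / 4 := by
    have h1 : r ≤ ε / (4 * (C + 1)) := min_le_right _ _
    rw [le_div_iff₀ (by positivity)] at h1
    nlinarith
  filter_upwards [Metric.ball_mem_nhds y hrpos] with q hq
  have hqb : q ∈ ball y r₀ := ball_subset_ball (by linarith) hq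
  by_cases hqO : q ∈ O
  swap
  · exact ((H q hqb).1.2 ⟨(H q hqb).2, hqO⟩).trans (by linarith)
  have hKc : IsCompact (closedBall y (3 * r) ∩ Oᶜ) :=
    (isCompact_closedBall y (3 * r)).inter_right hOo.isClosed_compl
  have hyK : y ∈ closedBall y (3 * r) ∩ Oᶜ := ⟨mem_closedBall_self (by positivity), hyO⟩
  obtain ⟨p, hp, hpd⟩ := hKc.exists_infDist_eq_dist ⟨y, hyK⟩ q
  set d := dist q p with hd
  have hdr : d < r := by
    rw [← hpd]
    exact (infDist_le_dist_of_mem hyK).trans_lt hq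
  have hpq : q ≠ p := fun h => hp.2 (h ▸ hqO)
  have hdpos : 0 < d := dist_pos.2 hpq
  have hball : ∀ u ∈ ball q d, u ∈ ball y r₀ ∧ u ∈ O := by
    intro u hu
    have h1 : dist u y < 2 * r := by
      have := dist_triangle u q y
      have h2 : dist u q < d := hu
      have h3 : dist q y < r := hq
      linarith
    refine ⟨by rw [mem_ball]; linarith, ?_⟩
    by_contra huO
    have := infDist_le_dist_of_mem (x := q) (show u ∈ closedBall y (3 * r) ∩ Oᶜ from
      ⟨by rw [mem_closedBall]; linarith, huO⟩)
    rw [hpd, dist_comm q u] at this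
    exact absurd hu (not_lt.2 this)
  have hlip : ∀ u ∈ ball q d, ‖f u - f q‖ ≤ C * d := by
    intro u hu
    have := (convex_ball q d).norm_image_sub_le_of_norm_hasFDerivWithin_le (f := f) (f' := a) (C := C)
      (fun x hx => (hdiff x ⟨(H x (hball x hx).1).2, (hball x hx).2⟩).hasFDerivWithinAt)
      (fun x hx => (H x (hball x hx).1).1.1) (mem_ball_self hdpos) hu
    refine this.trans (mul_le_mul_of_nonneg_left ?_ hC0)
    rw [← dist_eq_norm]
    exact le_of_lt hu
  have hpb : p ∈ ball y r₀ := by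
    have h1 := dist_triangle p q y
    have h3 : dist q y < r := hq
    rw [mem_ball]
    rw [dist_comm p q] at h1
    linarith
  obtain ⟨S, hS, hSp⟩ := ha p (H p hpb).2
  obtain ⟨v, hv, hvn⟩ : ∃ v ∈ S, inner ℝ (p - q) v ≠ 0 := by
    by_contra! hcon
    have h1 : (innerSL ℝ (p - q) : E →ₗ[ℝ] ℝ) = (0 : E →L[ℝ] ℝ) :=
      LinearMap.ext_on hS fun v hv => hcon v hv
    have h2 : inner ℝ (p - q) (p - q) = 0 := DFunLike.congr_fun h1 (p - q)
    rw [inner_self_eq_zero, sub_eq_zero] at h2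
    exact hpq h2.symm
  obtain ⟨c, h0, h1, h2⟩ := hSp v hv
  have hfreq : ∃ᶠ t in 𝓝 (0 : ℝ), c t ∈ ball q d := by
    have d1 : HasDerivAt (fun t => ‖c t - q‖ ^ 2) (2 * inner ℝ (p - q) v) 0 := by
      have := (h1.sub_const q).norm_sq
      rwa [h0] at this
    by_contra hcon
    rw [not_frequently] at hcon
    have hmin : IsLocalMin (fun t => ‖c t - q‖ ^ 2) 0 := by
      filter_upwards [hcon] with t ht
      rw [mem_ball, not_lt, dist_eq_norm] at ht
      rw [h0, ← dist_eq_norm, dist_comm]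
      exact pow_le_pow_left₀ dist_nonneg ht 2
    have := hmin.hasDerivAt_eq_zero d1
    simp_all
  have hpq' : ‖f p - f q‖ ≤ C * d := by
    have ht : Tendsto (fun t => ‖f (c t) - f q‖) (𝓝 0) (𝓝 ‖f p - f q‖) := by
      have := h2.continuousAt.tendsto
      rw [h0] at this
      exact (this.sub_const (f q)).norm
    exact isClosed_Iic.mem_of_frequently_of_tendsto (hfreq.mono fun t ht => hlip _ ht) ht
  have hpy : dist (f p) (f y) < ε / 2 := (H p hpb).1.2 ⟨(H p hpb).2, hp.2⟩
  have h5 : dist (f q) (f p) ≤ ε / 4 := by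
    rw [dist_comm, dist_eq_norm]
    refine (hpq'.trans (mul_le_mul_of_nonneg_left hdr.le hC0)).trans hCr
  have := dist_triangle (f q) (f p) (f y)
  linarith
end

end

/-! ### Coordinates on the tangent bundle -/

section Charts
variable {m : ℕ} [NeZero m] {M : Type*} [TopologicalSpace M]
  [ChartedSpace (EuclideanHalfSpace m) M] [IsManifold (𝓡∂ m) ∞ M]

/-- The coordinates on `TM` induced by the chart around `x₀`. -/
noncomputable def coord (x₀ : M) (p : TangentBundle (𝓡∂ m) M) : Model m × Model m :=
  (extChartAt (𝓡∂ m) x₀ p.proj,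
    mfderiv (𝓡∂ m) 𝓘(ℝ, Model m) (extChartAt (𝓡∂ m) x₀) p.proj p.snd)

/-- The vector of `TM` with given coordinates; the inverse of `coord x₀`. -/
noncomputable def ofCoord (x₀ : M) (z : Model m × Model m) : TangentBundle (𝓡∂ m) M :=
  ⟨(extChartAt (𝓡∂ m) x₀).symm z.1,
    mfderivWithin 𝓘(ℝ, Model m) (𝓡∂ m) (extChartAt (𝓡∂ m) x₀).symm (range (𝓡∂ m)) z.1 z.2⟩

instance isManifold_one : IsManifold (𝓡∂ m) 1 M :=
  IsManifold.of_le (n := ∞) (by exact_mod_cast le_top)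

theorem coord_ofCoord {x₀ : M} {z : Model m × Model m} (hz : z.1 ∈ (extChartAt (𝓡∂ m) x₀).target) :
    coord x₀ (ofCoord x₀ z) = z := by
  refine Prod.ext ((extChartAt (𝓡∂ m) x₀).right_inv hz) ?_
  exact DFunLike.congr_fun (mfderiv_extChartAt_comp_mfderivWithin_extChartAt_symm hz) z.2

theorem ofCoord_coord {x₀ : M} {p : TangentBundle (𝓡∂ m) M}
    (hp : p.proj ∈ (extChartAt (𝓡∂ m) x₀).source) : ofCoord x₀ (coord x₀ p) = p := by
  obtain ⟨x, v⟩ := p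
  have h1 : (extChartAt (𝓡∂ m) x₀).symm (extChartAt (𝓡∂ m) x₀ x) = x :=
    (extChartAt (𝓡∂ m) x₀).left_inv hp
  have h2 := DFunLike.congr_fun (mfderivWithin_extChartAt_symm_comp_mfderiv_extChartAt' hp) v
  refine TotalSpace.ext h1 ?_
  have h3 : HEq (mfderivWithin 𝓘(ℝ, Model m) (𝓡∂ m) (extChartAt (𝓡∂ m) x₀).symm (range (𝓡∂ m))
      (extChartAt (𝓡∂ m) x₀ x)
        (mfderiv (𝓡∂ m) 𝓘(ℝ, Model m) (extChartAt (𝓡∂ m) x₀) x v)) v := heq_of_eq h2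
  exact h3

theorem coord_eq_extChartAt {x₀ : M} {p : TangentBundle (𝓡∂ m) M}
    (hp : p.proj ∈ (extChartAt (𝓡∂ m) x₀).source) :
    coord x₀ p = extChartAt (𝓡∂ m).tangent (⟨x₀, 0⟩ : TangentBundle (𝓡∂ m) M) p := by
  have hp' : p.proj ∈ (chartAt (EuclideanHalfSpace m) x₀).source := by rwa [extChartAt_source] at hp
  rw [FiberBundle.extChartAt]
  refine Prod.ext ?_ ?_
  · simp only [coord, PartialEquiv.coe_trans, Function.comp, PartialEquiv.prod_coe]
    congr 1
  · simp only [coord, PartialEquiv.coe_trans, Function.comp, PartialEquiv.prod_coe]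
    refine (DFunLike.congr_fun
      (TangentBundle.continuousLinearMapAt_trivializationAt hp') p.snd).symm.trans ?_
    refine (congr_fun (Trivialization.continuousLinearMapAt_apply ℝ
      (trivializationAt (Model m) (TangentSpace (𝓡∂ m)) x₀) p.proj) p.snd).trans ?_
    exact congr_fun (Trivialization.coe_linearMapAt_of_mem (R := ℝ)
      (trivializationAt (Model m) (TangentSpace (𝓡∂ m)) x₀) hp') p.snd

theorem extChartAt_tangent_source (x₀ : M) :
    (extChartAt (𝓡∂ m).tangent (⟨x₀, 0⟩ : TangentBundle (𝓡∂ m) M)).source =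
      TotalSpace.proj ⁻¹' (extChartAt (𝓡∂ m) x₀).source := by
  ext p
  rw [extChartAt_source, TangentBundle.mem_chart_source_iff, extChartAt_source]
  rfl

theorem extChartAt_tangent_target (x₀ : M) :
    (extChartAt (𝓡∂ m).tangent (⟨x₀, 0⟩ : TangentBundle (𝓡∂ m) M)).target =
      (extChartAt (𝓡∂ m) x₀).target ×ˢ univ := by
  rw [FiberBundle.extChartAt_target]
  congr 1
  refine inter_eq_left.2 fun y hy => ?_
  have := (extChartAt (𝓡∂ m) x₀).map_target hy
  rwa [extChartAt_source] at this

theorem ofCoord_eq_extChartAt_symm {x₀ : M} {z : Model m × Model m}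
    (hz : z.1 ∈ (extChartAt (𝓡∂ m) x₀).target) :
    ofCoord x₀ z = (extChartAt (𝓡∂ m).tangent (⟨x₀, 0⟩ : TangentBundle (𝓡∂ m) M)).symm z := by
  have hz' : z ∈ (extChartAt (𝓡∂ m).tangent (⟨x₀, 0⟩ : TangentBundle (𝓡∂ m) M)).target := by
    rw [extChartAt_tangent_target]; exact ⟨hz, trivial⟩
  set e := extChartAt (𝓡∂ m).tangent (⟨x₀, 0⟩ : TangentBundle (𝓡∂ m) M) with he
  have hs : ofCoord x₀ z ∈ e.source := by
    rw [he, extChartAt_tangent_source]; exact (extChartAt (𝓡∂ m) x₀).map_target hz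
  have h1 : e (ofCoord x₀ z) = z := by
    rw [he, ← coord_eq_extChartAt, coord_ofCoord hz]
    exact (extChartAt (𝓡∂ m) x₀).map_target hz
  rw [← e.left_inv hs, h1]

theorem contMDiffOn_ofCoord (x₀ : M) :
    ContMDiffOn 𝓘(ℝ, Model m × Model m) (𝓡∂ m).tangent ∞ (ofCoord x₀)
      ((extChartAt (𝓡∂ m) x₀).target ×ˢ univ) := by
  have := contMDiffOn_extChartAt_symm (I := (𝓡∂ m).tangent) (n := ∞)
    (⟨x₀, 0⟩ : TangentBundle (𝓡∂ m) M)
  rw [extChartAt_tangent_target] at this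
  exact this.congr fun z hz => ofCoord_eq_extChartAt_symm hz.1

theorem continuousOn_coord (x₀ : M) :
    ContinuousOn (coord x₀ : TangentBundle (𝓡∂ m) M → _)
      (TotalSpace.proj ⁻¹' (extChartAt (𝓡∂ m) x₀).source) := by
  have := continuousOn_extChartAt (I := (𝓡∂ m).tangent) (⟨x₀, 0⟩ : TangentBundle (𝓡∂ m) M)
  rw [extChartAt_tangent_source] at this
  exact this.congr fun p hp => coord_eq_extChartAt hp

theorem continuousOn_ofCoord (x₀ : M) :
    ContinuousOn (ofCoord x₀ : _ → TangentBundle (𝓡∂ m) M)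
      ((extChartAt (𝓡∂ m) x₀).target ×ˢ univ) := (contMDiffOn_ofCoord x₀).continuousOn

theorem contMDiffOn_ofCoord_const (x₀ : M) (a : Model m) :
    ContMDiffOn 𝓘(ℝ, Model m) (𝓡∂ m).tangent ∞ (fun y => ofCoord x₀ (y, a))
      (extChartAt (𝓡∂ m) x₀).target := by
  refine (contMDiffOn_ofCoord x₀).comp (t := (extChartAt (𝓡∂ m) x₀).target ×ˢ univ)
    (f := fun y => (y, a)) ?_ (fun y hy => ⟨hy, trivial⟩)
  exact (contDiff_id.prodMk contDiff_const).contMDiff.contMDiffOn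

theorem contDiffOn_metricInChart (g : SmoothMetric m M) (x₀ : M) (a b : Model m) :
    ContDiffOn ℝ ∞ (fun y => metricInChart g x₀ y a b) (extChartAt (𝓡∂ m) x₀).target := by
  rw [← contMDiffOn_iff_contDiffOn]
  intro y hy
  have hv := contMDiffOn_ofCoord_const x₀ a y hy
  have hw := contMDiffOn_ofCoord_const x₀ b y hy
  have hb : ContMDiffWithinAt 𝓘(ℝ, Model m) (𝓡∂ m) ∞ (extChartAt (𝓡∂ m) x₀).symm
      (extChartAt (𝓡∂ m) x₀).target y := contMDiffOn_extChartAt_symm x₀ y hy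
  have : ContMDiffWithinAt 𝓘(ℝ, Model m) ((𝓡∂ m).prod 𝓘(ℝ)) ∞
      (fun y ↦ TotalSpace.mk' ℝ (E := Bundle.Trivial M ℝ) ((extChartAt (𝓡∂ m) x₀).symm y)
        (metricInChart g x₀ y a b)) (extChartAt (𝓡∂ m) x₀).target y := by
    apply ContMDiffWithinAt.clm_bundle_apply₂ (F₁ := Model m) (F₂ := Model m)
      (E₁ := fun x : M => TangentSpace (𝓡∂ m) x) (E₂ := fun x : M => TangentSpace (𝓡∂ m) x)
    · exact ContMDiffAt.comp_contMDiffWithinAt y g.contMDiff.contMDiffAt hb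
    · exact hv
    · exact hw
  simp only [contMDiffWithinAt_totalSpace] at this
  exact this.2

/-- The form `A` in the coordinates of the chart around `x₀`. -/
noncomputable def formInChart {n : ℕ} (A : HermitianConnection m M n) (x₀ : M)
    (z : Model m × Model m) :
    Matrix (Fin n) (Fin n) ℂ := A.form (ofCoord x₀ z).proj (ofCoord x₀ z).snd

theorem contDiffOn_formInChart {n : ℕ} (A : HermitianConnection m M n) (x₀ : M) :
    ContDiffOn ℝ ∞ (formInChart A x₀) ((extChartAt (𝓡∂ m) x₀).target ×ˢ univ) := by
  rw [← contMDiffOn_iff_contDiffOn]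
  exact A.smooth.comp_contMDiffOn (contMDiffOn_ofCoord x₀)

/-! ### The geodesic equation as a first order system -/

/-- For a field `G` of bilinear forms, the covector
`w ↦ (∂_v G)(v, w) - (∂_w G)(v, v) / 2` at `y`. -/
noncomputable def christoffelCovector {E : Type*} [NormedAddCommGroup E] [NormedSpace ℝ E]
    (G : E → E →L[ℝ] E →L[ℝ] ℝ) (s : Set E) (y v : E) : E →L[ℝ] ℝ :=
  fderivWithin ℝ G s y v v - (2⁻¹ : ℝ) • ((fderivWithin ℝ G s y).flip v).flip v

theorem contDiffWithinAt_fderivWithin_apply {E F : Type*} [NormedAddCommGroup E] [NormedSpace ℝ E]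
    [NormedAddCommGroup F] [NormedSpace ℝ F]
    {G : E → F} {s : Set E} {z : E × E} (hG : ContDiffWithinAt ℝ ∞ G s z.1)
    (hs : UniqueDiffOn ℝ s) (hz : z.1 ∈ s) :
    ContDiffWithinAt ℝ ∞ (fun z : E × E => fderivWithin ℝ G s z.1 z.2) (s ×ˢ univ) z := by
  have hD : ContDiffWithinAt ℝ ∞ (fun z : E × E => fderivWithin ℝ G s z.1) (s ×ˢ univ) z :=
    (hG.fderivWithin_right hs (m := ∞) (by simp) hz).comp z contDiffWithinAt_fst (fun _ h => h.1)
  exact hD.clm_apply contDiffWithinAt_snd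

theorem contDiffWithinAt_clm_of_apply {D E F : Type*} [NormedAddCommGroup D] [NormedSpace ℝ D]
    [NormedAddCommGroup E] [NormedSpace ℝ E] [FiniteDimensional ℝ E] [NormedAddCommGroup F]
    [NormedSpace ℝ F] {f : D → E →L[ℝ] F} {s : Set D} {x : D} {k : WithTop ℕ∞}
    (h : ∀ w, ContDiffWithinAt ℝ k (fun y => f y w) s x) : ContDiffWithinAt ℝ k f s x := by
  let d := Module.finrank ℝ E
  have hd : d = Module.finrank ℝ (Fin d → ℝ) := (Module.finrank_fin_fun ℝ).symm
  let e₁ := ContinuousLinearEquiv.ofFinrankEq hd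
  let e₂ := (e₁.arrowCongr (1 : F ≃L[ℝ] F)).trans (ContinuousLinearEquiv.piRing (Fin d))
  rw [← Function.id_comp f, ← e₂.symm_comp_self]
  exact e₂.symm.contDiff.comp_contDiffWithinAt (contDiffWithinAt_pi.mpr fun i => h _)

theorem contDiffWithinAt_christoffelCovector {E : Type*} [NormedAddCommGroup E] [NormedSpace ℝ E]
    [FiniteDimensional ℝ E] {G : E → E →L[ℝ] E →L[ℝ] ℝ} {s : Set E} {z : E × E}
    (hG : ContDiffWithinAt ℝ ∞ G s z.1) (hs : UniqueDiffOn ℝ s) (hz : z.1 ∈ s) :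
    ContDiffWithinAt ℝ ∞ (fun z : E × E => christoffelCovector G s z.1 z.2) (s ×ˢ univ) z := by
  have hv : ContDiffWithinAt ℝ ∞ (fun z : E × E => z.2) (s ×ˢ univ) z := contDiffWithinAt_snd
  refine contDiffWithinAt_clm_of_apply fun w => ?_
  have h1 := ((contDiffWithinAt_fderivWithin_apply hG hs hz).clm_apply hv).clm_apply
    (contDiffWithinAt_const (c := w))
  have h2 : ContDiffWithinAt ℝ ∞ (fun z : E × E => fderivWithin ℝ G s z.1 w) (s ×ˢ univ) z :=
    (contDiffWithinAt_fderivWithin_apply (z := (z.1, w)) hG hs hz).comp z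
      (f := fun z : E × E => (z.1, w)) (contDiffWithinAt_fst.prodMk contDiffWithinAt_const)
      (fun z hz => ⟨hz.1, trivial⟩)
  exact h1.sub (((h2.clm_apply hv).clm_apply hv).const_smul (2⁻¹ : ℝ))

theorem contDiffWithinAt_inverse_apply {X E F : Type*} [NormedAddCommGroup X] [NormedSpace ℝ X]
    [NormedAddCommGroup E] [NormedSpace ℝ E] [CompleteSpace E] [NormedAddCommGroup F]
    [NormedSpace ℝ F] {G : X → E →L[ℝ] F} {c : X → F} {s : Set X} {z : X}
    (hG : ContDiffWithinAt ℝ ∞ G s z) (hz : (G z).IsInvertible) (hc : ContDiffWithinAt ℝ ∞ c s z) :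
    ContDiffWithinAt ℝ ∞ (fun z => (G z).inverse (c z)) s z := by
  obtain ⟨e, he⟩ := hz
  have h1 := contDiffAt_map_inverse (𝕜 := ℝ) (n := ∞) e
  rw [he] at h1
  exact (h1.comp_contDiffWithinAt z hG).clm_apply hc

theorem fderivWithin_clm_apply_apply {E F : Type*} [NormedAddCommGroup E] [NormedSpace ℝ E]
    [NormedAddCommGroup F] [NormedSpace ℝ F]
    {G : E → F →L[ℝ] F →L[ℝ] ℝ} {s : Set E} {y : E} (hG : DifferentiableWithinAt ℝ G s y)
    (hs : UniqueDiffWithinAt ℝ s y) (a : E) (b c : F) :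
    fderivWithin ℝ (fun z => G z b c) s y a = fderivWithin ℝ G s y a b c := by
  have h1 := (hG.hasFDerivWithinAt.clm_apply (hasFDerivWithinAt_const b y s)).clm_apply
    (hasFDerivWithinAt_const c y s)
  rw [h1.fderivWithin hs]
  simp

/-- The pullback of a bilinear form on a tangent space to the model space. -/
noncomputable def pullbackForm {x : M}
    (B : TangentSpace (𝓡∂ m) x →L[ℝ] TangentSpace (𝓡∂ m) x →L[ℝ] ℝ)
    (D : Model m →L[ℝ] TangentSpace (𝓡∂ m) x) : Model m →L[ℝ] Model m →L[ℝ] ℝ :=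
  (LinearMap.toContinuousLinearMap.toLinearMap ∘ₗ
    LinearMap.mk₂ ℝ (fun a b => B (D a) (D b)) (fun a b c => by simp) (fun r a b => by simp)
      (fun a b c => by simp) (fun r a b => by simp)).toContinuousLinearMap

/-- The metric at the coordinate point `y`, as a bilinear form on the model space. -/
noncomputable def metricForm (g : SmoothMetric m M) (x₀ : M) (y : Model m) :
    Model m →L[ℝ] Model m →L[ℝ] ℝ :=
  pullbackForm (g.inner ((extChartAt (𝓡∂ m) x₀).symm y))
    (mfderivWithin 𝓘(ℝ, Model m) (𝓡∂ m) (extChartAt (𝓡∂ m) x₀).symm (range (𝓡∂ m)) y)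

theorem metricForm_apply (g : SmoothMetric m M) (x₀ : M) (y a b : Model m) :
    metricForm g x₀ y a b = metricInChart g x₀ y a b := rfl

theorem contDiffOn_metricForm (g : SmoothMetric m M) (x₀ : M) :
    ContDiffOn ℝ ∞ (metricForm g x₀) (extChartAt (𝓡∂ m) x₀).target := by
  rw [contDiffOn_clm_apply]
  intro a
  rw [contDiffOn_clm_apply]
  exact contDiffOn_metricInChart g x₀ a

theorem contDiffWithinAt_metricForm (g : SmoothMetric m M) {x₀ : M} {y : Model m}
    (hy : y ∈ (extChartAt (𝓡∂ m) x₀).target) :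
    ContDiffWithinAt ℝ ∞ (metricForm g x₀) (range (𝓡∂ m)) y :=
  (contDiffOn_metricForm g x₀ y hy).mono_of_mem_nhdsWithin
    (extChartAt_target_mem_nhdsWithin_of_mem hy)

theorem isInvertible_metricForm (g : SmoothMetric m M) {x₀ : M} {y : Model m}
    (hy : y ∈ (extChartAt (𝓡∂ m) x₀).target) : (metricForm g x₀ y).IsInvertible := by
  have hinj : Function.Injective (metricForm g x₀ y) := by
    rw [injective_iff_map_eq_zero]
    intro a ha
    by_contra h0
    obtain ⟨e, he⟩ := isInvertible_mfderivWithin_extChartAt_symm hy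
    have h1 := g.pos ((extChartAt (𝓡∂ m) x₀).symm y) (e a) (by
      intro h; exact h0 (e.map_eq_zero_iff.1 h))
    have h2 : metricForm g x₀ y a a = 0 := by rw [ha]; rfl
    have h3 : metricForm g x₀ y a a = g.inner ((extChartAt (𝓡∂ m) x₀).symm y) (e a) (e a) := by
      rw [metricForm, ← he]
      rfl
    linarith
  have hdim : Module.finrank ℝ (Model m) = Module.finrank ℝ (Model m →L[ℝ] ℝ) :=
    (InnerProductSpace.toDual ℝ (Model m)).toLinearEquiv.finrank_eq
  refine ⟨(LinearEquiv.ofInjectiveOfFinrankEq (metricForm g x₀ y : Model m →ₗ[ℝ] _) hinj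
    hdim).toContinuousLinearEquiv, ?_⟩
  ext a b
  rfl

/-- The Christoffel symbols contracted twice with `v`, as a covector at the coordinate point `y`. -/
noncomputable def christoffelForm (g : SmoothMetric m M) (x₀ : M) (y v : Model m) :
    Model m →L[ℝ] ℝ :=
  christoffelCovector (metricForm g x₀) (range (𝓡∂ m)) y v

theorem christoffelForm_apply (g : SmoothMetric m M) {x₀ : M} {y : Model m}
    (hy : y ∈ (extChartAt (𝓡∂ m) x₀).target) (v w : Model m) :
    christoffelForm g x₀ y v w = christoffel g x₀ y v v w := by
  have hu : UniqueDiffWithinAt ℝ (range (𝓡∂ m)) y :=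
    (𝓡∂ m).uniqueDiffOn y (extChartAt_target_subset_range x₀ hy)
  have key : ∀ a b c : Model m, fderivWithin ℝ (fun z => metricInChart g x₀ z b c) (range (𝓡∂ m)) y
    a
      = fderivWithin ℝ (metricForm g x₀) (range (𝓡∂ m)) y a b c :=
    fderivWithin_clm_apply_apply
      ((contDiffWithinAt_metricForm g hy).differentiableWithinAt (by simp))
      hu
  rw [christoffel, key, key, christoffelForm, christoffelCovector]
  simp
  ring

/-- The acceleration `c̈ = F(c, ċ)` of geodesics in coordinates. -/
noncomputable def geodesicAccel (g : SmoothMetric m M) (x₀ : M) (z : Model m × Model m) : Model m :=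
  (metricForm g x₀ z.1).inverse (-christoffelForm g x₀ z.1 z.2)

theorem contDiffWithinAt_geodesicAccel (g : SmoothMetric m M) {x₀ : M} {z : Model m × Model m}
    (hz : z.1 ∈ (extChartAt (𝓡∂ m) x₀).target) :
    ContDiffWithinAt ℝ ∞ (geodesicAccel g x₀) (range (𝓡∂ m) ×ˢ univ) z := by
  have hG : ContDiffWithinAt ℝ ∞ (fun z : Model m × Model m => metricForm g x₀ z.1)
      (range (𝓡∂ m) ×ˢ univ) z :=
    (contDiffWithinAt_metricForm g hz).comp z contDiffWithinAt_fst (fun _ h => h.1)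
  have hC : ContDiffWithinAt ℝ ∞ (fun z : Model m × Model m => -christoffelForm g x₀ z.1 z.2)
      (range (𝓡∂ m) ×ˢ univ) z :=
    (contDiffWithinAt_christoffelCovector (contDiffWithinAt_metricForm g hz) (𝓡∂ m).uniqueDiffOn
      (extChartAt_target_subset_range x₀ hz)).neg
  exact contDiffWithinAt_inverse_apply hG (isInvertible_metricForm g hz) hC

end Charts

/-! ### The joint evolution of geodesics and parallel transport -/

section Flow
variable {m n : ℕ} [NeZero m] {M : Type*} [TopologicalSpace M]
  [ChartedSpace (EuclideanHalfSpace m) M] [IsManifold (𝓡∂ m) ∞ M]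

/-- Coordinates of a pair of a tangent vector and a matrix, the states of the joint evolution of a
geodesic and of a solution of the transport equation along it. -/
noncomputable def stateCoord (x₀ : M) (q : TangentBundle (𝓡∂ m) M × Matrix (Fin n) (Fin n) ℂ) :
    (Model m × Model m) × Matrix (Fin n) (Fin n) ℂ := (coord x₀ q.1, q.2)

/-- The vector field of the joint evolution in coordinates. -/
noncomputable def stateField (g : SmoothMetric m M) (A : HermitianConnection m M n) (x₀ : M)
    (z : (Model m × Model m) × Matrix (Fin n) (Fin n) ℂ) :
    (Model m × Model m) × Matrix (Fin n) (Fin n) ℂ :=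
  ((z.1.2, geodesicAccel g x₀ z.1), -(formInChart A x₀ z.1 * z.2))

/-- Geodesics with a solution of the transport equation, as solutions of a first order equation.
In contrast with `IsGeodesicOn` this passes at once to subsets of the parameter set. -/
structure IsFlowOn (g : SmoothMetric m M) (A : HermitianConnection m M n)
    (z : ℝ → TangentBundle (𝓡∂ m) M × Matrix (Fin n) (Fin n) ℂ) (s : Set ℝ) : Prop where
  cont : ContinuousOn z s
  deriv : ∀ x₀ : M, ∀ t ∈ s, (z t).1.proj ∈ (extChartAt (𝓡∂ m) x₀).source →
    HasDerivWithinAt (fun r => stateCoord x₀ (z r)) (stateField g A x₀ (stateCoord x₀ (z t))) s t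

theorem IsFlowOn.mono {g : SmoothMetric m M} {A : HermitianConnection m M n}
    {z : ℝ → TangentBundle (𝓡∂ m) M × Matrix (Fin n) (Fin n) ℂ} {s s' : Set ℝ}
    (h : IsFlowOn g A z s) (hs : s' ⊆ s) : IsFlowOn g A z s' :=
  ⟨h.cont.mono hs, fun x₀ t ht hx => (h.deriv x₀ t (hs ht) hx).mono hs⟩

theorem IsFlowOn.comp_add {g : SmoothMetric m M} {A : HermitianConnection m M n}
    {z : ℝ → TangentBundle (𝓡∂ m) M × Matrix (Fin n) (Fin n) ℂ} {s : Set ℝ}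
    (h : IsFlowOn g A z s) (a : ℝ) : IsFlowOn g A (fun t => z (t + a)) ((· + a) ⁻¹' s) := by
  refine ⟨h.cont.comp (by fun_prop) fun t ht => ht, fun x₀ t ht hx => ?_⟩
  have h1 := h.deriv x₀ (t + a) ht hx
  have h2 : HasDerivWithinAt (fun t : ℝ => t + a) 1 ((· + a) ⁻¹' s) t :=
    ((hasDerivAt_id t).add_const a).hasDerivWithinAt
  have h3 := h1.scomp t h2 (fun t ht => ht)
  rw [one_smul] at h3
  exact h3

theorem IsFlowOn.mul_right {g : SmoothMetric m M} {A : HermitianConnection m M n}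
    {z : ℝ → TangentBundle (𝓡∂ m) M × Matrix (Fin n) (Fin n) ℂ} {s : Set ℝ}
    (h : IsFlowOn g A z s) (C : Matrix (Fin n) (Fin n) ℂ) :
    IsFlowOn g A (fun t => ((z t).1, (z t).2 * C)) s := by
  refine ⟨h.cont.fst.prodMk (h.cont.snd.mul continuousOn_const), fun x₀ t ht hx => ?_⟩
  have h1 := h.deriv x₀ t ht hx
  have h2 := (hasFDerivAt_fst.comp_hasDerivWithinAt t h1).prodMk
    ((hasFDerivAt_snd.comp_hasDerivWithinAt t h1).mul_const C)
  refine h2.congr_deriv (Prod.ext rfl ?_)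
  change -(formInChart A x₀ (coord x₀ (z t).1) * (z t).2) * C =
    -(formInChart A x₀ (coord x₀ (z t).1) * ((z t).2 * C))
  rw [neg_mul, Matrix.mul_assoc]

theorem formInChart_coord (A : HermitianConnection m M n) {x₀ : M} {p : TangentBundle (𝓡∂ m) M}
    (hp : p.proj ∈ (extChartAt (𝓡∂ m) x₀).source) :
    formInChart A x₀ (coord x₀ p) = A.form p.proj p.snd := by
  rw [formInChart, ofCoord_coord hp]

theorem continuousOn_velocity {γ : ℝ → M} {s : Set ℝ} (hs : UniqueDiffOn ℝ s)
    (hγ : ContMDiffOn 𝓘(ℝ, ℝ) (𝓡∂ m) ∞ γ s) :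
    ContinuousOn (velocity γ s : ℝ → TangentBundle (𝓡∂ m) M) s := by
  have h1 := hγ.continuousOn_tangentMapWithin (by simp) hs.uniqueMDiffOn
  have h2 : Continuous (fun t : ℝ => (⟨t, (1 : ℝ)⟩ : TangentBundle 𝓘(ℝ, ℝ) ℝ)) := by
    have := (tangentBundleModelSpaceHomeomorph 𝓘(ℝ, ℝ)).symm.continuous.comp
      (show Continuous (fun t : ℝ => ((t, (1 : ℝ)) : ModelProd ℝ ℝ)) from by
        exact continuous_id.prodMk continuous_const)
    exact this
  exact h1.comp h2.continuousOn (fun t ht => ht)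

theorem contDiffWithinAt_chart_comp {γ : ℝ → M} {s : Set ℝ}
    (hγ : ContMDiffOn 𝓘(ℝ, ℝ) (𝓡∂ m) ∞ γ s) {x₀ : M} {t : ℝ} (ht : t ∈ s)
    (hx : γ t ∈ (extChartAt (𝓡∂ m) x₀).source) :
    ContDiffWithinAt ℝ ∞ (fun r => extChartAt (𝓡∂ m) x₀ (γ r)) s t := by
  rw [← contMDiffWithinAt_iff_contDiffWithinAt]
  have h1 : ContMDiffAt (𝓡∂ m) 𝓘(ℝ, Model m) ∞ (extChartAt (𝓡∂ m) x₀) (γ t) :=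
    contMDiffAt_extChartAt' (by rwa [extChartAt_source] at hx)
  exact h1.comp_contMDiffWithinAt t (hγ t ht)

theorem coord_velocity {γ : ℝ → M} {s : Set ℝ} (hs : UniqueDiffOn ℝ s)
    (hγ : ContMDiffOn 𝓘(ℝ, ℝ) (𝓡∂ m) ∞ γ s) {x₀ : M} {t : ℝ} (ht : t ∈ s)
    (hx : γ t ∈ (extChartAt (𝓡∂ m) x₀).source) :
    coord x₀ (velocity γ s t) =
      (extChartAt (𝓡∂ m) x₀ (γ t), derivWithin (fun r => extChartAt (𝓡∂ m) x₀ (γ r)) s t) := by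
  refine Prod.ext rfl ?_
  have h1 := mfderiv_comp_mfderivWithin (I := 𝓘(ℝ, ℝ)) (I' := 𝓡∂ m) (I'' := 𝓘(ℝ, Model m)) t
    (mdifferentiableAt_extChartAt (by rwa [extChartAt_source] at hx))
    ((hγ t ht).mdifferentiableWithinAt (by simp)) (hs t ht).uniqueMDiffWithinAt
  have h2 : mfderivWithin 𝓘(ℝ, ℝ) 𝓘(ℝ, Model m) (extChartAt (𝓡∂ m) x₀ ∘ γ) s t (1 : ℝ) =
      derivWithin (fun r => extChartAt (𝓡∂ m) x₀ (γ r)) s t := by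
    rw [mfderivWithin_eq_fderivWithin]; rfl
  rw [← h2, h1]
  rfl

theorem IsGeodesicOn.isFlowOn {g : SmoothMetric m M} {A : HermitianConnection m M n} {γ : ℝ → M}
    {s : Set ℝ} (hs : UniqueDiffOn ℝ s) (hγ : IsGeodesicOn g γ s)
    {W : ℝ → Matrix (Fin n) (Fin n) ℂ}
    (hW : ∀ t ∈ s, HasDerivWithinAt W
      (-(A.form (γ t) (mfderivWithin 𝓘(ℝ, ℝ) (𝓡∂ m) γ s t (1 : ℝ)) * W t)) s t) :
    IsFlowOn g A (fun t => (velocity γ s t, W t)) s := by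
  refine ⟨(continuousOn_velocity hs hγ.smooth).prodMk
    fun t ht => (hW t ht).continuousWithinAt, fun x₀ t ht hx => ?_⟩
  change γ t ∈ _ at hx
  set c : ℝ → Model m := fun r => extChartAt (𝓡∂ m) x₀ (γ r) with hc
  have hcd := contDiffWithinAt_chart_comp hγ.smooth ht hx
  have d1 : HasDerivWithinAt c (derivWithin c s t) s t :=
    (hcd.differentiableWithinAt (by simp)).hasDerivWithinAt
  have d2 : HasDerivWithinAt (derivWithin c s) (derivWithin (derivWithin c s) s t) s t := by
    have h1 : ContDiffWithinAt ℝ ∞ (fderivWithin ℝ c s) s t :=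
      hcd.fderivWithin_right hs (m := ∞) (by simp) ht
    have h2 : ContDiffWithinAt ℝ ∞ (derivWithin c s) s t :=
      h1.clm_apply contDiffWithinAt_const
    exact (h2.differentiableWithinAt (by simp)).hasDerivWithinAt
  have hct : c t ∈ (extChartAt (𝓡∂ m) x₀).target := (extChartAt (𝓡∂ m) x₀).map_source hx
  have hacc : derivWithin (derivWithin c s) s t = geodesicAccel g x₀ (c t, derivWithin c s t) := by
    have h1 := hγ.geodesic_eq x₀ t ht hx
    have h2 : metricForm g x₀ (c t) (derivWithin (derivWithin c s) s t) =
        -christoffelForm g x₀ (c t) (derivWithin c s t) := by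
      ext w
      rw [metricForm_apply, neg_apply, christoffelForm_apply g hct]
      exact eq_neg_of_add_eq_zero_left (h1 w)
    obtain ⟨e, he⟩ := isInvertible_metricForm g hct
    rw [geodesicAccel, ← h2, ← he, ContinuousLinearMap.inverse_equiv]
    exact (e.symm_apply_apply _).symm
  have hco := coord_velocity hs hγ.smooth ht hx
  have hev : (fun r => stateCoord x₀ (velocity γ s r, W r)) =ᶠ[𝓝[s] t]
      fun r => ((c r, derivWithin c s r), W r) := by
    have h1 : ∀ᶠ r in 𝓝[s] t, γ r ∈ (extChartAt (𝓡∂ m) x₀).source :=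
      (hγ.smooth.continuousOn t ht).eventually ((isOpen_extChartAt_source x₀).mem_nhds hx)
    filter_upwards [h1, self_mem_nhdsWithin] with r hr hrs
    exact Prod.ext (coord_velocity hs hγ.smooth hrs hr) rfl
  refine (((d1.prodMk d2).prodMk (hW t ht)).congr_of_eventuallyEq hev
    (hev.self_of_nhdsWithin ht)).congr_deriv ?_
  refine Prod.ext ?_ ?_
  · simp only [stateField, stateCoord, hco, hacc]
    rfl
  · simp only [stateField, stateCoord]
    rw [formInChart_coord A (p := velocity γ s t) hx]
    rfl

theorem contDiffWithinAt_stateField (g : SmoothMetric m M) (A : HermitianConnection m M n) {x₀ : M}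
    {z : (Model m × Model m) × Matrix (Fin n) (Fin n) ℂ}
    (hz : z.1.1 ∈ (extChartAt (𝓡∂ m) x₀).target) :
    ContDiffWithinAt ℝ ∞ (stateField g A x₀) ((range (𝓡∂ m) ×ˢ univ) ×ˢ univ) z := by
  have h1 : ContDiffWithinAt ℝ ∞ (formInChart A x₀) (range (𝓡∂ m) ×ˢ univ) z.1 :=
    (contDiffOn_formInChart A x₀ z.1 ⟨hz, trivial⟩).mono_of_mem_nhdsWithin (by
      have h := extChartAt_target_mem_nhdsWithin_of_mem hz
      have : z.1 = (z.1.1, z.1.2) := rfl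
      rw [this, nhdsWithin_prod_eq]
      exact prod_mem_prod h univ_mem)
  have h2 := (contDiffWithinAt_geodesicAccel g hz).comp z
    (s := (range (𝓡∂ m) ×ˢ univ) ×ˢ univ) contDiffWithinAt_fst (fun z hz => hz.1)
  have h3 := h1.comp z (s := (range (𝓡∂ m) ×ˢ univ) ×ˢ univ) contDiffWithinAt_fst (fun z hz => hz.1)
  have h4 : ContDiffWithinAt ℝ ∞ (fun z : (Model m × Model m) × Matrix (Fin n) (Fin n) ℂ => z.1.2)
    ((range (𝓡∂ m) ×ˢ univ) ×ˢ univ) z := contDiff_fst.snd.contDiffWithinAt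
  exact (h4.prodMk h2).prodMk (h3.mul contDiffWithinAt_snd).neg

/-- The states over the chart domain around `x₀` whose coordinates are within `r` of `ζ`. -/
def stateBall (x₀ : M) (ζ : (Model m × Model m) × Matrix (Fin n) (Fin n) ℂ) (r : ℝ) :
    Set (TangentBundle (𝓡∂ m) M × Matrix (Fin n) (Fin n) ℂ) :=
  {q | q.1.proj ∈ (extChartAt (𝓡∂ m) x₀).source ∧ dist (stateCoord x₀ q) ζ < r}

/-- As `stateBall`, with the weak inequality. -/
def stateClosedBall (x₀ : M) (ζ : (Model m × Model m) × Matrix (Fin n) (Fin n) ℂ) (r : ℝ) :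
    Set (TangentBundle (𝓡∂ m) M × Matrix (Fin n) (Fin n) ℂ) :=
  {q | q.1.proj ∈ (extChartAt (𝓡∂ m) x₀).source ∧ dist (stateCoord x₀ q) ζ ≤ r}

theorem continuousOn_stateCoord (x₀ : M) :
    ContinuousOn (stateCoord x₀ : TangentBundle (𝓡∂ m) M × Matrix (Fin n) (Fin n) ℂ → _)
      {q | q.1.proj ∈ (extChartAt (𝓡∂ m) x₀).source} :=
  ((continuousOn_coord x₀).comp continuousOn_fst (fun _ h => h)).prodMk continuousOn_snd

theorem isOpen_stateBall (x₀ : M) (ζ : (Model m × Model m) × Matrix (Fin n) (Fin n) ℂ) (r : ℝ) :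
    IsOpen (stateBall x₀ ζ r) := by
  have h1 : IsOpen {q : TangentBundle (𝓡∂ m) M × Matrix (Fin n) (Fin n) ℂ |
      q.1.proj ∈ (extChartAt (𝓡∂ m) x₀).source} :=
    (isOpen_extChartAt_source x₀).preimage
      ((FiberBundle.continuous_proj (Model m) (TangentSpace (𝓡∂ m))).comp continuous_fst)
  exact (continuousOn_stateCoord x₀).isOpen_inter_preimage h1 (Metric.isOpen_ball (x := ζ) (ε := r))

theorem isClosed_stateClosedBall [T2Space M] (x₀ : M)
    (ζ : (Model m × Model m) × Matrix (Fin n) (Fin n) ℂ) (r : ℝ)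
    (hr : Metric.closedBall ζ.1.1 r ∩ range (𝓡∂ m) ⊆ (extChartAt (𝓡∂ m) x₀).target) :
    IsClosed (stateClosedBall x₀ ζ r) := by
  set K : Set M := (extChartAt (𝓡∂ m) x₀).symm '' (Metric.closedBall ζ.1.1 r ∩ range (𝓡∂ m)) with hK
  have hKc : IsCompact K :=
    ((isCompact_closedBall _ _).inter_right (𝓡∂ m).isClosed_range).image_of_continuousOn
      ((continuousOn_extChartAt_symm x₀).mono hr)
  have hKs : K ⊆ (extChartAt (𝓡∂ m) x₀).source := by
    rintro _ ⟨y, hy, rfl⟩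
    exact (extChartAt (𝓡∂ m) x₀).map_target (hr hy)
  have h1 : IsClosed {q : TangentBundle (𝓡∂ m) M × Matrix (Fin n) (Fin n) ℂ | q.1.proj ∈ K} :=
    hKc.isClosed.preimage
      ((FiberBundle.continuous_proj (Model m) (TangentSpace (𝓡∂ m))).comp continuous_fst)
  have h2 := ((continuousOn_stateCoord (n := n) x₀).mono
    (fun q hq => hKs hq)).preimage_isClosed_of_isClosed h1
    (Metric.isClosed_closedBall (x := ζ) (ε := r))
  convert h2 using 1
  ext q
  refine ⟨fun hq => ⟨⟨extChartAt (𝓡∂ m) x₀ q.1.proj, ⟨?_, ?_⟩, ?_⟩, hq.2⟩, fun hq =>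
    ⟨hKs hq.1, hq.2⟩⟩
  · have h3 := hq.2
    rw [Prod.dist_eq, max_le_iff, Prod.dist_eq, max_le_iff] at h3
    exact h3.1.1
  · exact extChartAt_target_subset_range x₀ ((extChartAt (𝓡∂ m) x₀).map_source hq.1)
  · exact (extChartAt (𝓡∂ m) x₀).left_inv hq.1

omit [IsManifold (𝓡∂ m) ∞ M] in
theorem stateCoord_mem {x₀ : M} {q : TangentBundle (𝓡∂ m) M × Matrix (Fin n) (Fin n) ℂ}
    (hq : q.1.proj ∈ (extChartAt (𝓡∂ m) x₀).source) :
    stateCoord x₀ q ∈ ((range (𝓡∂ m) ×ˢ univ) ×ˢ univ :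
      Set ((Model m × Model m) × Matrix (Fin n) (Fin n) ℂ)) :=
  ⟨⟨extChartAt_target_subset_range x₀ ((extChartAt (𝓡∂ m) x₀).map_source hq), trivial⟩, trivial⟩

/-- Around each state there is a coordinate ball on which the vector field is bounded and
Lipschitz. -/
theorem exists_stateBall [T2Space M] (g : SmoothMetric m M) (A : HermitianConnection m M n)
    (q : TangentBundle (𝓡∂ m) M × Matrix (Fin n) (Fin n) ℂ) :
    ∃ (r : ℝ) (L : ℝ) (K : NNReal), 0 < r ∧ 0 ≤ L ∧ ∀ r' ≤ r,
      IsClosed (stateClosedBall q.1.proj (stateCoord q.1.proj q) r') ∧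
      (∀ p ∈ stateClosedBall q.1.proj (stateCoord q.1.proj q) r',
        ‖stateField g A q.1.proj (stateCoord q.1.proj p)‖ ≤ L) ∧
      LipschitzOnWith K (stateField g A q.1.proj)
        (stateCoord q.1.proj '' stateClosedBall q.1.proj (stateCoord q.1.proj q) r') := by
  set x₀ := q.1.proj with hx₀
  set ζ := stateCoord x₀ q with hζ
  set D : Set ((Model m × Model m) × Matrix (Fin n) (Fin n) ℂ) := (range (𝓡∂ m) ×ˢ univ) ×ˢ univ
  have hmem : x₀ ∈ (extChartAt (𝓡∂ m) x₀).source := mem_extChartAt_source x₀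
  have hζt : ζ.1.1 ∈ (extChartAt (𝓡∂ m) x₀).target := (extChartAt (𝓡∂ m) x₀).map_source hmem
  have hsm := contDiffWithinAt_stateField g A hζt
  have hconv : Convex ℝ D := ((𝓡∂ m).convex_range.prod convex_univ).prod convex_univ
  obtain ⟨K, U, hU, hK⟩ := (hsm.of_le (by simp : (1 : WithTop ℕ∞) ≤ ∞)).exists_lipschitzOnWith hconv
  have hcont : ∀ᶠ z in 𝓝[D] ζ, ‖stateField g A x₀ z‖ < ‖stateField g A x₀ ζ‖ + 1 :=
    hsm.continuousWithinAt.norm.eventually (gt_mem_nhds (by linarith))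
  obtain ⟨r₁, hr₁, H₁⟩ := Metric.mem_nhdsWithin_iff.1 (inter_mem hU hcont)
  obtain ⟨r₂, hr₂, H₂⟩ := Metric.mem_nhdsWithin_iff.1 (extChartAt_target_mem_nhdsWithin_of_mem hζt)
  have hsub : ∀ p ∈ stateClosedBall x₀ ζ (min r₁ r₂ / 2),
      stateCoord x₀ p ∈ Metric.ball ζ r₁ ∩ D := by
    intro p hp
    refine ⟨?_, stateCoord_mem hp.1⟩
    have h1 := hp.2
    have h2 := min_le_left r₁ r₂
    rw [Metric.mem_ball]
    linarith
  refine ⟨min r₁ r₂ / 2, ‖stateField g A x₀ ζ‖ + 1, K, by positivity, by positivity,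
    fun r' hr' => ⟨?_, ?_, ?_⟩⟩
  · refine isClosed_stateClosedBall x₀ ζ _ fun y hy => H₂ ⟨?_, hy.2⟩
    have h1 : dist y ζ.1.1 ≤ r' := hy.1
    have h2 := min_le_right r₁ r₂
    rw [Metric.mem_ball]
    linarith
  · intro p hp
    exact le_of_lt (H₁ (hsub p ⟨hp.1, hp.2.trans hr'⟩)).2
  · refine hK.mono ?_
    rintro _ ⟨p, hp, rfl⟩
    exact (H₁ (hsub p ⟨hp.1, hp.2.trans hr'⟩)).1

/-- A flow line which starts within `r / 2` of the centre of a coordinate ball of radius `r`, on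
which the speed is at most `L`, stays in the ball for times less than `r / (2 L)`. -/
theorem IsFlowOn.mem_stateBall {g : SmoothMetric m M} {A : HermitianConnection m M n}
    {z : ℝ → TangentBundle (𝓡∂ m) M × Matrix (Fin n) (Fin n) ℂ} {a b : ℝ}
    (h : IsFlowOn g A z (Icc a b)) {x₀ : M} {ζ : (Model m × Model m) × Matrix (Fin n) (Fin n) ℂ}
    {r L : ℝ} (hcl : IsClosed (stateClosedBall x₀ ζ r))
    (hL : ∀ p ∈ stateClosedBall x₀ ζ r, ‖stateField g A x₀ (stateCoord x₀ p)‖ ≤ L)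
    (hL0 : 0 ≤ L) (hr : 0 < r)
    (ha : z a ∈ stateBall x₀ ζ (r / 2)) (hab : L * (b - a) ≤ r / 2) :
    ∀ t ∈ Icc a b, z t ∈ stateBall x₀ ζ r ∧
      dist (stateCoord x₀ (z t)) (stateCoord x₀ (z a)) ≤ L * (t - a) := by
  have key : ∀ t ∈ Icc a b, (∀ u ∈ Icc a t, z u ∈ stateClosedBall x₀ ζ r) →
      dist (stateCoord x₀ (z t)) (stateCoord x₀ (z a)) ≤ L * (t - a) := by
    intro t ht hu
    have h1 := (convex_Icc a t).norm_image_sub_le_of_norm_hasDerivWithin_le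
      (f := fun r => stateCoord x₀ (z r)) (C := L)
      (f' := fun r => stateField g A x₀ (stateCoord x₀ (z r)))
      (fun u hu' => (h.deriv x₀ u ⟨hu'.1, hu'.2.trans ht.2⟩ (hu u hu').1).mono
        (Icc_subset_Icc_right ht.2))
      (fun u hu' => hL _ (hu u hu')) (left_mem_Icc.2 ht.1) (right_mem_Icc.2 ht.1)
    rw [dist_eq_norm]
    rwa [Real.norm_of_nonneg (sub_nonneg.2 ht.1)] at h1
  have hsub : stateBall x₀ ζ r ⊆ stateClosedBall x₀ ζ r := fun q hq => ⟨hq.1, le_of_lt hq.2⟩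
  have hin := forall_mem_Icc_of_confined h.cont hcl (isOpen_stateBall x₀ ζ r) hsub
    ⟨ha.1, ha.2.trans (by linarith)⟩ (fun t ht hu => ⟨(hu t (right_mem_Icc.2 ht.1)).1, by
      have h1 := key t ht hu
      have h2 := dist_triangle (stateCoord x₀ (z t)) (stateCoord x₀ (z a)) ζ
      have h3 := ha.2
      have h4 : L * (t - a) ≤ L * (b - a) := mul_le_mul_of_nonneg_left (by linarith [ht.2]) hL0
      linarith⟩)
  exact fun t ht => ⟨hin t ht, key t ht fun u hu => hsub (hin u ⟨hu.1, hu.2.trans ht.2⟩)⟩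

end Flow

section Stability
variable {m n : ℕ} [NeZero m] {M : Type*} [TopologicalSpace M]
  [ChartedSpace (EuclideanHalfSpace m) M] [IsManifold (𝓡∂ m) ∞ M]

/-! ### Continuous dependence of geodesics and transport on the initial condition -/

theorem tendsto_of_stateCoord {ι : Type*} {l : Filter ι} {x₀ : M}
    {q : ι → TangentBundle (𝓡∂ m) M × Matrix (Fin n) (Fin n) ℂ}
    {q' : TangentBundle (𝓡∂ m) M × Matrix (Fin n) (Fin n) ℂ}
    (hq' : q'.1.proj ∈ (extChartAt (𝓡∂ m) x₀).source)
    (hq : ∀ᶠ k in l, (q k).1.proj ∈ (extChartAt (𝓡∂ m) x₀).source)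
    (h : Tendsto (fun k => stateCoord x₀ (q k)) l (𝓝 (stateCoord x₀ q'))) :
    Tendsto q l (𝓝 q') := by
  have h1 : Tendsto (fun k => coord x₀ (q k).1) l (𝓝 (coord x₀ q'.1)) :=
    (continuous_fst.tendsto _).comp h
  have h2 : Tendsto (fun k => (q k).2) l (𝓝 q'.2) :=
    (continuous_snd.tendsto (stateCoord x₀ q')).comp h
  have h3 := continuousOn_ofCoord x₀ (coord x₀ q'.1)
    ⟨(extChartAt (𝓡∂ m) x₀).map_source hq', trivial⟩
  have h4 : Tendsto (fun k => coord x₀ (q k).1) l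
      (𝓝[(extChartAt (𝓡∂ m) x₀).target ×ˢ univ] (coord x₀ q'.1)) :=
    tendsto_nhdsWithin_iff.2 ⟨h1, hq.mono fun k hk =>
      ⟨(extChartAt (𝓡∂ m) x₀).map_source hk, trivial⟩⟩
  have h5 : Tendsto (fun k => ofCoord x₀ (coord x₀ (q k).1)) l (𝓝 (ofCoord x₀ (coord x₀ q'.1))) :=
    Tendsto.comp h3 h4
  rw [ofCoord_coord hq'] at h5
  have h6 : Tendsto (fun k => (q k).1) l (𝓝 q'.1) :=
    h5.congr' (hq.mono fun k hk => ofCoord_coord hk)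
  exact h6.prodMk_nhds h2

theorem tendsto_stateCoord {ι : Type*} {l : Filter ι} {x₀ : M}
    {q : ι → TangentBundle (𝓡∂ m) M × Matrix (Fin n) (Fin n) ℂ}
    {q' : TangentBundle (𝓡∂ m) M × Matrix (Fin n) (Fin n) ℂ}
    (hq' : q'.1.proj ∈ (extChartAt (𝓡∂ m) x₀).source) (h : Tendsto q l (𝓝 q')) :
    Tendsto (fun k => stateCoord x₀ (q k)) l (𝓝 (stateCoord x₀ q')) := by
  have ho : IsOpen {q : TangentBundle (𝓡∂ m) M × Matrix (Fin n) (Fin n) ℂ |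
      q.1.proj ∈ (extChartAt (𝓡∂ m) x₀).source} :=
    (isOpen_extChartAt_source x₀).preimage
      ((FiberBundle.continuous_proj (Model m) (TangentSpace (𝓡∂ m))).comp continuous_fst)
  exact ((continuousOn_stateCoord x₀).continuousAt (ho.mem_nhds hq')).tendsto.comp h

/-- The flow lines `zk` on `[0, Tk]` converge to `z` up to time `t`, in a sense that is meaningful
without a uniform structure on the state space: values at convergent times converge. Convergence is
along an ultrafilter, so that of two complementary cases for the index one holds eventually. -/
def FlowTendsto {ι : Type*} (𝓤 : Ultrafilter ι)
    (zk : ι → ℝ → TangentBundle (𝓡∂ m) M × Matrix (Fin n) (Fin n) ℂ) (Tk : ι → ℝ)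
    (z : ℝ → TangentBundle (𝓡∂ m) M × Matrix (Fin n) (Fin n) ℂ) (t : ℝ) : Prop :=
  ∀ (s : ι → ℝ) (σ : ℝ), (∀ᶠ k in 𝓤, s k ∈ Icc 0 (min t (Tk k))) → Tendsto s 𝓤 (𝓝 σ) →
    Tendsto (fun k => zk k (s k)) 𝓤 (𝓝 (z σ))

theorem hasDerivWithinAt_Ici_of_Icc {F : Type*} [NormedAddCommGroup F] [NormedSpace ℝ F] {f : ℝ → F}
    {f' : F} {a b t : ℝ} (h : HasDerivWithinAt f f' (Icc a b) t) (ht : t ∈ Ico a b) :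
    HasDerivWithinAt f f' (Ici t) t := by
  refine h.mono_of_mem_nhdsWithin ?_
  filter_upwards [Icc_mem_nhdsGE ht.2] with u hu
  exact ⟨ht.1.trans hu.1, hu.2⟩

/-- Around each time, convergence of flow lines propagates for a fixed amount of time, by Gronwall's
inequality in a coordinate ball. -/
theorem FlowTendsto.exists_step [T2Space M] {g : SmoothMetric m M} {A : HermitianConnection m M n}
    {ι : Type*} {𝓤 : Ultrafilter ι}
    {zk : ι → ℝ → TangentBundle (𝓡∂ m) M × Matrix (Fin n) (Fin n) ℂ} {Tk : ι → ℝ}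
    {z : ℝ → TangentBundle (𝓡∂ m) M × Matrix (Fin n) (Fin n) ℂ} {T : ℝ}
    (hk : ∀ᶠ k in 𝓤, IsFlowOn g A (zk k) (Icc 0 (Tk k))) (hz : IsFlowOn g A z (Icc 0 T))
    {t₀ : ℝ} (ht₀ : t₀ ∈ Icc 0 T) :
    ∃ δ > 0, ∀ t₁ ∈ Icc 0 T, ∀ t₂ ∈ Icc 0 T, t₀ - δ ≤ t₁ → t₂ ≤ t₀ + δ →
      FlowTendsto 𝓤 zk Tk z t₁ → FlowTendsto 𝓤 zk Tk z t₂ := by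
  set x₀ := (z t₀).1.proj with hx₀
  set ζ := stateCoord x₀ (z t₀) with hζ
  obtain ⟨r, L, K, hr, hL0, H⟩ := exists_stateBall g A (z t₀)
  obtain ⟨hcl, hL, hK⟩ := H r le_rfl
  have hsub : stateBall x₀ ζ r ⊆ stateClosedBall x₀ ζ r := fun q hq => ⟨hq.1, le_of_lt hq.2⟩
  have hball : ∀ᶠ t in 𝓝[Icc 0 T] t₀, z t ∈ stateBall x₀ ζ (r / 2) :=
    (hz.cont t₀ ht₀).eventually ((isOpen_stateBall x₀ ζ (r / 2)).mem_nhds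
      ⟨mem_extChartAt_source _, by rw [dist_self]; positivity⟩)
  obtain ⟨δ₁, hδ₁, H₁⟩ := Metric.mem_nhdsWithin_iff.1 hball
  set δ := min (δ₁ / 2) (r / (4 * (L + 1))) with hδ
  have hδpos : 0 < δ := by positivity
  have hδr : L * (2 * δ) ≤ r / 2 := by
    have h1 : δ ≤ r / (4 * (L + 1)) := min_le_right _ _
    rw [le_div_iff₀ (by positivity)] at h1
    nlinarith
  have hnear : ∀ t ∈ Icc 0 T, t₀ - δ ≤ t → t ≤ t₀ + δ → z t ∈ stateBall x₀ ζ (r / 2) := by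
    intro t ht h1 h2
    refine H₁ ⟨?_, ht⟩
    have h3 : δ ≤ δ₁ / 2 := min_le_left _ _
    rw [Metric.mem_ball, Real.dist_eq, abs_lt]
    constructor <;> linarith
  refine ⟨δ, hδpos, fun t₁ ht₁ t₂ ht₂ h1 h2 hconv s σ hs hσ => ?_⟩
  rcases Ultrafilter.eventually_or.1 (Eventually.of_forall (f := (𝓤 : Filter ι))
    fun k => le_or_gt (s k) t₁) with hcase | hcase
  · refine hconv s σ ?_ hσ
    filter_upwards [hs, hcase] with k hk1 hk2
    exact ⟨hk1.1, le_min hk2 (hk1.2.trans (min_le_right _ _))⟩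
  have hstart : Tendsto (fun k => zk k t₁) 𝓤 (𝓝 (z t₁)) := by
    refine hconv (fun _ => t₁) t₁ ?_ tendsto_const_nhds
    filter_upwards [hs, hcase] with k hk1 hk2
    exact ⟨ht₁.1, le_min le_rfl (hk2.le.trans (hk1.2.trans (min_le_right _ _)))⟩
  have hstart' : ∀ᶠ k in 𝓤, zk k t₁ ∈ stateBall x₀ ζ (r / 2) := by
    by_cases ht12 : t₁ ≤ t₂
    · exact hstart.eventually ((isOpen_stateBall x₀ ζ (r / 2)).mem_nhds
        (hnear t₁ ht₁ h1 (ht12.trans h2)))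
    · exfalso
      obtain ⟨k, hk1, hk2⟩ := (hs.and hcase).exists
      exact absurd (hk2.le.trans (hk1.2.trans (min_le_left _ _))) ht12
  -- Gronwall's inequality on `[t₁, s k]`
  have hgron : ∀ᶠ k in 𝓤, zk k (s k) ∈ stateBall x₀ ζ r ∧ z (s k) ∈ stateBall x₀ ζ (r / 2) ∧
      dist (stateCoord x₀ (zk k (s k))) (stateCoord x₀ (z (s k))) ≤
        dist (stateCoord x₀ (zk k t₁)) (stateCoord x₀ (z t₁)) * Real.exp (K * (2 * δ)) := by
    filter_upwards [hs, hcase, hstart', hk] with k hk1 hk2 hk3 hk4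
    have hsT : s k ≤ Tk k := hk1.2.trans (min_le_right _ _)
    have hst₂ : s k ≤ t₂ := hk1.2.trans (min_le_left _ _)
    have hfk : IsFlowOn g A (zk k) (Icc t₁ (s k)) := hk4.mono (Icc_subset_Icc ht₁.1 hsT)
    have hfz : IsFlowOn g A z (Icc t₁ (s k)) := hz.mono (Icc_subset_Icc ht₁.1 (hst₂.trans ht₂.2))
    have hin := hfk.mem_stateBall hcl hL hL0 hr hk3
      ((mul_le_mul_of_nonneg_left (by linarith) hL0).trans hδr)
    have hinz : ∀ t ∈ Icc t₁ (s k), z t ∈ stateBall x₀ ζ (r / 2) := fun t ht =>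
      hnear t ⟨ht₁.1.trans ht.1, ht.2.trans (hst₂.trans ht₂.2)⟩ (h1.trans ht.1)
        (ht.2.trans (hst₂.trans h2))
    have hinz' : ∀ t ∈ Icc t₁ (s k), z t ∈ stateClosedBall x₀ ζ r := fun t ht =>
      ⟨(hinz t ht).1, (hinz t ht).2.le.trans (by linarith)⟩
    have hmem : s k ∈ Icc t₁ (s k) := ⟨hk2.le, le_rfl⟩
    refine ⟨(hin _ hmem).1, hinz _ hmem, ?_⟩
    have h3 := dist_le_of_trajectories_ODE_of_mem (v := fun _ => stateField g A x₀)
      (s := fun _ => stateCoord x₀ '' stateClosedBall x₀ ζ r) (K := K)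
      (f := fun t => stateCoord x₀ (zk k t)) (g := fun t => stateCoord x₀ (z t))
      (δ := dist (stateCoord x₀ (zk k t₁)) (stateCoord x₀ (z t₁)))
      (a := t₁) (b := s k) (fun _ _ => hK)
      (fun t ht => (hfk.deriv x₀ t ht (hin t ht).1.1).continuousWithinAt)
      (fun t ht => hasDerivWithinAt_Ici_of_Icc (hfk.deriv x₀ t (Ico_subset_Icc_self ht)
        (hin t (Ico_subset_Icc_self ht)).1.1) ht)
      (fun t ht => ⟨_, hsub (hin t (Ico_subset_Icc_self ht)).1, rfl⟩)
      (fun t ht => (hfz.deriv x₀ t ht (hinz t ht).1).continuousWithinAt)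
      (fun t ht => hasDerivWithinAt_Ici_of_Icc (hfz.deriv x₀ t (Ico_subset_Icc_self ht)
        (hinz t (Ico_subset_Icc_self ht)).1) ht)
      (fun t ht => ⟨_, hinz' t (Ico_subset_Icc_self ht), rfl⟩) le_rfl (s k) hmem
    refine h3.trans (mul_le_mul_of_nonneg_left (Real.exp_le_exp.2 ?_) dist_nonneg)
    exact mul_le_mul_of_nonneg_left (by linarith) K.2
  have hσ2 : σ ∈ Icc 0 T ∧ t₀ - δ ≤ σ ∧ σ ≤ t₀ + δ := by
    have hh : ∀ᶠ k in 𝓤, s k ∈ Icc t₁ t₂ := by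
      filter_upwards [hs, hcase] with k hk1 hk2
      exact ⟨hk2.le, hk1.2.trans (min_le_left _ _)⟩
    have := isClosed_Icc.mem_of_tendsto hσ hh
    exact ⟨⟨ht₁.1.trans this.1, this.2.trans ht₂.2⟩, h1.trans this.1, this.2.trans h2⟩
  have hzσ := hnear σ hσ2.1 hσ2.2.1 hσ2.2.2
  have hlimz : Tendsto (fun k => z (s k)) 𝓤 (𝓝 (z σ)) := by
    refine Tendsto.comp (hz.cont σ hσ2.1) (tendsto_nhdsWithin_iff.2 ⟨hσ, ?_⟩)
    filter_upwards [hs] with k hk1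
    exact ⟨hk1.1, (hk1.2.trans (min_le_left _ _)).trans ht₂.2⟩
  have hz1 : (z t₁).1.proj ∈ (extChartAt (𝓡∂ m) x₀).source := by
    obtain ⟨k, hk1, hk2⟩ := (hs.and hcase).exists
    exact (hnear t₁ ht₁ h1 ((hk2.le.trans (hk1.2.trans (min_le_left _ _))).trans h2)).1
  have hd0 : Tendsto (fun k => dist (stateCoord x₀ (zk k (s k))) (stateCoord x₀ (z (s k)))) 𝓤
    (𝓝 0) := by
    have h4 : Tendsto (fun k => dist (stateCoord x₀ (zk k t₁)) (stateCoord x₀ (z t₁)) *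
        Real.exp (K * (2 * δ))) 𝓤 (𝓝 0) := by
      have h5 := (tendsto_stateCoord hz1 hstart).dist
        (tendsto_const_nhds (x := stateCoord x₀ (z t₁)))
      rw [dist_self] at h5
      simpa using h5.mul_const (Real.exp (K * (2 * δ)))
    exact squeeze_zero' (Eventually.of_forall fun _ => dist_nonneg)
      (hgron.mono fun k hk1 => hk1.2.2) h4
  refine tendsto_of_stateCoord hzσ.1 (hgron.mono fun k hk1 => hk1.1.1) ?_
  have h6 := tendsto_stateCoord hzσ.1 hlimz
  rw [tendsto_iff_dist_tendsto_zero] at h6 ⊢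
  refine squeeze_zero (fun _ => dist_nonneg) (fun k => dist_triangle _ (stateCoord x₀ (z (s k))) _)
    ?_
  simpa using hd0.add h6

/-- Flow lines depend continuously on the initial condition. -/
theorem flowTendsto [T2Space M] {g : SmoothMetric m M} {A : HermitianConnection m M n}
    {ι : Type*} {𝓤 : Ultrafilter ι}
    {zk : ι → ℝ → TangentBundle (𝓡∂ m) M × Matrix (Fin n) (Fin n) ℂ} {Tk : ι → ℝ}
    {z : ℝ → TangentBundle (𝓡∂ m) M × Matrix (Fin n) (Fin n) ℂ} {T : ℝ} (hT : 0 ≤ T)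
    (hk : ∀ᶠ k in 𝓤, IsFlowOn g A (zk k) (Icc 0 (Tk k))) (hz : IsFlowOn g A z (Icc 0 T))
    (h0 : Tendsto (fun k => zk k 0) 𝓤 (𝓝 (z 0))) : FlowTendsto 𝓤 zk Tk z T := by
  have hzero : FlowTendsto 𝓤 zk Tk z 0 := by
    intro s σ hs hσ
    have h1 : ∀ᶠ k in 𝓤, s k = 0 := hs.mono fun k hk =>
      le_antisymm (hk.2.trans (min_le_left _ _)) hk.1
    have h2 : σ = 0 := tendsto_nhds_unique hσ
      (tendsto_const_nhds.congr' (h1.mono fun k hk => hk.symm))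
    rw [h2]
    exact h0.congr' (h1.mono fun k hk => by simp only [hk])
  have hsub : Icc 0 T ⊆ {t | FlowTendsto 𝓤 zk Tk z t} := by
    refine IsClosed.Icc_subset_of_forall_exists_gt ?_ hzero ?_
    · refine isClosed_of_closure_subset fun t ht => ?_
      have htI : t ∈ Icc 0 T := isClosed_Icc.closure_subset_iff.2 inter_subset_right ht
      obtain ⟨δ, hδ, H⟩ := FlowTendsto.exists_step hk hz htI
      obtain ⟨t₁, ht₁, ht₁'⟩ := mem_closure_iff.1 ht (Ioi (t - δ)) isOpen_Ioi
        (show t - δ < t by linarith)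
      exact ⟨H t₁ ht₁'.2 t htI (le_of_lt ht₁) (by linarith) ht₁'.1, htI⟩
    · rintro t ⟨ht, htI⟩ y hy
      obtain ⟨δ, hδ, H⟩ := FlowTendsto.exists_step hk hz (Ico_subset_Icc_self htI)
      have hlt : t < min (min y T) (t + δ) := lt_min (lt_min hy htI.2) (by linarith)
      refine ⟨min (min y T) (t + δ), ?_, hlt, (min_le_left _ _).trans (min_le_left _ _)⟩
      exact H t (Ico_subset_Icc_self htI) _
        ⟨htI.1.trans hlt.le, (min_le_left _ _).trans (min_le_right _ _)⟩
        (by linarith) (min_le_right _ _) ht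
  exact hsub ⟨hT, le_rfl⟩

theorem eq_of_tendsto_const [T2Space M] {ι : Type*} {l : Filter ι} [l.NeBot]
    {q q' : TangentBundle (𝓡∂ m) M × Matrix (Fin n) (Fin n) ℂ}
    (h : Tendsto (fun _ : ι => q) l (𝓝 q')) : q = q' := by
  have h1 : q.1.proj = q'.1.proj := tendsto_nhds_unique tendsto_const_nhds
    (((FiberBundle.continuous_proj (Model m) (TangentSpace (𝓡∂ m))).comp
      continuous_fst).continuousAt.tendsto.comp h)
  have hs : q'.1.proj ∈ (extChartAt (𝓡∂ m) q'.1.proj).source := mem_extChartAt_source _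
  have h2 := tendsto_nhds_unique tendsto_const_nhds (tendsto_stateCoord hs h)
  refine Prod.ext ?_ (show (stateCoord q'.1.proj q).2 = (stateCoord q'.1.proj q').2 by rw [h2])
  have h3 : coord q'.1.proj q.1 = coord q'.1.proj q'.1 := congrArg Prod.fst h2
  have hs' : q.1.proj ∈ (extChartAt (𝓡∂ m) q'.1.proj).source := by rw [h1]; exact hs
  exact (ofCoord_coord hs').symm.trans ((congrArg _ h3).trans (ofCoord_coord hs))

/-- Flow lines are determined by their initial condition. -/
theorem IsFlowOn.eqOn [T2Space M] {g : SmoothMetric m M} {A : HermitianConnection m M n}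
    {z z' : ℝ → TangentBundle (𝓡∂ m) M × Matrix (Fin n) (Fin n) ℂ} {T : ℝ}
    (hz : IsFlowOn g A z (Icc 0 T)) (hz' : IsFlowOn g A z' (Icc 0 T)) (h0 : z 0 = z' 0) :
    EqOn z z' (Icc 0 T) := by
  intro t ht
  have h1 := flowTendsto (𝓤 := (pure () : Ultrafilter Unit)) (zk := fun _ => z) (Tk := fun _ => T)
    (ht.1.trans ht.2) (Eventually.of_forall fun _ => hz) hz' (by rw [h0]; exact tendsto_const_nhds)
  exact eq_of_tendsto_const (h1 (fun _ => t) t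
    (Eventually.of_forall fun _ => ⟨ht.1, by simpa using ht.2⟩)
    tendsto_const_nhds)

omit [NeZero m] in
theorem abs_apply_sub_le_dist {x y : Model m} (i : Fin m) : |x i - y i| ≤ dist x y := by
  rw [dist_eq_norm, ← Real.norm_eq_abs]
  exact PiLp.norm_apply_le (x - y) i

omit [IsManifold (𝓡∂ m) ∞ M] in
theorem extChartAt_apply_zero_nonneg {x₀ x : M} (hx : x ∈ (extChartAt (𝓡∂ m) x₀).source) :
    0 ≤ extChartAt (𝓡∂ m) x₀ x 0 := by
  have h := extChartAt_target_subset_range x₀ ((extChartAt (𝓡∂ m) x₀).map_source hx)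
  rw [range_modelWithCornersEuclideanHalfSpace] at h
  exact h

/-- The end points of flow lines that reach the boundary depend continuously on the initial
condition, near a flow line that reaches the boundary transversally: the distance to the boundary
decreases at a definite rate near its end point, hence nearby flow lines end soon afterwards. -/
theorem tendsto_exit [T2Space M] {g : SmoothMetric m M} {A : HermitianConnection m M n}
    {ι : Type*} {𝓤 : Ultrafilter ι}
    {zk : ι → ℝ → TangentBundle (𝓡∂ m) M × Matrix (Fin n) (Fin n) ℂ} {Tk : ι → ℝ}
    {z : ℝ → TangentBundle (𝓡∂ m) M × Matrix (Fin n) (Fin n) ℂ} {T : ℝ} (hT : 0 < T)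
    (hk : ∀ᶠ k in 𝓤, IsFlowOn g A (zk k) (Icc 0 (Tk k)))
    (hk0 : ∀ᶠ k in 𝓤, 0 ≤ Tk k) (hkb : ∀ᶠ k in 𝓤, (zk k (Tk k)).1.proj ∈ (𝓡∂ m).boundary M)
    (hz : IsFlowOn g A z (Icc 0 T)) (hzi : ∀ t ∈ Ico 0 T, (z t).1.proj ∈ (𝓡∂ m).interior M)
    (hzb : (z T).1.proj ∈ (𝓡∂ m).boundary M) (htr : ¬ IsTangentToBoundary (m := m) (z T).1)
    (h0 : Tendsto (fun k => zk k 0) 𝓤 (𝓝 (z 0))) :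
    Tendsto (fun k => zk k (Tk k)) 𝓤 (𝓝 (z T)) := by
  have hconv := flowTendsto hT.le hk hz h0
  rcases Ultrafilter.eventually_or.1 (Eventually.of_forall (f := (𝓤 : Filter ι))
    fun k => le_or_gt (Tk k) T) with hcase | hcase
  · -- the exit times `Tk` accumulate at some `σ ≤ T`, and `z σ` lies on the boundary
    have hmem : ∀ᶠ k in 𝓤, Tk k ∈ Icc 0 T := by
      filter_upwards [hk0, hcase] with k h1 h2 using ⟨h1, h2⟩
    obtain ⟨σ, hσ, hσ'⟩ := isCompact_Icc.ultrafilter_le_nhds (𝓤.map Tk)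
      (le_principal_iff.2 hmem)
    have hlim : Tendsto Tk 𝓤 (𝓝 σ) := hσ'
    have h1 := hconv Tk σ (by
      filter_upwards [hmem] with k hk1
      exact ⟨hk1.1, le_min hk1.2 le_rfl⟩) hlim
    have h2 : (z σ).1.proj ∈ (𝓡∂ m).boundary M :=
      (ModelWithCorners.isClosed_boundary (n := ∞) (by simp)).mem_of_tendsto
        (((FiberBundle.continuous_proj (Model m) (TangentSpace (𝓡∂ m))).comp
          continuous_fst).continuousAt.tendsto.comp h1) hkb
    have h3 : σ = T := by
      by_contra hne
      have := hzi σ ⟨hσ.1, lt_of_le_of_ne hσ.2 hne⟩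
      rw [← ModelWithCorners.compl_interior] at h2
      exact h2 this
    rwa [h3] at h1
  have hstart : Tendsto (fun k => zk k T) 𝓤 (𝓝 (z T)) :=
    hconv (fun _ => T) T (hcase.mono fun k hk1 => ⟨hT.le, le_min le_rfl hk1.le⟩) tendsto_const_nhds
  set x₀ := (z T).1.proj with hx₀
  have hsrc : x₀ ∈ (extChartAt (𝓡∂ m) x₀).source := mem_extChartAt_source _
  set ζ := stateCoord x₀ (z T) with hζ
  have hTm : T ∈ Icc 0 T := ⟨hT.le, le_rfl⟩
  let π₀ : (Model m × Model m) × Matrix (Fin n) (Fin n) ℂ →L[ℝ] ℝ :=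
    (EuclideanSpace.proj (𝕜 := ℝ) (0 : Fin m)).comp
      ((ContinuousLinearMap.fst ℝ (Model m) (Model m)).comp
        (ContinuousLinearMap.fst ℝ (Model m × Model m) (Matrix (Fin n) (Fin n) ℂ)))
  -- the first coordinate `f` of `z` vanishes at time `T`, with negative derivative `u`
  have hζ0 : ζ.1.1 0 = 0 := by
    have h1 : extChartAt (𝓡∂ m) x₀ x₀ ∈ frontier (range (𝓡∂ m)) := hzb
    rw [frontier_range_modelWithCornersEuclideanHalfSpace] at h1
    exact h1.symm
  set u : ℝ := ζ.1.2 0 with hu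
  have hune : u ≠ 0 := htr
  have hule : u ≤ 0 := by
    have d := hz.deriv x₀ T hTm hsrc
    have d1 : HasDerivWithinAt (fun t => (stateCoord x₀ (z t)).1.1 0) u (Icc 0 T) T :=
      π₀.hasFDerivAt.comp_hasDerivWithinAt T d
    have d2 := d1.mono (Ico_subset_Icc_self)
    rw [hasDerivWithinAt_iff_tendsto_slope' (by simp), nhdsWithin_Ico_eq_nhdsLT hT] at d2
    refine le_of_tendsto d2 ?_
    have hev : ∀ᶠ t in 𝓝[<] T, (z t).1.proj ∈ (extChartAt (𝓡∂ m) x₀).source := by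
      rw [← nhdsWithin_Ico_eq_nhdsLT hT]
      have : ContinuousWithinAt (fun t => (z t).1.proj) (Ico 0 T) T :=
        ((FiberBundle.continuous_proj (Model m) (TangentSpace (𝓡∂ m))).comp
          continuous_fst).continuousAt.comp_continuousWithinAt
            ((hz.cont T hTm).mono Ico_subset_Icc_self)
      exact this.eventually ((isOpen_extChartAt_source x₀).mem_nhds hsrc)
    filter_upwards [hev, self_mem_nhdsWithin] with t ht htT
    have h1 : (stateCoord x₀ (z T)).1.1 0 = 0 := hζ0
    have h2 : 0 ≤ (stateCoord x₀ (z t)).1.1 0 := extChartAt_apply_zero_nonneg ht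
    rw [slope_def_field, h1, sub_zero]
    exact div_nonpos_of_nonneg_of_nonpos h2 (sub_nonpos.2 (le_of_lt htT))
  have hneg : u < 0 := lt_of_le_of_ne hule hune
  obtain ⟨r₀, L, K, hr₀, hL0, H⟩ := exists_stateBall g A (z T)
  set r := min r₀ (-u / 2) with hr
  have hrpos : 0 < r := lt_min hr₀ (by linarith)
  obtain ⟨hcl, hL, -⟩ := H r (min_le_left _ _)
  have hvel : ∀ p ∈ stateBall x₀ ζ r, (stateCoord x₀ p).1.2 0 ≤ u / 2 := by
    intro p hp
    have h1 := abs_apply_sub_le_dist (x := (stateCoord x₀ p).1.2) (y := ζ.1.2) 0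
    have h2 : dist (stateCoord x₀ p).1.2 ζ.1.2 ≤ dist (stateCoord x₀ p) ζ :=
      (le_max_right _ _).trans (le_max_left _ _)
    have h3 := (abs_le.1 (h1.trans (h2.trans hp.2.le))).2
    have h4 : r ≤ -u / 2 := min_le_right _ _
    linarith
  have hcoord := tendsto_stateCoord hsrc hstart
  have hcoord0 : Tendsto (fun k => (stateCoord x₀ (zk k T)).1.1 0) 𝓤 (𝓝 0) := by
    have h1 := π₀.continuous.continuousAt.tendsto.comp hcoord
    have h2 : (stateCoord x₀ (z T)).1.1 0 = 0 := hζ0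
    rw [← h2]
    exact h1
  have hinit : ∀ᶠ k in 𝓤, zk k T ∈ stateBall x₀ ζ (r / 2) :=
    hstart.eventually ((isOpen_stateBall x₀ ζ (r / 2)).mem_nhds
      ⟨hsrc, by rw [dist_self]; positivity⟩)
  have key : ∀ η > 0, L * η ≤ r / 2 → ∀ᶠ k in 𝓤, zk k (Tk k) ∈ stateBall x₀ ζ r ∧
      dist (stateCoord x₀ (zk k (Tk k))) (stateCoord x₀ (zk k T)) ≤ L * η := by
    intro η hη hLη
    filter_upwards [hk, hcase, hinit, hcoord0.eventually
      (gt_mem_nhds (show 0 < -u / 2 * η by nlinarith))] with k hk1 hk2 hk3 hk4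
    set b := min (Tk k) (T + η) with hb
    have hTb : T ≤ b := le_min hk2.le (by linarith)
    have hf : IsFlowOn g A (zk k) (Icc T b) := hk1.mono (Icc_subset_Icc hT.le (min_le_left _ _))
    have hbη : b - T ≤ η := by have := min_le_right (Tk k) (T + η); linarith
    have hin := hf.mem_stateBall hcl hL hL0 hrpos hk3
      ((mul_le_mul_of_nonneg_left hbη hL0).trans hLη)
    have hle : Tk k ≤ T + η := by
      by_contra hlt
      have hbe : b = T + η := min_eq_right (not_le.1 hlt).le
      have hd : ∀ t ∈ Icc T b, HasDerivWithinAt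
          (fun t => (stateCoord x₀ (zk k t)).1.1 0 - u / 2 * t)
          ((stateCoord x₀ (zk k t)).1.2 0 - u / 2) (Icc T b) t := by
        intro t ht
        have d := hf.deriv x₀ t ht (hin t ht).1.1
        have d1 : HasDerivWithinAt (fun t => (stateCoord x₀ (zk k t)).1.1 0)
            ((stateCoord x₀ (zk k t)).1.2 0) (Icc T b) t :=
          π₀.hasFDerivAt.comp_hasDerivWithinAt t d
        have d2 : HasDerivWithinAt (fun t => u / 2 * t) (u / 2) (Icc T b) t := by
          simpa using (hasDerivWithinAt_id t (Icc T b)).const_mul (u / 2)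
        exact d1.sub d2
      have hanti := antitoneOn_of_hasDerivWithinAt_nonpos (convex_Icc T b)
        (fun t ht => (hd t ht).continuousWithinAt)
        (fun t ht => (hd t (interior_subset ht)).mono interior_subset)
        (fun t ht => sub_nonpos.2 (hvel _ (hin t (interior_subset ht)).1))
      have h1 := hanti (left_mem_Icc.2 hTb) (right_mem_Icc.2 hTb) hTb
      have h2 : 0 ≤ (stateCoord x₀ (zk k b)).1.1 0 :=
        extChartAt_apply_zero_nonneg (hin b (right_mem_Icc.2 hTb)).1.1
      simp only [hbe] at h1 h2
      nlinarith
    have hTkb : Tk k = b := (min_eq_left hle).symm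
    have hbm : b ∈ Icc T b := right_mem_Icc.2 hTb
    rw [hTkb]
    exact ⟨(hin b hbm).1, (hin b hbm).2.trans (mul_le_mul_of_nonneg_left hbη hL0)⟩
  have hLη : ∀ ε > 0, L * (ε / (2 * (L + 1))) ≤ ε / 2 := by
    intro ε hε
    rw [mul_div_assoc', div_le_div_iff₀ (by positivity) (by norm_num)]
    nlinarith
  refine tendsto_of_stateCoord hsrc
    ((key (r / (2 * (L + 1))) (by positivity) (hLη r hrpos)).mono fun k hk1 => hk1.1.1) ?_
  rw [Metric.tendsto_nhds] at hcoord ⊢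
  intro ε hε
  have hη : 0 < min (r / (2 * (L + 1))) (ε / (2 * (L + 1))) := by positivity
  filter_upwards [hcoord (ε / 2) (by positivity), key _ hη
    ((mul_le_mul_of_nonneg_left (min_le_left _ _) hL0).trans (hLη r hrpos))] with k hk1 hk2
  have h1 := hk2.2.trans ((mul_le_mul_of_nonneg_left (min_le_right _ _) hL0).trans (hLη ε hε))
  have h2 := dist_triangle (stateCoord x₀ (zk k (Tk k))) (stateCoord x₀ (zk k T))
    (stateCoord x₀ (z T))
  linarith

end Stability

/-! ### The tensor square of a matrix -/

section TensorSquare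
open scoped Kronecker
variable {n : ℕ}

/-- The tensor square `u ⊗ u`. It determines `u` up to sign. -/
def tsq (u : Matrix (Fin n) (Fin n) ℂ) : Matrix (Fin n × Fin n) (Fin n × Fin n) ℂ := u ⊗ₖ u

/-- The derivation `X ⊗ 1 + 1 ⊗ X`, the derivative of `u ↦ u ⊗ u` at `1`. -/
def dtsq (X : Matrix (Fin n) (Fin n) ℂ) : Matrix (Fin n × Fin n) (Fin n × Fin n) ℂ :=
  X ⊗ₖ (1 : Matrix (Fin n) (Fin n) ℂ) + (1 : Matrix (Fin n) (Fin n) ℂ) ⊗ₖ X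

/-- The tensor product of matrices as a continuous bilinear map over `ℝ`. -/
noncomputable def kronL : Matrix (Fin n) (Fin n) ℂ →L[ℝ] Matrix (Fin n) (Fin n) ℂ →L[ℝ]
    Matrix (Fin n × Fin n) (Fin n × Fin n) ℂ :=
  (LinearMap.toContinuousLinearMap.toLinearMap ∘ₗ
    LinearMap.mk₂ ℝ (fun a b => a ⊗ₖ b) (fun a b c => Matrix.add_kronecker a b c)
      (fun r a b => Matrix.smul_kronecker r a b)
      (fun a b c => Matrix.kronecker_add a b c)
      (fun r a b => Matrix.kronecker_smul r a b)).toContinuousLinearMap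

theorem tsq_mul (a b : Matrix (Fin n) (Fin n) ℂ) : tsq (a * b) = tsq a * tsq b :=
  Matrix.mul_kronecker_mul a b a b

theorem tsq_one : tsq (1 : Matrix (Fin n) (Fin n) ℂ) = 1 := Matrix.one_kronecker_one

theorem tsq_neg (a : Matrix (Fin n) (Fin n) ℂ) : tsq (-a) = tsq a := by
  ext i j
  simp [tsq]

theorem tsq_eq_iff {u w : Matrix (Fin n) (Fin n) ℂ} : tsq u = tsq w ↔ w = u ∨ w = -u := by
  refine ⟨fun h => ?_, ?_⟩
  · have h' : ∀ i j k l, u i j * u k l = w i j * w k l := fun i j k l =>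
      congr_fun (congr_fun h (i, k)) (j, l)
    by_cases hu : u = 0
    · left
      ext i j
      have := h' i j i j
      rw [hu] at this ⊢
      simpa using this.symm
    · obtain ⟨i, j, hij⟩ : ∃ i j, u i j ≠ 0 := by
        by_contra! hcon
        exact hu (by ext i j; exact hcon i j)
      rcases mul_self_eq_mul_self_iff.1 (h' i j i j) with h1 | h1
      · left
        ext k l
        have := h' i j k l
        rw [← h1] at this
        exact (mul_left_cancel₀ hij this).symm
      · right
        ext k l
        have := h' i j k l
        have h2 : w i j = - u i j := by rw [h1, neg_neg]
        rw [h2, neg_mul, ← mul_neg] at this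
        rw [Matrix.neg_apply, mul_left_cancel₀ hij this, neg_neg]
  · rintro (rfl | rfl)
    · rfl
    · rw [tsq_neg]

theorem dtsq_eq_zero_iff {X : Matrix (Fin n) (Fin n) ℂ} : dtsq X = 0 ↔ X = 0 := by
  refine ⟨fun h => ?_, fun h => by simp [dtsq, h]⟩
  ext i j
  have h1 := congr_fun (congr_fun h (i, i)) (j, i)
  by_cases hij : i = j
  · subst hij
    simpa [dtsq, ← two_mul] using h1
  · simpa [dtsq, Matrix.one_apply, hij] using h1

theorem continuous_tsq : Continuous (tsq : Matrix (Fin n) (Fin n) ℂ → _) :=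
  (kronL.continuous.clm_apply continuous_id : Continuous fun u => kronL u u)

theorem dtsq_mul_tsq (X u : Matrix (Fin n) (Fin n) ℂ) :
    (X * u) ⊗ₖ u + u ⊗ₖ (X * u) = dtsq X * tsq u := by
  rw [dtsq, tsq, add_mul, ← Matrix.mul_kronecker_mul, ← Matrix.mul_kronecker_mul, one_mul]

theorem tsq_mul_dtsq (X u : Matrix (Fin n) (Fin n) ℂ) :
    (u * X) ⊗ₖ u + u ⊗ₖ (u * X) = tsq u * dtsq X := by
  rw [dtsq, tsq, mul_add, ← Matrix.mul_kronecker_mul, ← Matrix.mul_kronecker_mul, mul_one]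

theorem dtsq_neg (X : Matrix (Fin n) (Fin n) ℂ) : dtsq (-X) = -dtsq X := by
  ext i j
  simp [dtsq]
  ring

theorem hasDerivWithinAt_clm_apply_self {E F : Type*} [NormedAddCommGroup E] [NormedSpace ℝ E]
    [NormedAddCommGroup F] [NormedSpace ℝ F] (B : E →L[ℝ] E →L[ℝ] F) {W : ℝ → E} {W' : E}
    {s : Set ℝ} {t : ℝ} (h : HasDerivWithinAt W W' s t) :
    HasDerivWithinAt (fun t => B (W t) (W t)) (B W' (W t) + B (W t) W') s t :=
  (B.hasFDerivAt.comp_hasDerivWithinAt t h).clm_apply h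

theorem hasDerivWithinAt_tsq {W : ℝ → Matrix (Fin n) (Fin n) ℂ} {W' : Matrix (Fin n) (Fin n) ℂ}
    {s : Set ℝ} {t : ℝ} (h : HasDerivWithinAt W W' s t) :
    HasDerivWithinAt (fun t => tsq (W t)) (W' ⊗ₖ W t + W t ⊗ₖ W') s t :=
  hasDerivWithinAt_clm_apply_self kronL h

end TensorSquare

section GaugeODE
variable {n : ℕ} {A₁ A₂ : Matrix (Fin n) (Fin n) ℂ} {W₁ W₂ : ℝ → Matrix (Fin n) (Fin n) ℂ}
  {s : Set ℝ} {t : ℝ}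

theorem hasDerivWithinAt_tsq_transport {A : Matrix (Fin n) (Fin n) ℂ}
    {W : ℝ → Matrix (Fin n) (Fin n) ℂ} (h : HasDerivWithinAt W (-(A * W t)) s t) :
    HasDerivWithinAt (fun t => tsq (W t)) (-(dtsq A * tsq (W t))) s t := by
  have h1 := hasDerivWithinAt_tsq h
  rwa [← neg_mul, dtsq_mul_tsq, dtsq_neg, neg_mul] at h1

theorem hasDerivWithinAt_conjTranspose_transport {A : Matrix (Fin n) (Fin n) ℂ} (hA : Aᴴ = -A)
    {W : ℝ → Matrix (Fin n) (Fin n) ℂ} (h : HasDerivWithinAt W (-(A * W t)) s t) :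
    HasDerivWithinAt (fun t => (W t)ᴴ) ((W t)ᴴ * A) s t := by
  have h1 : HasDerivWithinAt (fun t => (W t)ᴴ) ((-(A * W t))ᴴ) s t := h.star
  rwa [Matrix.conjTranspose_neg, Matrix.conjTranspose_mul, hA, mul_neg, neg_neg] at h1

theorem hasDerivWithinAt_tsq_conjTranspose_transport {A : Matrix (Fin n) (Fin n) ℂ} (hA : Aᴴ = -A)
    {W : ℝ → Matrix (Fin n) (Fin n) ℂ} (h : HasDerivWithinAt W (-(A * W t)) s t) :
    HasDerivWithinAt (fun t => tsq (W t)ᴴ) (tsq (W t)ᴴ * dtsq A) s t := by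
  have h1 := hasDerivWithinAt_tsq (hasDerivWithinAt_conjTranspose_transport hA h)
  rwa [tsq_mul_dtsq] at h1

/-- The conjugate of a constant matrix by the tensor squares of two transports solves the parallel
equation `Q' = Q (A₂ ⊗ 1 + 1 ⊗ A₂) - (A₁ ⊗ 1 + 1 ⊗ A₁) Q`. -/
theorem hasDerivWithinAt_conj_transport (hA₂ : A₂ᴴ = -A₂)
    (h₁ : HasDerivWithinAt W₁ (-(A₁ * W₁ t)) s t) (h₂ : HasDerivWithinAt W₂ (-(A₂ * W₂ t)) s t)
    (C : Matrix (Fin n × Fin n) (Fin n × Fin n) ℂ) :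
    HasDerivWithinAt (fun t => tsq (W₁ t) * C * tsq (W₂ t)ᴴ)
      ((tsq (W₁ t) * C * tsq (W₂ t)ᴴ) * dtsq A₂ -
        dtsq A₁ * (tsq (W₁ t) * C * tsq (W₂ t)ᴴ)) s t := by
  have h := ((hasDerivWithinAt_tsq_transport h₁).mul_const C).mul
    (hasDerivWithinAt_tsq_conjTranspose_transport hA₂ h₂)
  refine h.congr_deriv ?_
  noncomm_ring

/-- Conversely, solutions of the parallel equation become constant after conjugation by the
inverse transports. -/
theorem hasDerivWithinAt_conj_transport_zero (hA₁ : A₁ᴴ = -A₁)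
    (h₁ : HasDerivWithinAt W₁ (-(A₁ * W₁ t)) s t) (h₂ : HasDerivWithinAt W₂ (-(A₂ * W₂ t)) s t)
    {Q : ℝ → Matrix (Fin n × Fin n) (Fin n × Fin n) ℂ}
    (hQ : HasDerivWithinAt Q (Q t * dtsq A₂ - dtsq A₁ * Q t) s t) :
    HasDerivWithinAt (fun t => tsq (W₁ t)ᴴ * Q t * tsq (W₂ t)) 0 s t := by
  have h := ((hasDerivWithinAt_tsq_conjTranspose_transport hA₁ h₁).mul hQ).mul
    (hasDerivWithinAt_tsq_transport h₂)
  refine h.congr_deriv ?_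
  simp only [Pi.mul_apply]
  noncomm_ring

end GaugeODE

section Transport
variable {m n : ℕ} [NeZero m] {M : Type*} [TopologicalSpace M]
  [ChartedSpace (EuclideanHalfSpace m) M] [IsManifold (𝓡∂ m) ∞ M]

/-! ### Transport along nontangential geodesics -/

theorem IsTransportSolution.conjTranspose_mul_self {A : HermitianConnection m M n} {γ : ℝ → M}
    {τ : ℝ} {W : ℝ → Matrix (Fin n) (Fin n) ℂ} (h : IsTransportSolution A γ τ W) :
    ∀ t ∈ Icc 0 τ, (W t)ᴴ * W t = 1 := by
  have hd : ∀ t ∈ Icc 0 τ, HasDerivWithinAt (fun t => (W t)ᴴ * W t) 0 (Icc 0 τ) t := by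
    intro t ht
    have h1 := (hasDerivWithinAt_conjTranspose_transport (A.skew _ _) (h.2 t ht)).mul (h.2 t ht)
    refine h1.congr_deriv ?_
    noncomm_ring
  intro t ht
  have h2 := (convex_Icc 0 τ).norm_image_sub_le_of_norm_hasDerivWithin_le (C := 0)
    (fun u hu => hd u hu) (fun u _ => by simp) ⟨le_rfl, ht.1.trans ht.2⟩ ht
  rw [zero_mul, norm_le_zero_iff, sub_eq_zero] at h2
  simpa [h.1] using h2

theorem IsTransportSolution.mul_conjTranspose_self {A : HermitianConnection m M n} {γ : ℝ → M}
    {τ : ℝ} {W : ℝ → Matrix (Fin n) (Fin n) ℂ} (h : IsTransportSolution A γ τ W) {t : ℝ}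
    (ht : t ∈ Icc 0 τ) :
    W t * (W t)ᴴ = 1 := mul_eq_one_comm.1 (h.conjTranspose_mul_self t ht)

theorem exists_isTransportSolution (A : HermitianConnection m M n) {γ : ℝ → M} {τ : ℝ} (hτ : 0 < τ)
    (hγ : ContMDiffOn 𝓘(ℝ, ℝ) (𝓡∂ m) ∞ γ (Icc 0 τ)) : ∃ W, IsTransportSolution A γ τ W := by
  have hc : ContinuousOn (fun t =>
    A.form (γ t) (mfderivWithin 𝓘(ℝ, ℝ) (𝓡∂ m) γ (Icc 0 τ) t (1 : ℝ)))
      (Icc 0 τ) :=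
    A.smooth.continuous.comp_continuousOn (continuousOn_velocity (uniqueDiffOn_Icc hτ) hγ)
  obtain ⟨W, h0, h⟩ := exists_linearODE hτ.le
    (B := fun t => -ContinuousLinearMap.mul ℝ (Matrix (Fin n) (Fin n) ℂ)
      (A.form (γ t) (mfderivWithin 𝓘(ℝ, ℝ) (𝓡∂ m) γ (Icc 0 τ) t (1 : ℝ))))
    ((ContinuousLinearMap.continuous _).comp_continuousOn hc).neg 1
  exact ⟨W, h0, h⟩

/-- The solution of the transport equation along `γ_{x,v}` which defines the transport `P^A`. -/
theorem exists_isTransportSolution_geo (A : HermitianConnection m M n) {g : SmoothMetric m M}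
    {p : TangentBundle (𝓡∂ m) M} (hp : IsNontangential g p) :
    ∃ W, IsTransportSolution A (geo g p) (exitTime g p) W ∧
      geodesicTransport g A p = W (exitTime g p) := by
  have h := isNontangentialGeodesic_geo hp
  have hW := exists_isTransportSolution A h.pos h.geodesic.smooth
  refine ⟨hW.choose, hW.choose_spec, ?_⟩
  rw [geodesicTransport, parallelTransport, dif_pos hW]

open Classical in
/-- A solution of the transport equation along `γ_{x,v}`. -/
noncomputable def transportSol (g : SmoothMetric m M) (A : HermitianConnection m M n)
    (p : TangentBundle (𝓡∂ m) M) : ℝ → Matrix (Fin n) (Fin n) ℂ :=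
  if h : IsNontangential g p then (exists_isTransportSolution_geo A h).choose else fun _ => 1

theorem isTransportSolution_transportSol (A : HermitianConnection m M n) {g : SmoothMetric m M}
    {p : TangentBundle (𝓡∂ m) M} (hp : IsNontangential g p) :
    IsTransportSolution A (geo g p) (exitTime g p) (transportSol g A p) := by
  rw [transportSol, dif_pos hp]
  exact (exists_isTransportSolution_geo A hp).choose_spec.1

theorem transportSol_exitTime (A : HermitianConnection m M n) {g : SmoothMetric m M}
    {p : TangentBundle (𝓡∂ m) M} (hp : IsNontangential g p) :
    transportSol g A p (exitTime g p) = geodesicTransport g A p := by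
  rw [transportSol, dif_pos hp]
  exact (exists_isTransportSolution_geo A hp).choose_spec.2.symm

theorem exitTime_pos {g : SmoothMetric m M} {p : TangentBundle (𝓡∂ m) M}
    (hp : IsNontangential g p) :
    0 < exitTime g p := (isNontangentialGeodesic_geo hp).pos

theorem conjTranspose_mul_geodesicTransport (A : HermitianConnection m M n) {g : SmoothMetric m M}
    {p : TangentBundle (𝓡∂ m) M} (hp : IsNontangential g p) :
    (geodesicTransport g A p)ᴴ * geodesicTransport g A p = 1 := by
  rw [← transportSol_exitTime A hp]
  exact (isTransportSolution_transportSol A hp).conjTranspose_mul_self _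
    ⟨(exitTime_pos hp).le, le_rfl⟩

theorem inv_geodesicTransport (A : HermitianConnection m M n) {g : SmoothMetric m M}
    {p : TangentBundle (𝓡∂ m) M} (hp : IsNontangential g p) :
    (geodesicTransport g A p)⁻¹ = (geodesicTransport g A p)ᴴ :=
  Matrix.inv_eq_left_inv (conjTranspose_mul_geodesicTransport A hp)

/-- The velocity of `γ_{x,v}` together with the solution of the transport equation. -/
noncomputable def geoFlow (g : SmoothMetric m M) (A : HermitianConnection m M n)
    (p : TangentBundle (𝓡∂ m) M) (t : ℝ) : TangentBundle (𝓡∂ m) M × Matrix (Fin n) (Fin n) ℂ :=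
  (velocity (geo g p) (Icc 0 (exitTime g p)) t, transportSol g A p t)

theorem isFlowOn_geoFlow (A : HermitianConnection m M n) {g : SmoothMetric m M}
    {p : TangentBundle (𝓡∂ m) M} (hp : IsNontangential g p) :
    IsFlowOn g A (geoFlow g A p) (Icc 0 (exitTime g p)) :=
  (isNontangentialGeodesic_geo hp).geodesic.isFlowOn (uniqueDiffOn_Icc (exitTime_pos hp))
    (isTransportSolution_transportSol A hp).2

theorem geoFlow_zero (A : HermitianConnection m M n) {g : SmoothMetric m M}
    {p : TangentBundle (𝓡∂ m) M} (hp : IsNontangential g p) : geoFlow g A p 0 = (p, 1) :=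
  Prod.ext (isNontangentialGeodesic_geo hp).initial (isTransportSolution_transportSol A hp).1

theorem IsNontangential.proj_mem_interior {g : SmoothMetric m M} {p : TangentBundle (𝓡∂ m) M}
    (hp : IsNontangential g p) : p.proj ∈ (𝓡∂ m).interior M := by
  have h := isNontangentialGeodesic_geo hp
  have h1 := h.interior 0 ⟨le_rfl, h.pos⟩
  have h2 : geo g p 0 = p.proj := congrArg TotalSpace.proj h.initial
  rwa [h2] at h1

/-- The transport along `γ_{x,v}` depends continuously on the nontangential vector `(x, v)`. -/
theorem continuousOn_geodesicTransport [T2Space M] (g : SmoothMetric m M)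
    (A : HermitianConnection m M n) :
    ContinuousOn (geodesicTransport g A) {p | IsNontangential g p} := by
  intro p hp
  have hpg := isNontangentialGeodesic_geo hp
  rw [ContinuousWithinAt, tendsto_iff_ultrafilter]
  intro 𝓤 h𝓤
  have hmem : ∀ᶠ q in (𝓤 : Filter _), IsNontangential g q := h𝓤 self_mem_nhdsWithin
  have hlim : Tendsto (fun q => q) (𝓤 : Filter _) (𝓝 p) := h𝓤.trans nhdsWithin_le_nhds
  have h := tendsto_exit (g := g) (A := A) (𝓤 := 𝓤) (zk := geoFlow g A) (Tk := exitTime g)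
    (z := geoFlow g A p) (T := exitTime g p) hpg.pos (hmem.mono fun q hq => isFlowOn_geoFlow A hq)
    (hmem.mono fun q hq => (exitTime_pos hq).le)
    (hmem.mono fun q hq => (isNontangentialGeodesic_geo hq).boundary)
    (isFlowOn_geoFlow A hp) hpg.interior hpg.boundary hpg.transversal
    (by
      rw [geoFlow_zero A hp]
      exact (hlim.prodMk_nhds tendsto_const_nhds).congr'
        (hmem.mono fun q hq => (geoFlow_zero A hq).symm))
  have h2 := (continuous_snd.tendsto _).comp h
  have h3 : (geoFlow g A p (exitTime g p)).2 = geodesicTransport g A p := transportSol_exitTime A hp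
  rw [h3] at h2
  exact h2.congr' (hmem.mono fun q hq => transportSol_exitTime A hq)

/-- Transport along `γ_p` factors through any nontangential velocity of `γ_p`. -/
theorem geodesicTransport_mul_transportSol [T2Space M] {g : SmoothMetric m M}
    (A : HermitianConnection m M n) {p q : TangentBundle (𝓡∂ m) M} (hp : IsNontangential g p)
    (hq : IsNontangential g q) {t : ℝ} (ht : t ∈ Ico 0 (exitTime g p))
    (hpq : velocity (geo g p) (Icc 0 (exitTime g p)) t = q) :
    geodesicTransport g A q * transportSol g A p t = geodesicTransport g A p := by
  have hpg := isNontangentialGeodesic_geo hp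
  have hqg := isNontangentialGeodesic_geo hq
  set b := min (exitTime g q) (exitTime g p - t) with hb
  have hb0 : 0 ≤ b := le_min hqg.pos.le (sub_nonneg.2 ht.2.le)
  have f1 : IsFlowOn g A (fun s => geoFlow g A p (s + t)) (Icc 0 b) :=
    ((isFlowOn_geoFlow A hp).comp_add t).mono fun s hs =>
      ⟨by linarith [hs.1, ht.1], by
        have := hs.2.trans (min_le_right _ _)
        linarith⟩
  have f2 := ((isFlowOn_geoFlow A hq).mul_right (transportSol g A p t)).mono
    (Icc_subset_Icc_right (min_le_left _ _ : b ≤ _))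
  have heq := f1.eqOn f2 (by
    simp only [zero_add, geoFlow_zero A hq, one_mul]
    exact Prod.ext hpq rfl) (right_mem_Icc.2 hb0)
  have hproj : geo g p (b + t) = geo g q b := congrArg (fun z => z.1.proj) heq
  have hτ : exitTime g q = exitTime g p - t := by
    rcases lt_trichotomy (exitTime g q) (exitTime g p - t) with h | h | h
    · exfalso
      have hbe : b = exitTime g q := min_eq_left h.le
      have h1 := hqg.boundary
      rw [← hbe, ← hproj, ← ModelWithCorners.compl_interior] at h1
      exact h1 (hpg.interior _ ⟨by linarith [ht.1], by linarith⟩)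
    · exact h
    · exfalso
      have hbe : b = exitTime g p - t := min_eq_right h.le
      have h1 := hpg.boundary
      rw [show exitTime g p = b + t by rw [hbe]; ring, hproj,
        ← ModelWithCorners.compl_interior] at h1
      exact h1 (hqg.interior _ ⟨hb0, by linarith⟩)
  have hbe : b = exitTime g q := min_eq_left hτ.le
  have h2 : transportSol g A p (b + t) = transportSol g A q b * transportSol g A p t :=
    congrArg (fun z => z.2) heq
  rw [← transportSol_exitTime A hq, ← hbe, ← h2, ← transportSol_exitTime A hp]
  congr 1
  rw [hbe, hτ]
  ring

variable (m M) in
/-- The connection on the bundle of rank zero, which allows to treat geodesics without transport. -/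
noncomputable def zeroConnection : HermitianConnection m M 0 where
  form := fun x => (0 : TangentSpace (𝓡∂ m) x →L[ℝ] Matrix (Fin 0) (Fin 0) ℂ)
  skew := fun x (_ : TangentSpace (𝓡∂ m) x) => Subsingleton.elim _ _
  smooth := (contMDiff_const : ContMDiff (𝓡∂ m).tangent 𝓘(ℝ, Matrix (Fin 0) (Fin 0) ℂ) ∞
    (fun _ : TangentBundle (𝓡∂ m) M => (0 : Matrix (Fin 0) (Fin 0) ℂ)))

/-- A geodesic through nontangential vectors is, for later times, part of `γ_p`. -/
theorem velocity_geo_eq [T2Space M] {g : SmoothMetric m M} {γ : ℝ → M} {ε : ℝ}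
    (hγ : IsGeodesicOn g γ (Ioo (-ε) ε))
    (hnt : ∀ t ∈ Ioo (-ε) ε, IsNontangential g (velocity γ (Ioo (-ε) ε) t)) {a t : ℝ}
    (ha : a ∈ Ioo (-ε) ε) (ht : t ∈ Ioo (-ε) ε) (hat : a ≤ t) :
    t - a ∈ Ico 0 (exitTime g (velocity γ (Ioo (-ε) ε) a)) ∧
    velocity (geo g (velocity γ (Ioo (-ε) ε) a))
        (Icc 0 (exitTime g (velocity γ (Ioo (-ε) ε) a))) (t - a) =
      (velocity γ (Ioo (-ε) ε) t : TangentBundle (𝓡∂ m) M) := by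
  set p : TangentBundle (𝓡∂ m) M := velocity γ (Ioo (-ε) ε) a with hp
  have hpn : IsNontangential g p := hnt a ha
  have hpg := isNontangentialGeodesic_geo hpn
  have hfl : IsFlowOn g (zeroConnection m M) (fun t => (velocity γ (Ioo (-ε) ε) t, 1))
    (Ioo (-ε) ε) :=
    hγ.isFlowOn isOpen_Ioo.uniqueDiffOn (W := fun _ => 1) fun t _ =>
      (hasDerivWithinAt_const t _ _).congr_deriv (Subsingleton.elim _ _)
  set b := min (exitTime g p) (t - a) with hb
  have hb0 : 0 ≤ b := le_min hpg.pos.le (sub_nonneg.2 hat)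
  have f1 : IsFlowOn g (zeroConnection m M) (fun s => (velocity γ (Ioo (-ε) ε) (s + a), 1))
    (Icc 0 b) :=
    (hfl.comp_add a).mono fun s hs => ⟨by linarith [hs.1, ha.1], by
      have := hs.2.trans (min_le_right _ _)
      linarith [ht.2]⟩
  have f2 := (isFlowOn_geoFlow (zeroConnection m M) hpn).mono
    (Icc_subset_Icc_right (min_le_left _ _ : b ≤ _))
  have heq := f1.eqOn f2 (by
    simp only [zero_add, geoFlow_zero _ hpn]
    rfl) (right_mem_Icc.2 hb0)
  have hvel : velocity γ (Ioo (-ε) ε) (b + a) = velocity (geo g p) (Icc 0 (exitTime g p)) b :=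
    congrArg Prod.fst heq
  have hlt : t - a < exitTime g p := by
    by_contra hle
    have hbe : b = exitTime g p := min_eq_left (not_lt.1 hle)
    have h1 : geo g p b ∈ (𝓡∂ m).boundary M := by rw [hbe]; exact hpg.boundary
    have h2 : γ (b + a) = geo g p b := congrArg TotalSpace.proj hvel
    have h3 := (hnt (b + a) ⟨by linarith [ha.1], by
      have := min_le_right (exitTime g p) (t - a)
      linarith [ht.2]⟩).proj_mem_interior
    change γ (b + a) ∈ _ at h3
    rw [h2] at h3
    rw [← ModelWithCorners.compl_interior] at h1
    exact h1 h3
  have hbe : b = t - a := min_eq_right hlt.le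
  rw [hbe, sub_add_cancel] at hvel
  exact ⟨⟨sub_nonneg.2 hat, hlt⟩, hvel.symm⟩

end Transport

/-! ### The parallel equation for the tensor square of a gauge -/

section Parallel
variable {m n : ℕ} [NeZero m] {M : Type*} [TopologicalSpace M]
  [ChartedSpace (EuclideanHalfSpace m) M] [IsManifold (𝓡∂ m) ∞ M]

/-- The connection form in the chart around `x₀`, as a linear map. -/
noncomputable def formL (A : HermitianConnection m M n) (x₀ : M) (y : Model m) :
    Model m →L[ℝ] Matrix (Fin n) (Fin n) ℂ :=
  (A.form ((extChartAt (𝓡∂ m) x₀).symm y)).comp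
    (mfderivWithin 𝓘(ℝ, Model m) (𝓡∂ m) (extChartAt (𝓡∂ m) x₀).symm (range (𝓡∂ m)) y)

theorem contDiffOn_formL (A : HermitianConnection m M n) (x₀ : M) :
    ContDiffOn ℝ ∞ (formL A x₀) (extChartAt (𝓡∂ m) x₀).target := by
  rw [contDiffOn_clm_apply]
  intro v
  exact (contDiffOn_formInChart A x₀).comp (contDiff_id.prodMk contDiff_const).contDiffOn
    fun y hy => ⟨hy, trivial⟩

/-- `dtsq` as a continuous linear map. -/
noncomputable def dtsqL : Matrix (Fin n) (Fin n) ℂ →L[ℝ]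
    Matrix (Fin n × Fin n) (Fin n × Fin n) ℂ :=
  kronL.flip 1 + kronL 1

/-- The linear map `v ↦ q (A₂(v) ⊗ 1 + 1 ⊗ A₂(v)) - (A₁(v) ⊗ 1 + 1 ⊗ A₁(v)) q`, in the chart
around `x₀` at the coordinate point `y`: the value that the equation of a parallel section
prescribes for the derivative at `y` of a section with value `q`. -/
noncomputable def parallelL (A₁ A₂ : HermitianConnection m M n) (x₀ : M) (y : Model m)
    (q : Matrix (Fin n × Fin n) (Fin n × Fin n) ℂ) :
    Model m →L[ℝ] Matrix (Fin n × Fin n) (Fin n × Fin n) ℂ :=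
  (ContinuousLinearMap.mul ℝ _ q).comp (dtsqL.comp (formL A₂ x₀ y)) -
    ((ContinuousLinearMap.mul ℝ _).flip q).comp (dtsqL.comp (formL A₁ x₀ y))

theorem parallelL_apply (A₁ A₂ : HermitianConnection m M n) (x₀ : M) (y : Model m)
    (q : Matrix (Fin n × Fin n) (Fin n × Fin n) ℂ) (v : Model m) :
    parallelL A₁ A₂ x₀ y q v =
      q * dtsq (formInChart A₂ x₀ (y, v)) - dtsq (formInChart A₁ x₀ (y, v)) * q := rfl

theorem parallelL_coord (A₁ A₂ : HermitianConnection m M n) {x₀ : M}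
    (q : Matrix (Fin n × Fin n) (Fin n × Fin n) ℂ) {p : TangentBundle (𝓡∂ m) M}
    (hp : p.proj ∈ (extChartAt (𝓡∂ m) x₀).source) :
    parallelL A₁ A₂ x₀ (coord x₀ p).1 q (coord x₀ p).2 =
      q * dtsq (A₂.form p.proj p.snd) - dtsq (A₁.form p.proj p.snd) * q := by
  rw [parallelL_apply, formInChart_coord A₂ hp, formInChart_coord A₁ hp]

theorem continuousWithinAt_mul_comp_sub {E V R : Type*} [NormedAddCommGroup E] [NormedSpace ℝ E]
    [NormedAddCommGroup V] [NormedSpace ℝ V] [NormedRing R] [NormedAlgebra ℝ R] (D : V →L[ℝ] R)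
    {f : E → R} {B₁ B₂ : E → E →L[ℝ] V} {s : Set E} {y : E} (hf : ContinuousWithinAt f s y)
    (h₁ : ContinuousWithinAt B₁ s y) (h₂ : ContinuousWithinAt B₂ s y) :
    ContinuousWithinAt (fun z => (ContinuousLinearMap.mul ℝ R (f z)).comp (D.comp (B₂ z)) -
      ((ContinuousLinearMap.mul ℝ R).flip (f z)).comp (D.comp (B₁ z))) s y :=
  (((ContinuousLinearMap.mul ℝ R).continuous.continuousAt.comp_continuousWithinAt hf).clm_comp
      (continuousWithinAt_const.clm_comp h₂)).sub
    (((ContinuousLinearMap.mul ℝ R).flip.continuous.continuousAt.comp_continuousWithinAt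
      hf).clm_comp
      (continuousWithinAt_const.clm_comp h₁))

theorem contDiffOn_mul_comp_sub {E V R : Type*} [NormedAddCommGroup E] [NormedSpace ℝ E]
    [NormedAddCommGroup V] [NormedSpace ℝ V] [NormedRing R] [NormedAlgebra ℝ R] (D : V →L[ℝ] R)
    {f : E → R} {B₁ B₂ : E → E →L[ℝ] V} {s : Set E} {k : WithTop ℕ∞} (hf : ContDiffOn ℝ k f s)
    (h₁ : ContDiffOn ℝ k B₁ s) (h₂ : ContDiffOn ℝ k B₂ s) :
    ContDiffOn ℝ k (fun z => (ContinuousLinearMap.mul ℝ R (f z)).comp (D.comp (B₂ z)) -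
      ((ContinuousLinearMap.mul ℝ R).flip (f z)).comp (D.comp (B₁ z))) s :=
  (((ContinuousLinearMap.mul ℝ R).contDiff.comp_contDiffOn hf).clm_comp
      (contDiffOn_const.clm_comp h₂)).sub
    (((ContinuousLinearMap.mul ℝ R).flip.contDiff.comp_contDiffOn hf).clm_comp
      (contDiffOn_const.clm_comp h₁))

theorem continuousWithinAt_parallelL (A₁ A₂ : HermitianConnection m M n) {x₀ : M} {y : Model m}
    {s : Set (Model m)} (hs : s ⊆ (extChartAt (𝓡∂ m) x₀).target)
    (hy : y ∈ (extChartAt (𝓡∂ m) x₀).target)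
    {f : Model m → Matrix (Fin n × Fin n) (Fin n × Fin n) ℂ} (hf : ContinuousWithinAt f s y) :
    ContinuousWithinAt (fun z => parallelL A₁ A₂ x₀ z (f z)) s y :=
  continuousWithinAt_mul_comp_sub dtsqL hf
    (((contDiffOn_formL A₁ x₀).continuousOn y hy).mono hs)
    (((contDiffOn_formL A₂ x₀).continuousOn y hy).mono hs)

theorem contDiffOn_parallelL (A₁ A₂ : HermitianConnection m M n) {x₀ : M} {k : ℕ}
    {f : Model m → Matrix (Fin n × Fin n) (Fin n × Fin n) ℂ}
    (hf : ContDiffOn ℝ k f (extChartAt (𝓡∂ m) x₀).target) :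
    ContDiffOn ℝ k (fun z => parallelL A₁ A₂ x₀ z (f z)) (extChartAt (𝓡∂ m) x₀).target :=
  contDiffOn_mul_comp_sub dtsqL hf
    ((contDiffOn_formL A₁ x₀).of_le (by exact_mod_cast le_top))
    ((contDiffOn_formL A₂ x₀).of_le (by exact_mod_cast le_top))

/-- For bounded sections the derivatives prescribed by the parallel equation are locally
bounded. -/
theorem eventually_norm_parallelL_le (A₁ A₂ : HermitianConnection m M n) {x₀ : M} {y : Model m}
    (hy : y ∈ (extChartAt (𝓡∂ m) x₀).target) :
    ∃ C : ℝ, 0 ≤ C ∧ ∀ᶠ z in 𝓝[(extChartAt (𝓡∂ m) x₀).target] y,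
      ∀ q : Matrix (Fin n × Fin n) (Fin n × Fin n) ℂ, ‖q‖ ≤ 1 → ‖parallelL A₁ A₂ x₀ z q‖ ≤ C := by
  set B : HermitianConnection m M n → Model m → Model m →L[ℝ] _ :=
    fun A z => dtsqL.comp (formL A x₀ z) with hBdef
  have hB : ∀ A : HermitianConnection m M n, ∀ᶠ z in 𝓝[(extChartAt (𝓡∂ m) x₀).target] y,
      ‖B A z‖ < ‖B A y‖ + 1 := fun A =>
    ((continuousWithinAt_const.clm_comp
      ((contDiffOn_formL A x₀).continuousOn y hy)).norm).eventually
      (gt_mem_nhds (lt_add_one _))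
  refine ⟨(‖B A₂ y‖ + 1) + (‖B A₁ y‖ + 1), by positivity, ?_⟩
  filter_upwards [hB A₁, hB A₂] with z h1 h2 q hq
  refine (norm_sub_le _ _).trans (add_le_add ?_ ?_)
  · refine (ContinuousLinearMap.opNorm_comp_le _ _).trans ?_
    have h3 := (ContinuousLinearMap.opNorm_mul_apply_le ℝ _ q).trans hq
    exact (mul_le_mul h3 h2.le (norm_nonneg _) zero_le_one).trans (one_mul _).le
  · refine (ContinuousLinearMap.opNorm_comp_le _ _).trans ?_
    have h3 : ‖(ContinuousLinearMap.mul ℝ _).flip q‖ ≤ 1 :=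
      ContinuousLinearMap.opNorm_le_bound _ zero_le_one fun w => by
        change ‖w * q‖ ≤ 1 * ‖w‖
        calc ‖w * q‖ ≤ ‖w‖ * ‖q‖ := norm_mul_le _ _
          _ ≤ ‖w‖ * 1 := by gcongr
          _ = 1 * ‖w‖ := by ring
    exact (mul_le_mul h3 h1.le (norm_nonneg _) zero_le_one).trans (one_mul _).le

theorem norm_tsq_le_one (u : U n) : ‖tsq (u : Matrix (Fin n) (Fin n) ℂ)‖ ≤ 1 := by
  have h1 : (tsq (u : Matrix (Fin n) (Fin n) ℂ))ᴴ * tsq (u : Matrix (Fin n) (Fin n) ℂ) = 1 := by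
    rw [tsq, Matrix.conjTranspose_kronecker, ← Matrix.mul_kronecker_mul,
      show (u : Matrix (Fin n) (Fin n) ℂ)ᴴ * u = 1 from Matrix.UnitaryGroup.star_mul_self u,
      Matrix.one_kronecker_one]
  have h2 := Matrix.l2_opNorm_conjTranspose_mul_self (tsq (u : Matrix (Fin n) (Fin n) ℂ))
  rw [h1] at h2
  rcases isEmpty_or_nonempty (Fin n) with h | h
  · rw [Subsingleton.elim (tsq (u : Matrix (Fin n) (Fin n) ℂ)) 0, norm_zero]
    exact zero_le_one
  · rw [CStarRing.norm_one] at h2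
    nlinarith [norm_nonneg (tsq (u : Matrix (Fin n) (Fin n) ℂ))]

end Parallel

/-! ### The relative gauge of two connections with the same scattering data -/

section RelativeGauge
variable {m n : ℕ} [NeZero m] {M : Type*} [TopologicalSpace M]
  [ChartedSpace (EuclideanHalfSpace m) M] [IsManifold (𝓡∂ m) ∞ M]

/-- `φ` equals `(P^{A₁})⁻¹ P^{A₂}` up to sign, for the transport from any point along any of the
geodesics of `G`, and `φ = 1` at the boundary. -/
structure IsRelativeGauge {g : SmoothMetric m M} (A₁ A₂ : HermitianConnection m M n)
    (G : GeodesicGraph g) (φ : M → U n) : Prop where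
  transport : ∀ p ∈ G.total, tsq (φ p.proj : Matrix (Fin n) (Fin n) ℂ) =
    tsq ((geodesicTransport g A₁ p)ᴴ * geodesicTransport g A₂ p)
  boundary : ∀ x ∈ (𝓡∂ m).boundary M, φ x = 1

theorem GeodesicGraph.isNontangential {g : SmoothMetric m M} {G : GeodesicGraph g}
    {p : TangentBundle (𝓡∂ m) M} (hp : p ∈ G.total) : IsNontangential g p :=
  G.nontangential p.proj p.snd hp

theorem geodesicTransport_mem_unitaryGroup (A : HermitianConnection m M n) {g : SmoothMetric m M}
    {p : TangentBundle (𝓡∂ m) M} (hp : IsNontangential g p) :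
    geodesicTransport g A p ∈ Matrix.unitaryGroup (Fin n) ℂ :=
  Matrix.mem_unitaryGroup_iff'.2 (conjTranspose_mul_geodesicTransport A hp)

theorem geodesicTransport_mul_conjTranspose (A : HermitianConnection m M n) {g : SmoothMetric m M}
    {p : TangentBundle (𝓡∂ m) M} (hp : IsNontangential g p) :
    geodesicTransport g A p * (geodesicTransport g A p)ᴴ = 1 :=
  mul_eq_one_comm.1 (conjTranspose_mul_geodesicTransport A hp)

/-- The scattering data of two connections agree up to sign on an edge `(v, w)` if and only if
the matrices `(P^{A₁})⁻¹ P^{A₂}` for `v` and `w` agree up to sign. -/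
theorem scatteringData_eq_or_eq_neg_iff {g : SmoothMetric m M} (A₁ A₂ : HermitianConnection m M n)
    {x : M} {v w : TangentSpace (𝓡∂ m) x} (hv : IsNontangential g ⟨x, v⟩)
    (hw : IsNontangential g ⟨x, w⟩) :
    (scatteringData g A₁ x v w = scatteringData g A₂ x v w ∨
        scatteringData g A₁ x v w = -scatteringData g A₂ x v w) ↔
      tsq ((geodesicTransport g A₁ ⟨x, v⟩)ᴴ * geodesicTransport g A₂ ⟨x, v⟩) =
        tsq ((geodesicTransport g A₁ ⟨x, w⟩)ᴴ * geodesicTransport g A₂ ⟨x, w⟩) := by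
  rw [← tsq_eq_iff]
  unfold scatteringData
  rw [inv_geodesicTransport A₁ hv, inv_geodesicTransport A₂ hv]
  have e1 := conjTranspose_mul_geodesicTransport A₁ hw
  have e1' := geodesicTransport_mul_conjTranspose A₁ hw
  have e2 := conjTranspose_mul_geodesicTransport A₂ hv
  have e2' := geodesicTransport_mul_conjTranspose A₂ hv
  constructor
  · intro h
    have h' := congrArg (fun X => tsq (geodesicTransport g A₁ ⟨x, w⟩)ᴴ * X *
      tsq (geodesicTransport g A₂ ⟨x, v⟩)) h
    simp only [← tsq_mul] at h'
    rw [show (geodesicTransport g A₁ ⟨x, w⟩)ᴴ * (geodesicTransport g A₁ ⟨x, w⟩ *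
        (geodesicTransport g A₁ ⟨x, v⟩)ᴴ) * geodesicTransport g A₂ ⟨x, v⟩ =
        ((geodesicTransport g A₁ ⟨x, w⟩)ᴴ * geodesicTransport g A₁ ⟨x, w⟩) *
        ((geodesicTransport g A₁ ⟨x, v⟩)ᴴ * geodesicTransport g A₂ ⟨x, v⟩) by noncomm_ring,
      show (geodesicTransport g A₁ ⟨x, w⟩)ᴴ * (geodesicTransport g A₂ ⟨x, w⟩ *
        (geodesicTransport g A₂ ⟨x, v⟩)ᴴ) * geodesicTransport g A₂ ⟨x, v⟩ =
        (geodesicTransport g A₁ ⟨x, w⟩)ᴴ * geodesicTransport g A₂ ⟨x, w⟩ *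
        ((geodesicTransport g A₂ ⟨x, v⟩)ᴴ * geodesicTransport g A₂ ⟨x, v⟩) by noncomm_ring,
      e1, e2, one_mul, mul_one] at h'
    exact h'.symm
  · intro h
    have h' := congrArg (fun X => tsq (geodesicTransport g A₁ ⟨x, w⟩) * X *
      tsq (geodesicTransport g A₂ ⟨x, v⟩)ᴴ) h
    simp only [← tsq_mul] at h'
    rw [show geodesicTransport g A₁ ⟨x, w⟩ * ((geodesicTransport g A₁ ⟨x, v⟩)ᴴ *
        geodesicTransport g A₂ ⟨x, v⟩) * (geodesicTransport g A₂ ⟨x, v⟩)ᴴ =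
        geodesicTransport g A₁ ⟨x, w⟩ * (geodesicTransport g A₁ ⟨x, v⟩)ᴴ *
        (geodesicTransport g A₂ ⟨x, v⟩ * (geodesicTransport g A₂ ⟨x, v⟩)ᴴ) by noncomm_ring,
      show geodesicTransport g A₁ ⟨x, w⟩ * ((geodesicTransport g A₁ ⟨x, w⟩)ᴴ *
        geodesicTransport g A₂ ⟨x, w⟩) * (geodesicTransport g A₂ ⟨x, v⟩)ᴴ =
        (geodesicTransport g A₁ ⟨x, w⟩ * (geodesicTransport g A₁ ⟨x, w⟩)ᴴ) *
        (geodesicTransport g A₂ ⟨x, w⟩ * (geodesicTransport g A₂ ⟨x, v⟩)ᴴ) by noncomm_ring,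
      e1', e2', one_mul, mul_one] at h'
    exact h'.symm

open Classical in
theorem exists_isRelativeGauge {g : SmoothMetric m M} (A₁ A₂ : HermitianConnection m M n)
    {G : GeodesicGraph g} (hG : G.IsComplete)
    (h : ∀ (x : M), ∀ e ∈ G.E x,
      scatteringData g A₁ x e.1 e.2 = scatteringData g A₂ x e.1 e.2 ∨
      scatteringData g A₁ x e.1 e.2 = -scatteringData g A₂ x e.1 e.2) :
    ∃ φ : M → U n, IsRelativeGauge A₁ A₂ G φ := by
  have hind : ∀ x ∈ (𝓡∂ m).interior M, ∀ v ∈ G.V x, ∀ w ∈ G.V x,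
      tsq ((geodesicTransport g A₁ ⟨x, v⟩)ᴴ * geodesicTransport g A₂ ⟨x, v⟩) =
        tsq ((geodesicTransport g A₁ ⟨x, w⟩)ᴴ * geodesicTransport g A₂ ⟨x, w⟩) := by
    intro x hx v hv w hw
    induction hG.connected x hx v hv w hw with
    | refl => rfl
    | tail _ hbc ih =>
      have he := G.edges x _ hbc
      exact (ih he.1).trans ((scatteringData_eq_or_eq_neg_iff A₁ A₂ (G.nontangential x _ he.1)
        (G.nontangential x _ he.2.1)).1 (h x _ hbc))
  have hmem : ∀ x, ∀ v ∈ G.V x,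
      (geodesicTransport g A₁ ⟨x, v⟩)ᴴ * geodesicTransport g A₂ ⟨x, v⟩ ∈
        Matrix.unitaryGroup (Fin n) ℂ := fun x v hv =>
    mul_mem (Unitary.star_mem (geodesicTransport_mem_unitaryGroup A₁ (G.nontangential x v hv)))
      (geodesicTransport_mem_unitaryGroup A₂ (G.nontangential x v hv))
  refine ⟨fun x => if hx : (G.V x).Nonempty then
    ⟨_, hmem x hx.some hx.some_mem⟩ else 1, fun p hp => ?_, fun x hx => ?_⟩
  · have hne : (G.V p.proj).Nonempty := ⟨p.snd, hp⟩
    simp only [dif_pos hne]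
    exact hind p.proj (GeodesicGraph.isNontangential hp).proj_mem_interior _ hne.some_mem p.snd hp
  · rw [dif_neg]
    rintro ⟨v, hv⟩
    rw [← ModelWithCorners.compl_interior] at hx
    exact hx (G.nontangential x v hv).proj_mem_interior

variable {g : SmoothMetric m M} {A₁ A₂ : HermitianConnection m M n} {G : GeodesicGraph g}
  {φ : M → U n}

/-- Along geodesics of `G` the parallel equation holds, by factorisation of the transports. -/
theorem IsRelativeGauge.hasDerivAt [T2Space M] (hφ : IsRelativeGauge A₁ A₂ G φ) {γ : ℝ → M}
    {ε : ℝ} (hε : 0 < ε) (hγ : IsGeodesicOn g γ (Ioo (-ε) ε))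
    (htot : ∀ t ∈ Ioo (-ε) ε, velocity γ (Ioo (-ε) ε) t ∈ G.total)
    {p₀ : TangentBundle (𝓡∂ m) M} (h0 : velocity γ (Ioo (-ε) ε) 0 = p₀) :
    HasDerivAt (fun t => tsq (φ (γ t) : Matrix (Fin n) (Fin n) ℂ))
      (tsq (φ p₀.proj : Matrix (Fin n) (Fin n) ℂ) * dtsq (A₂.form p₀.proj p₀.snd) -
        dtsq (A₁.form p₀.proj p₀.snd) * tsq (φ p₀.proj : Matrix (Fin n) (Fin n) ℂ)) 0 := by
  have hnt := fun t ht => GeodesicGraph.isNontangential (htot t ht)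
  set a : ℝ := -(ε / 2) with ha
  have haε : a ∈ Ioo (-ε) ε := ⟨by linarith, by linarith⟩
  have h0ε : (0 : ℝ) ∈ Ioo (-ε) ε := ⟨by linarith, hε⟩
  set p : TangentBundle (𝓡∂ m) M := velocity γ (Ioo (-ε) ε) a with hp
  have hpn : IsNontangential g p := hnt a haε
  have hvel := fun t ht hat => velocity_geo_eq hγ hnt (a := a) (t := t) haε ht hat
  set C := tsq ((geodesicTransport g A₁ p)ᴴ * geodesicTransport g A₂ p) with hC
  -- the transport from time `a` on factors at all later times
  have key : ∀ t ∈ Ico a ε, tsq (φ (γ t) : Matrix (Fin n) (Fin n) ℂ) =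
      tsq (transportSol g A₁ p (t - a)) * C * tsq (transportSol g A₂ p (t - a))ᴴ := by
    intro t ht
    have htε : t ∈ Ioo (-ε) ε := ⟨haε.1.trans_le ht.1, ht.2⟩
    obtain ⟨hm, hv⟩ := hvel t htε ht.1
    have hq := hnt t htε
    have hpt : ∀ A : HermitianConnection m M n,
        geodesicTransport g A (velocity γ (Ioo (-ε) ε) t) =
          geodesicTransport g A p * (transportSol g A p (t - a))ᴴ := by
      intro A
      rw [← geodesicTransport_mul_transportSol A hpn hq hm hv, Matrix.mul_assoc,
        (isTransportSolution_transportSol A hpn).mul_conjTranspose_self ⟨hm.1, hm.2.le⟩, mul_one]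
    have h1 := hφ.transport _ (htot t htε)
    rw [hpt, hpt, Matrix.conjTranspose_mul, Matrix.conjTranspose_conjTranspose] at h1
    rw [hC, ← tsq_mul, ← tsq_mul]
    refine h1.trans (congrArg tsq ?_)
    noncomm_ring
  obtain ⟨hm0, hv0⟩ := hvel 0 h0ε (by linarith)
  have hm0' : 0 - a ∈ Ioo 0 (exitTime g p) := ⟨by linarith, hm0.2⟩
  have hW : ∀ A : HermitianConnection m M n, HasDerivWithinAt (transportSol g A p)
      (-(A.form p₀.proj p₀.snd * transportSol g A p (0 - a))) (Icc 0 (exitTime g p)) (0 - a) := by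
    intro A
    have h1 := (isTransportSolution_transportSol A hpn).2 _ (Ioo_subset_Icc_self hm0')
    have h2 : A.form (geo g p (0 - a)) (mfderivWithin 𝓘(ℝ, ℝ) (𝓡∂ m) (geo g p)
        (Icc 0 (exitTime g p)) (0 - a) (1 : ℝ)) = A.form p₀.proj p₀.snd :=
      congrArg (fun z : TangentBundle (𝓡∂ m) M => A.form z.proj z.snd) (hv0.trans h0)
    rwa [h2] at h1
  have hd := hasDerivWithinAt_conj_transport (A₂.skew _ _) (hW A₁) (hW A₂) C
  have hd1 := hd.hasDerivAt (Icc_mem_nhds hm0'.1 hm0'.2)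
  have hd2 := hd1.comp_sub_const 0 a
  have hγ0 : γ 0 = p₀.proj := congrArg TotalSpace.proj h0
  have hk0 := key 0 ⟨by linarith, hε⟩
  rw [hγ0] at hk0
  rw [← hk0] at hd2
  refine hd2.congr_of_eventuallyEq ?_
  filter_upwards [Ico_mem_nhds (show a < 0 by linarith) hε] with t ht
  exact key t ht

end RelativeGauge

/-! ### The relative gauge in the interior -/

theorem continuousOn_image_of_isCompact {X Y Z : Type*} [TopologicalSpace X] [TopologicalSpace Y]
    [T2Space Y] [TopologicalSpace Z] {K : Set X} (hK : IsCompact K) {h : X → Y}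
    (hh : ContinuousOn h K) {f : Y → Z} (hf : ContinuousOn (f ∘ h) K) :
    ContinuousOn f (h '' K) := by
  rw [continuousOn_iff_isClosed]
  intro t ht
  obtain ⟨u, hu, hut⟩ := continuousOn_iff_isClosed.1 hf t ht
  refine ⟨h '' (K ∩ u), ((hK.inter_right hu).image_of_continuousOn
    (hh.mono inter_subset_left)).isClosed, ?_⟩
  ext y
  constructor
  · rintro ⟨hy, x, hx, rfl⟩
    have : x ∈ u ∩ K := by
      rw [← hut]
      exact ⟨hy, hx⟩
    exact ⟨⟨x, this.symm, rfl⟩, x, hx, rfl⟩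
  · rintro ⟨⟨x, ⟨hxK, hxu⟩, rfl⟩, -⟩
    have : x ∈ f ∘ h ⁻¹' t ∩ K := by
      rw [hut]
      exact ⟨hxu, hxK⟩
    exact ⟨this.1, x, hxK, rfl⟩

section Interior
variable {m n : ℕ} [NeZero m] {M : Type*} [TopologicalSpace M]
  [ChartedSpace (EuclideanHalfSpace m) M]

/-- The image of the interior of `M` under the chart around `x₀`. -/
def interiorTarget (x₀ : M) : Set (Model m) := (extChartAt (𝓡∂ m) x₀).target ∩ {y | 0 < y 0}

theorem isOpen_interiorTarget (x₀ : M) : IsOpen (interiorTarget x₀ : Set (Model m)) := by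
  have h : (interiorTarget x₀ : Set (Model m)) =
      (𝓡∂ m).symm ⁻¹' (chartAt (EuclideanHalfSpace m) x₀).target ∩ {y | 0 < y 0} := by
    ext y
    simp only [interiorTarget, extChartAt_target, mem_inter_iff, mem_preimage]
    refine ⟨fun h => ⟨h.1.1, h.2⟩, fun h => ⟨⟨h.1, ?_⟩, h.2⟩⟩
    rw [range_modelWithCornersEuclideanHalfSpace]
    exact (show 0 < y 0 from h.2).le
  rw [h]
  exact ((chartAt (EuclideanHalfSpace m) x₀).open_target.preimage (𝓡∂ m).continuous_symm).inter
    (isOpen_lt continuous_const (by fun_prop))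

theorem interior_extChartAt_target (x₀ : M) :
    interior (extChartAt (𝓡∂ m) x₀).target = interiorTarget x₀ := by
  refine Subset.antisymm (fun y hy => ⟨interior_subset hy, ?_⟩)
    (interior_maximal inter_subset_left (isOpen_interiorTarget x₀))
  have h := interior_mono (extChartAt_target_subset_range (I := 𝓡∂ m) x₀) hy
  rwa [interior_range_modelWithCornersEuclideanHalfSpace] at h

variable [IsManifold (𝓡∂ m) ∞ M]

theorem extChartAt_mem_interiorTarget_iff {x₀ x : M} (hx : x ∈ (extChartAt (𝓡∂ m) x₀).source) :
    extChartAt (𝓡∂ m) x₀ x ∈ interiorTarget x₀ ↔ x ∈ (𝓡∂ m).interior M := by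
  rw [extChartAt_source] at hx
  rw [← interior_extChartAt_target]
  exact (ModelWithCorners.isInteriorPoint_iff_of_mem_atlas (n := ∞) (by simp)
    (chart_mem_atlas (EuclideanHalfSpace m) x₀) hx).symm

theorem extChartAt_symm_mem_interior {x₀ : M} {y : Model m} (hy : y ∈ interiorTarget x₀) :
    (extChartAt (𝓡∂ m) x₀).symm y ∈ (𝓡∂ m).interior M := by
  rw [← extChartAt_mem_interiorTarget_iff ((extChartAt (𝓡∂ m) x₀).map_target hy.1),
    (extChartAt (𝓡∂ m) x₀).right_inv hy.1]
  exact hy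

variable {g : SmoothMetric m M} {A₁ A₂ : HermitianConnection m M n} {G : GeodesicGraph g}
  {φ : M → U n}

theorem surjective_coord_snd {x₀ x : M} (hx : x ∈ (extChartAt (𝓡∂ m) x₀).source) :
    Function.Surjective (mfderiv (𝓡∂ m) 𝓘(ℝ, Model m) (extChartAt (𝓡∂ m) x₀) x) := by
  intro v
  have h := coord_ofCoord (x₀ := x₀) (z := (extChartAt (𝓡∂ m) x₀ x, v))
    ((extChartAt (𝓡∂ m) x₀).map_source hx)
  have h1 : (ofCoord x₀ (extChartAt (𝓡∂ m) x₀ x, v)).proj = x :=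
    (extChartAt (𝓡∂ m) x₀).left_inv hx
  generalize ofCoord x₀ (extChartAt (𝓡∂ m) x₀ x, v) = p at h h1
  obtain ⟨x', w⟩ := p
  subst h1
  exact ⟨w, congrArg Prod.snd h⟩

/-- In the directions given by a complete geodesic graph structure, the relative gauge satisfies
the parallel equation. -/
theorem IsRelativeGauge.hasSpanningDerivAt [T2Space M] (hφ : IsRelativeGauge A₁ A₂ G φ)
    (hG : G.IsComplete) {x₀ : M} {y : Model m} (hy : y ∈ interiorTarget x₀) :
    HasSpanningDerivAt
      (fun z => tsq (φ ((extChartAt (𝓡∂ m) x₀).symm z) : Matrix (Fin n) (Fin n) ℂ))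
      (parallelL A₁ A₂ x₀ y (tsq (φ ((extChartAt (𝓡∂ m) x₀).symm y) : Matrix (Fin n) (Fin n) ℂ)))
      y := by
  set x := (extChartAt (𝓡∂ m) x₀).symm y with hxdef
  have hxs : x ∈ (extChartAt (𝓡∂ m) x₀).source := (extChartAt (𝓡∂ m) x₀).map_target hy.1
  have hex : extChartAt (𝓡∂ m) x₀ x = y := (extChartAt (𝓡∂ m) x₀).right_inv hy.1
  obtain ⟨v, -, hspan, hflow⟩ := hG.spanning x (extChartAt_symm_mem_interior hy)
  set D := mfderiv (𝓡∂ m) 𝓘(ℝ, Model m) (extChartAt (𝓡∂ m) x₀) x with hD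
  refine ⟨D '' range v, ?_, ?_⟩
  · have h1 : Submodule.map D.toLinearMap (Submodule.span ℝ (range v)) =
        Submodule.span ℝ (D '' range v) := Submodule.map_span D.toLinearMap (range v)
    refine h1.symm.trans ?_
    rw [hspan, Submodule.map_top]
    exact LinearMap.range_eq_top.2 (surjective_coord_snd hxs)
  · rintro _ ⟨_, ⟨i, rfl⟩, rfl⟩
    obtain ⟨ε, hε, γ, hγ, h0, htot⟩ := hflow i
    have h0ε : (0 : ℝ) ∈ Ioo (-ε) ε := ⟨by linarith, hε⟩
    have hγ0 : γ 0 = x := congrArg TotalSpace.proj h0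
    have hγs : γ 0 ∈ (extChartAt (𝓡∂ m) x₀).source := by rwa [hγ0]
    refine ⟨fun t => extChartAt (𝓡∂ m) x₀ (γ t), by simp only [hγ0, hex], ?_, ?_⟩
    · have hc := coord_velocity isOpen_Ioo.uniqueDiffOn hγ.smooth h0ε hγs
      rw [h0] at hc
      have hc2 : D (v i) = derivWithin (fun r => extChartAt (𝓡∂ m) x₀ (γ r)) (Ioo (-ε) ε) 0 :=
        congrArg Prod.snd hc
      rw [hc2]
      exact (((contDiffWithinAt_chart_comp hγ.smooth h0ε hγs).differentiableWithinAt
        (by simp)).hasDerivWithinAt).hasDerivAt (Ioo_mem_nhds h0ε.1 h0ε.2)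
    · have h1 := hφ.hasDerivAt hε hγ htot h0
      have h2 := parallelL_coord A₁ A₂ (x₀ := x₀) (tsq (φ x : Matrix (Fin n) (Fin n) ℂ))
        (p := ⟨x, v i⟩) hxs
      have h3 : (coord x₀ (⟨x, v i⟩ : TangentBundle (𝓡∂ m) M)).1 = y := hex
      rw [h3] at h2
      have hcont : ContinuousAt γ 0 :=
        (hγ.smooth.continuousOn 0 h0ε).continuousAt (Ioo_mem_nhds h0ε.1 h0ε.2)
      refine (h1.congr_deriv h2.symm).congr_of_eventuallyEq ?_
      filter_upwards [hcont ((isOpen_extChartAt_source x₀).mem_nhds hγs)] with t ht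
      rw [(extChartAt (𝓡∂ m) x₀).left_inv ht]

/-- The part of an embedded submanifold of `TM` over a chart domain is `σ`-compact. -/
theorem IsEmbeddedSubmanifold.exists_isCompact {S : Set (TangentBundle (𝓡∂ m) M)}
    (hS : IsEmbeddedSubmanifold S) (x₀ : M) :
    ∃ C : ℕ → Set (TangentBundle (𝓡∂ m) M), (∀ j, IsCompact (C j)) ∧
      ⋃ j, C j = S ∩ TotalSpace.proj ⁻¹' (extChartAt (𝓡∂ m) x₀).source := by
  obtain ⟨k, hcs, -, -⟩ := hS
  have : LocallyCompactSpace S := ChartedSpace.locallyCompactSpace (EuclideanSpace ℝ (Fin k)) S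
  set O : Set (TangentBundle (𝓡∂ m) M) :=
    TotalSpace.proj ⁻¹' (extChartAt (𝓡∂ m) x₀).source with hO
  have hOo : IsOpen O := (isOpen_extChartAt_source x₀).preimage
    (FiberBundle.continuous_proj (Model m) (TangentSpace (𝓡∂ m)))
  set S' : Set S := Subtype.val ⁻¹' O with hS'
  have hS'o : IsOpen S' := hOo.preimage continuous_subtype_val
  have : LocallyCompactSpace S' := hS'o.locallyCompactSpace
  -- the coordinates embed the part of `TM` over the chart domain in a second countable space
  have hemb : IsEmbedding (fun p : O => (⟨coord x₀ p.1, (extChartAt (𝓡∂ m) x₀).map_source p.2,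
      trivial⟩ : ((extChartAt (𝓡∂ m) x₀).target ×ˢ univ : Set (Model m × Model m)))) := by
    refine IsEmbedding.of_leftInverse
      (f := fun z : ((extChartAt (𝓡∂ m) x₀).target ×ˢ univ : Set (Model m × Model m)) =>
        (⟨ofCoord x₀ z.1, (extChartAt (𝓡∂ m) x₀).map_target z.2.1⟩ : O)) ?_ ?_ ?_
    · exact fun p => Subtype.ext (ofCoord_coord p.2)
    · exact (continuousOn_iff_continuous_domRestrict.1 (continuousOn_ofCoord x₀)).subtype_mk _
    · exact (continuousOn_iff_continuous_domRestrict.1 (continuousOn_coord x₀)).subtype_mk _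
  have : SecondCountableTopology O := hemb.secondCountableTopology
  have hemb2 : IsEmbedding (fun p : S' => (⟨p.1.1, p.2⟩ : O)) := by
    refine IsEmbedding.codRestrict (IsEmbedding.subtypeVal.comp IsEmbedding.subtypeVal) O _
  have : SecondCountableTopology S' := hemb2.secondCountableTopology
  have : SigmaCompactSpace S' := sigmaCompactSpace_of_locallyCompact_secondCountable
  refine ⟨fun j => (fun p : S' => p.1.1) '' compactCovering S' j, fun j =>
    (isCompact_compactCovering S' j).image (by fun_prop), ?_⟩
  rw [← image_iUnion, iUnion_compactCovering, image_univ]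
  ext p
  constructor
  · rintro ⟨q, rfl⟩
    exact ⟨q.1.2, q.2⟩
  · rintro ⟨h1, h2⟩
    exact ⟨⟨⟨p, h1⟩, h2⟩, rfl⟩

/-- The interior of a chart domain is a countable union of compact sets on which the relative
gauge is continuous: the projections of compact parts of the submanifolds of `TM` provided by the
graph structure, on which the transports depend continuously on the base vector. -/
theorem IsRelativeGauge.exists_cover [T2Space M] (hφ : IsRelativeGauge A₁ A₂ G φ)
    (hG : G.IsComplete) (x₀ : M) :
    ∃ K : ℕ → Set (Model m), (∀ j, IsClosed (K j)) ∧ interiorTarget x₀ ⊆ ⋃ j, K j ∧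
      ∀ j, ContinuousOn
        (fun z => tsq (φ ((extChartAt (𝓡∂ m) x₀).symm z) : Matrix (Fin n) (Fin n) ℂ)) (K j) := by
  have hloc : ∀ y ∈ (interiorTarget x₀ : Set (Model m)), ∃ K : ℕ → Set (Model m),
      (∀ j, IsClosed (K j)) ∧ ⋃ j, K j ∈ 𝓝[interiorTarget x₀] y ∧ ∀ j, ContinuousOn
        (fun z => tsq (φ ((extChartAt (𝓡∂ m) x₀).symm z) : Matrix (Fin n) (Fin n) ℂ)) (K j) := by
    intro y hy
    obtain ⟨S, hS, hST, hx⟩ := hG.submanifold _ (extChartAt_symm_mem_interior hy)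
    obtain ⟨C, hC, hCS⟩ := hS.exists_isCompact x₀
    have hCj : ∀ j, C j ⊆ S ∩ TotalSpace.proj ⁻¹' (extChartAt (𝓡∂ m) x₀).source := fun j =>
      hCS ▸ subset_iUnion C j
    have hcont : ∀ j, ContinuousOn (fun p => extChartAt (𝓡∂ m) x₀ (TotalSpace.proj p)) (C j) :=
      fun j => (continuousOn_extChartAt x₀).comp
        (FiberBundle.continuous_proj (Model m) (TangentSpace (𝓡∂ m))).continuousOn
        fun p hp => (hCj j hp).2
    refine ⟨fun j => (fun p => extChartAt (𝓡∂ m) x₀ (TotalSpace.proj p)) '' C j, fun j =>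
      ((hC j).image_of_continuousOn (hcont j)).isClosed, ?_, fun j => ?_⟩
    · have hca : ContinuousAt (extChartAt (𝓡∂ m) x₀).symm y :=
        (continuousOn_extChartAt_symm x₀ y hy.1).continuousAt
          (mem_of_superset ((isOpen_interiorTarget x₀).mem_nhds hy) inter_subset_left)
      filter_upwards [mem_nhdsWithin_of_mem_nhds (hca (mem_interior_iff_mem_nhds.1 hx)),
        self_mem_nhdsWithin] with z hz hz'
      obtain ⟨p, hpS, hp⟩ := hz
      have hps : p ∈ ⋃ j, C j := by
        rw [hCS]
        refine ⟨hpS, ?_⟩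
        rw [mem_preimage, hp]
        exact (extChartAt (𝓡∂ m) x₀).map_target hz'.1
      obtain ⟨j, hj⟩ := mem_iUnion.1 hps
      refine mem_iUnion.2 ⟨j, p, hj, ?_⟩
      change extChartAt (𝓡∂ m) x₀ p.proj = z
      rw [hp, (extChartAt (𝓡∂ m) x₀).right_inv hz'.1]
    · refine continuousOn_image_of_isCompact (hC j) (hcont j) ?_
      have hP : ∀ A : HermitianConnection m M n, ContinuousOn (geodesicTransport g A) (C j) :=
        fun A => (continuousOn_geodesicTransport g A).mono fun p hp =>
          GeodesicGraph.isNontangential (hST (hCj j hp).1)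
      have h1 : ContinuousOn (fun p => tsq ((geodesicTransport g A₁ p)ᴴ * geodesicTransport g A₂ p))
          (C j) := continuous_tsq.comp_continuousOn ((hP A₁).star.mul (hP A₂))
      refine h1.congr fun p hp => ?_
      simp only [Function.comp]
      rw [(extChartAt (𝓡∂ m) x₀).left_inv (hCj j hp).2]
      exact hφ.transport p (hST (hCj j hp).1)
  choose! K hK1 hK2 hK3 using hloc
  obtain ⟨t, htΩ, htc, ht⟩ := TopologicalSpace.countable_cover_nhdsWithin hK2
  rcases t.eq_empty_or_nonempty with rfl | hne
  · refine ⟨fun _ => ∅, fun _ => isClosed_empty, ?_, fun _ => continuousOn_empty _⟩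
    simpa using ht
  · obtain ⟨u, rfl⟩ := htc.exists_eq_range hne
    have hu : ∀ i, u i ∈ (interiorTarget x₀ : Set (Model m)) := fun i => htΩ (mem_range_self i)
    refine ⟨fun j => K (u j.unpair.1) j.unpair.2, fun j => hK1 _ (hu _) _, fun y hy => ?_,
      fun j => hK3 _ (hu _) _⟩
    obtain ⟨_, ⟨i, rfl⟩, h⟩ := mem_iUnion₂.1 (ht hy)
    obtain ⟨j, hj⟩ := mem_iUnion.1 h
    exact mem_iUnion.2 ⟨Nat.pair i j, by simpa using hj⟩

/-- In the interior the relative gauge is differentiable, and parallel. -/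
theorem IsRelativeGauge.hasFDerivAt [T2Space M] (hφ : IsRelativeGauge A₁ A₂ G φ)
    (hG : G.IsComplete) {x₀ : M} {y : Model m} (hy : y ∈ interiorTarget x₀) :
    HasFDerivAt (fun z => tsq (φ ((extChartAt (𝓡∂ m) x₀).symm z) : Matrix (Fin n) (Fin n) ℂ))
      (parallelL A₁ A₂ x₀ y (tsq (φ ((extChartAt (𝓡∂ m) x₀).symm y) : Matrix (Fin n) (Fin n) ℂ)))
      y := by
  have hΩ := isOpen_interiorTarget (m := m) x₀
  obtain ⟨K, hK, hΩK, hfK⟩ := hφ.exists_cover hG x₀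
  have hac : ∀ z ∈ (interiorTarget x₀ : Set (Model m)), ContinuousAt
      (fun z => tsq (φ ((extChartAt (𝓡∂ m) x₀).symm z) : Matrix (Fin n) (Fin n) ℂ)) z →
      ContinuousAt (fun z => parallelL A₁ A₂ x₀ z
        (tsq (φ ((extChartAt (𝓡∂ m) x₀).symm z) : Matrix (Fin n) (Fin n) ℂ))) z := fun z hz h =>
    (continuousWithinAt_parallelL A₁ A₂ (inter_subset_left : interiorTarget x₀ ⊆ _) hz.1
      h.continuousWithinAt).continuousAt (hΩ.mem_nhds hz)
  have hcont := continuousAt_of_hasSpanningDerivAt hΩ (fun z hz => hφ.hasSpanningDerivAt hG hz)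
    (fun z hz => by
      obtain ⟨C, -, hC⟩ := eventually_norm_parallelL_le A₁ A₂ hz.1
      rw [nhdsWithin_eq_nhds.2 (mem_of_superset (hΩ.mem_nhds hz) inter_subset_left)] at hC
      exact ⟨C, hC.mono fun w hw => hw _ (norm_tsq_le_one _)⟩) hac hK hΩK hfK
  exact hasFDerivAt_of_hasSpanningDerivAt
    (a := fun z => parallelL A₁ A₂ x₀ z
      (tsq (φ ((extChartAt (𝓡∂ m) x₀).symm z) : Matrix (Fin n) (Fin n) ℂ)))
    (Eventually.mono (hΩ.mem_nhds hy) hcont)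
    (Eventually.mono (hΩ.mem_nhds hy) fun z hz =>
      hφ.hasSpanningDerivAt hG hz) (hac y hy (hcont y hy))

end Interior

/-! ### Parallel sections -/

theorem nhdsLT_le_nhdsWithin_Icc {a b : ℝ} (h : a < b) : 𝓝[<] b ≤ 𝓝[Icc a b] b := by
  rw [← nhdsWithin_Ico_eq_nhdsLT h]
  exact nhdsWithin_mono _ Ico_subset_Icc_self

section ParallelSection
variable {m n : ℕ} [NeZero m] {M : Type*} [TopologicalSpace M]
  [ChartedSpace (EuclideanHalfSpace m) M] [IsManifold (𝓡∂ m) ∞ M]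

/-- The function `Q` satisfies `dQ = Q (A₂ ⊗ 1 + 1 ⊗ A₂) - (A₁ ⊗ 1 + 1 ⊗ A₁) Q` at `x`: it is
parallel at `x` for the connection that `A₁` and `A₂` induce on the endomorphisms of
`ℂⁿ ⊗ ℂⁿ`. -/
def IsParallelAt (A₁ A₂ : HermitianConnection m M n)
    (Q : M → Matrix (Fin n × Fin n) (Fin n × Fin n) ℂ) (x : M) : Prop :=
  MDifferentiableAt (𝓡∂ m) 𝓘(ℝ, Matrix (Fin n × Fin n) (Fin n × Fin n) ℂ) Q x ∧
    ∀ v : TangentSpace (𝓡∂ m) x,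
      mfderiv (𝓡∂ m) 𝓘(ℝ, Matrix (Fin n × Fin n) (Fin n × Fin n) ℂ) Q x v =
        Q x * dtsq (A₂.form x v) - dtsq (A₁.form x v) * Q x

variable {g : SmoothMetric m M} {A₁ A₂ : HermitianConnection m M n}
  {Q : M → Matrix (Fin n × Fin n) (Fin n × Fin n) ℂ}

theorem hasMFDerivAt_of_hasFDerivWithinAt_chart {V : Type*} [NormedAddCommGroup V]
    [NormedSpace ℝ V] {f : M → V} {L : Model m →L[ℝ] V} {x₀ x : M}
    (hx : x ∈ (extChartAt (𝓡∂ m) x₀).source)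
    (h : HasFDerivWithinAt (fun z => f ((extChartAt (𝓡∂ m) x₀).symm z)) L (range (𝓡∂ m))
      (extChartAt (𝓡∂ m) x₀ x)) :
    HasMFDerivAt (𝓡∂ m) 𝓘(ℝ, V) f x
      (L.comp (mfderiv (𝓡∂ m) 𝓘(ℝ, Model m) (extChartAt (𝓡∂ m) x₀) x)) := by
  have h1 : HasMFDerivAt (𝓡∂ m) 𝓘(ℝ, Model m) (extChartAt (𝓡∂ m) x₀) x
      (mfderiv (𝓡∂ m) 𝓘(ℝ, Model m) (extChartAt (𝓡∂ m) x₀) x) :=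
    (mdifferentiableAt_extChartAt (by rwa [extChartAt_source] at hx)).hasMFDerivAt
  have hs := (isOpen_extChartAt_source (I := 𝓡∂ m) x₀).mem_nhds hx
  have h2 := (h.hasMFDerivWithinAt.comp x (h1.hasMFDerivWithinAt
    (s := (extChartAt (𝓡∂ m) x₀).source)) fun z hz =>
      extChartAt_target_subset_range x₀ ((extChartAt (𝓡∂ m) x₀).map_source hz)).hasMFDerivAt hs
  refine h2.congr_of_eventuallyEq ?_
  filter_upwards [hs] with z hz
  simp only [Function.comp]
  rw [(extChartAt (𝓡∂ m) x₀).left_inv hz]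

theorem mfderiv_apply_of_hasFDerivWithinAt_chart {V : Type*} [NormedAddCommGroup V]
    [NormedSpace ℝ V] {f : M → V} {L : Model m →L[ℝ] V} {p : TangentBundle (𝓡∂ m) M} {x₀ : M}
    (hx : p.proj ∈ (extChartAt (𝓡∂ m) x₀).source)
    (h : HasFDerivWithinAt (fun z => f ((extChartAt (𝓡∂ m) x₀).symm z)) L (range (𝓡∂ m))
      (extChartAt (𝓡∂ m) x₀ p.proj)) :
    mfderiv (𝓡∂ m) 𝓘(ℝ, V) f p.proj p.snd = L (coord x₀ p).2 := by
  rw [(hasMFDerivAt_of_hasFDerivWithinAt_chart hx h).mfderiv]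
  rfl

omit [IsManifold (𝓡∂ m) ∞ M] in
theorem hasDerivWithinAt_comp_of_hasMFDerivAt {V : Type*} [NormedAddCommGroup V]
    [NormedSpace ℝ V] {f : M → V} {γ : ℝ → M} {s : Set ℝ} {t : ℝ}
    {L : TangentSpace (𝓡∂ m) (γ t) →L[ℝ] V}
    (h : HasMFDerivAt (𝓡∂ m) 𝓘(ℝ, V) f (γ t) L)
    (hγ : MDifferentiableWithinAt 𝓘(ℝ, ℝ) (𝓡∂ m) γ s t) :
    HasDerivWithinAt (fun r => f (γ r))
      (L (mfderivWithin 𝓘(ℝ, ℝ) (𝓡∂ m) γ s t (1 : ℝ))) s t := by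
  have h1 := h.comp_hasMFDerivWithinAt t hγ.hasMFDerivWithinAt
  have h2 : HasFDerivWithinAt (𝕜 := ℝ) (E := ℝ) (F := V) (f ∘ γ)
    (L.comp (mfderivWithin 𝓘(ℝ, ℝ) (𝓡∂ m) γ s t)) s t := h1.hasFDerivWithinAt
  exact h2.hasDerivWithinAt

theorem isParallelAt_of_hasFDerivWithinAt {x₀ x : M} (hx : x ∈ (extChartAt (𝓡∂ m) x₀).source)
    (h : HasFDerivWithinAt (fun z => Q ((extChartAt (𝓡∂ m) x₀).symm z))
      (parallelL A₁ A₂ x₀ (extChartAt (𝓡∂ m) x₀ x) (Q x)) (range (𝓡∂ m))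
      (extChartAt (𝓡∂ m) x₀ x)) : IsParallelAt A₁ A₂ Q x := by
  refine ⟨(hasMFDerivAt_of_hasFDerivWithinAt_chart hx h).mdifferentiableAt, fun v => ?_⟩
  exact (mfderiv_apply_of_hasFDerivWithinAt_chart (p := ⟨x, v⟩) hx h).trans
    (parallelL_coord A₁ A₂ (Q x) (p := ⟨x, v⟩) hx)

theorem IsParallelAt.hasDerivWithinAt {γ : ℝ → M} {s : Set ℝ} {t : ℝ}
    (h : IsParallelAt A₁ A₂ Q (γ t)) (hγ : MDifferentiableWithinAt 𝓘(ℝ, ℝ) (𝓡∂ m) γ s t) :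
    HasDerivWithinAt (fun r => Q (γ r))
      (Q (γ t) * dtsq (A₂.form (γ t) (mfderivWithin 𝓘(ℝ, ℝ) (𝓡∂ m) γ s t (1 : ℝ))) -
        dtsq (A₁.form (γ t) (mfderivWithin 𝓘(ℝ, ℝ) (𝓡∂ m) γ s t (1 : ℝ))) * Q (γ t)) s t :=
  (hasDerivWithinAt_comp_of_hasMFDerivAt h.1.hasMFDerivAt hγ).congr_deriv (h.2 _)

theorem tendsto_geo_scatteringMap {p : TangentBundle (𝓡∂ m) M} (hp : IsNontangential g p) :
    Tendsto (geo g p) (𝓝[<] (exitTime g p)) (𝓝 (scatteringMap g p)) := by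
  have h := isNontangentialGeodesic_geo hp
  exact (h.geodesic.smooth.continuousOn _ (right_mem_Icc.2 h.pos.le)).tendsto.mono_left
    (nhdsLT_le_nhdsWithin_Icc h.pos)

/-- Parallel sections along a nontangential geodesic are conjugated by the transports. -/
theorem tendsto_of_isParallelAt {p : TangentBundle (𝓡∂ m) M} (hp : IsNontangential g p)
    (hQ : ∀ x ∈ (𝓡∂ m).interior M, IsParallelAt A₁ A₂ Q x) :
    Tendsto (fun t => Q (geo g p t)) (𝓝[<] (exitTime g p))
      (𝓝 (tsq (geodesicTransport g A₁ p) * Q p.proj * tsq (geodesicTransport g A₂ p)ᴴ)) := by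
  have hpg := isNontangentialGeodesic_geo hp
  have hW₁ := isTransportSolution_transportSol A₁ hp
  have hW₂ := isTransportSolution_transportSol A₂ hp
  set τ := exitTime g p with hτ
  have h0 : (0 : ℝ) ∈ Ico 0 τ := ⟨le_rfl, hpg.pos⟩
  have hd : ∀ t ∈ Ico 0 τ, HasDerivWithinAt (fun t => tsq (transportSol g A₁ p t)ᴴ *
      Q (geo g p t) * tsq (transportSol g A₂ p t)) 0 (Ico 0 τ) t := fun t ht =>
    (hasDerivWithinAt_conj_transport_zero (Q := fun t => Q (geo g p t)) (A₁.skew _ _)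
      (hW₁.2 t (Ico_subset_Icc_self ht))
      (hW₂.2 t (Ico_subset_Icc_self ht)) ((hQ _ (hpg.interior t ht)).hasDerivWithinAt
        ((hpg.geodesic.smooth t (Ico_subset_Icc_self ht)).mdifferentiableWithinAt
          (by simp)))).mono Ico_subset_Icc_self
  have hconst : ∀ t ∈ Ico 0 τ, Q (geo g p t) =
      tsq (transportSol g A₁ p t) * Q p.proj * tsq (transportSol g A₂ p t)ᴴ := by
    intro t ht
    have h2 := (convex_Ico 0 τ).norm_image_sub_le_of_norm_hasDerivWithin_le (C := 0)
      hd (fun u _ => by simp) h0 ht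
    rw [zero_mul, norm_le_zero_iff, sub_eq_zero] at h2
    rw [hW₁.1, hW₂.1, Matrix.conjTranspose_one, tsq_one, one_mul, mul_one,
      show geo g p 0 = p.proj from congrArg TotalSpace.proj hpg.initial] at h2
    rw [← h2]
    have e1 : tsq (transportSol g A₁ p t) * tsq (transportSol g A₁ p t)ᴴ = 1 := by
      rw [← tsq_mul, hW₁.mul_conjTranspose_self (Ico_subset_Icc_self ht), tsq_one]
    have e2 : tsq (transportSol g A₂ p t) * tsq (transportSol g A₂ p t)ᴴ = 1 := by
      rw [← tsq_mul, hW₂.mul_conjTranspose_self (Ico_subset_Icc_self ht), tsq_one]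
    rw [show ∀ a b c d e : Matrix (Fin n × Fin n) (Fin n × Fin n) ℂ,
      a * (b * c * d) * e = (a * b) * c * (d * e) by intros; noncomm_ring, e1, e2, one_mul, mul_one]
  have hτm : τ ∈ Icc 0 τ := ⟨hpg.pos.le, le_rfl⟩
  have hc : ContinuousWithinAt (fun t => tsq (transportSol g A₁ p t) * Q p.proj *
      tsq (transportSol g A₂ p t)ᴴ) (Icc 0 τ) τ :=
    ((continuous_tsq.continuousAt.comp_continuousWithinAt (hW₁.2 τ hτm).continuousWithinAt).mul
      continuousWithinAt_const).mul
      (continuous_tsq.continuousAt.comp_continuousWithinAt (hW₂.2 τ hτm).continuousWithinAt.star)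
  have hc' := hc.tendsto.mono_left (nhdsLT_le_nhdsWithin_Icc hpg.pos)
  rw [hτ, transportSol_exitTime A₁ hp, transportSol_exitTime A₂ hp, ← hτ] at hc'
  refine hc'.congr' ?_
  filter_upwards [Ico_mem_nhdsLT hpg.pos] with t ht
  exact (hconst t ht).symm

/-- Solutions of the parallel equation are smooth, as the derivative is a smooth function of the
point and of the value. -/
theorem contDiffOn_of_hasFDerivWithinAt_parallelL {x₀ : M}
    {f : Model m → Matrix (Fin n × Fin n) (Fin n × Fin n) ℂ}
    (h : ∀ y ∈ (extChartAt (𝓡∂ m) x₀).target,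
      HasFDerivWithinAt f (parallelL A₁ A₂ x₀ y (f y)) (range (𝓡∂ m)) y) :
    ContDiffOn ℝ ∞ f (extChartAt (𝓡∂ m) x₀).target := by
  have h' : ∀ y ∈ (extChartAt (𝓡∂ m) x₀).target,
      HasFDerivWithinAt f (parallelL A₁ A₂ x₀ y (f y)) (extChartAt (𝓡∂ m) x₀).target y :=
    fun y hy => (h y hy).mono (extChartAt_target_subset_range x₀)
  rw [contDiffOn_infty]
  intro k
  induction k with
  | zero => exact contDiffOn_zero.2 fun y hy => (h' y hy).continuousWithinAt
  | succ k ih =>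
    refine (contDiffOn_succ_iff_hasFDerivWithinAt_of_uniqueDiffOn
      (uniqueDiffOn_extChartAt_target x₀)).2 ⟨fun h => absurd h (by simp), _,
        contDiffOn_parallelL A₁ A₂ ih, h'⟩

end ParallelSection

/-! ### The relative gauge at the boundary -/

section Boundary
variable {m n : ℕ} [NeZero m] {M : Type*} [TopologicalSpace M] [T2Space M]
  [ChartedSpace (EuclideanHalfSpace m) M] [IsManifold (𝓡∂ m) ∞ M]
  {g : SmoothMetric m M} {A₁ A₂ : HermitianConnection m M n} {G : GeodesicGraph g} {φ : M → U n}

theorem IsRelativeGauge.isParallelAt_of_mem_interior (hφ : IsRelativeGauge A₁ A₂ G φ)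
    (hG : G.IsComplete) {x : M} (hx : x ∈ (𝓡∂ m).interior M) :
    IsParallelAt A₁ A₂ (fun y => tsq (φ y : Matrix (Fin n) (Fin n) ℂ)) x := by
  have hs := mem_extChartAt_source (I := 𝓡∂ m) x
  have h := hφ.hasFDerivAt hG ((extChartAt_mem_interiorTarget_iff hs).2 hx)
  rw [(extChartAt (𝓡∂ m) x).left_inv hs] at h
  exact isParallelAt_of_hasFDerivWithinAt
    (Q := fun y => tsq (φ y : Matrix (Fin n) (Fin n) ℂ)) hs h.hasFDerivWithinAt

/-- The relative gauge tends to `1` along geodesics of `G`, as these approach the boundary. -/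
theorem IsRelativeGauge.tendsto_one (hφ : IsRelativeGauge A₁ A₂ G φ) (hG : G.IsComplete)
    {p : TangentBundle (𝓡∂ m) M} (hp : p ∈ G.total) :
    Tendsto (fun t => tsq (φ (geo g p t) : Matrix (Fin n) (Fin n) ℂ)) (𝓝[<] (exitTime g p))
      (𝓝 1) := by
  have hpn := GeodesicGraph.isNontangential hp
  have h := tendsto_of_isParallelAt (Q := fun y => tsq (φ y : Matrix (Fin n) (Fin n) ℂ)) hpn
    fun x hx => hφ.isParallelAt_of_mem_interior hG hx
  rw [hφ.transport p hp, ← tsq_mul, ← tsq_mul, ← Matrix.mul_assoc,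
    geodesicTransport_mul_conjTranspose A₁ hpn, one_mul,
    geodesicTransport_mul_conjTranspose A₂ hpn, tsq_one] at h
  exact h

omit [T2Space M] in
theorem extChartAt_symm_mem_boundary {x₀ : M} {y : Model m}
    (hy : y ∈ (extChartAt (𝓡∂ m) x₀).target) (h0 : y 0 = 0) :
    (extChartAt (𝓡∂ m) x₀).symm y ∈ (𝓡∂ m).boundary M := by
  rw [← ModelWithCorners.compl_interior]
  intro h
  have h1 := (extChartAt_mem_interiorTarget_iff ((extChartAt (𝓡∂ m) x₀).map_target hy)).2 h
  rw [(extChartAt (𝓡∂ m) x₀).right_inv hy] at h1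
  exact (show 0 < y 0 from h1.2).ne' h0

/-- The relative gauge is continuous at boundary points: it is Lipschitz on half balls, and tends
to `1` along geodesics which end in a dense set of boundary points. -/
theorem IsRelativeGauge.continuousWithinAt_boundary (hφ : IsRelativeGauge A₁ A₂ G φ)
    (hG : G.IsComplete) {x₀ : M} {y : Model m} (hy : y ∈ (extChartAt (𝓡∂ m) x₀).target)
    (hy0 : y 0 = 0) : ContinuousWithinAt
      (fun z => tsq (φ ((extChartAt (𝓡∂ m) x₀).symm z) : Matrix (Fin n) (Fin n) ℂ))
      (range (𝓡∂ m)) y := by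
  set f := fun z => tsq (φ ((extChartAt (𝓡∂ m) x₀).symm z) : Matrix (Fin n) (Fin n) ℂ) with hf
  have hf1 : ∀ z ∈ (extChartAt (𝓡∂ m) x₀).target, z 0 = 0 → f z = 1 := fun z hz h0 => by
    have h1 := hφ.boundary _ (extChartAt_symm_mem_boundary hz h0)
    simp only [hf, h1]
    exact tsq_one
  obtain ⟨C, hC0, hC⟩ := eventually_norm_parallelL_le A₁ A₂ hy
  rw [nhdsWithin_extChartAt_target_eq_of_mem hy] at hC
  obtain ⟨r, hr, hball⟩ := Metric.mem_nhdsWithin_iff.1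
    (hC.and (extChartAt_target_mem_nhdsWithin_of_mem hy))
  have hB : ∀ z ∈ Metric.ball y r ∩ {z | 0 < z 0}, z ∈ interiorTarget x₀ ∧
      ‖parallelL A₁ A₂ x₀ z (f z)‖ ≤ C := by
    intro z hz
    have hz' : z ∈ range (𝓡∂ m) := by
      rw [range_modelWithCornersEuclideanHalfSpace]
      exact (show 0 < z 0 from hz.2).le
    have h1 := hball ⟨hz.1, hz'⟩
    exact ⟨⟨h1.2, hz.2⟩, h1.1 _ (norm_tsq_le_one _)⟩
  have hconv : Convex ℝ (Metric.ball y r ∩ {z : Model m | 0 < z 0}) :=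
    (convex_ball y r).inter (convex_halfSpace_gt (f := fun z : Model m => z 0)
      ⟨fun _ _ => rfl, fun _ _ => rfl⟩ 0)
  have hlip : ∀ z ∈ Metric.ball y r ∩ {z : Model m | 0 < z 0},
      ∀ z' ∈ Metric.ball y r ∩ {z : Model m | 0 < z 0}, ‖f z' - f z‖ ≤ C * ‖z' - z‖ := by
    intro z hz z' hz'
    exact hconv.norm_image_sub_le_of_norm_hasFDerivWithin_le
      (fun w hw => (hφ.hasFDerivAt hG (hB w hw).1).hasFDerivWithinAt)
      (fun w hw => (hB w hw).2) hz hz'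
  have key : ∀ z ∈ Metric.ball y r ∩ {z : Model m | 0 < z 0}, ‖f z - 1‖ ≤ C * ‖z - y‖ := by
    intro z hz
    -- compare with a geodesic of `G` which ends within `δ` of `y`
    have hδ : ∀ δ > 0, ‖f z - 1‖ ≤ C * (‖z - y‖ + δ) := by
      intro δ hδ
      obtain ⟨q, ⟨hq1, hq2⟩, p, hp, rfl⟩ := mem_closure_iff.1
        (hG.dense (extChartAt_symm_mem_boundary hy hy0)) _
        (isOpen_extChartAt_preimage (I := 𝓡∂ m) x₀ (Metric.isOpen_ball (x := y) (ε := min δ r)))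
        ⟨by rw [← extChartAt_source (𝓡∂ m)]; exact (extChartAt (𝓡∂ m) x₀).map_target hy, by
          rw [mem_preimage, (extChartAt (𝓡∂ m) x₀).right_inv hy]
          exact Metric.mem_ball_self (lt_min hδ hr)⟩
      rw [← extChartAt_source (𝓡∂ m)] at hq1
      have hpn := GeodesicGraph.isNontangential hp
      have hpg := isNontangentialGeodesic_geo hpn
      have hγ := tendsto_geo_scatteringMap hpn
      have hγs := hγ.eventually ((isOpen_extChartAt_source (I := 𝓡∂ m) x₀).mem_nhds hq1)
      have hc : Tendsto (fun t => extChartAt (𝓡∂ m) x₀ (geo g p t)) (𝓝[<] (exitTime g p))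
          (𝓝 (extChartAt (𝓡∂ m) x₀ (scatteringMap g p))) :=
        (continuousAt_extChartAt' hq1).tendsto.comp hγ
      have hlim : ‖f z - 1‖ ≤ C * ‖z - extChartAt (𝓡∂ m) x₀ (scatteringMap g p)‖ := by
        refine le_of_tendsto_of_tendsto ((tendsto_const_nhds.sub (hφ.tendsto_one hG hp)).norm)
          ((tendsto_const_nhds.sub hc).norm.const_mul C) ?_
        filter_upwards [hγs, hc.eventually (Metric.isOpen_ball.mem_nhds hq2),
          Ico_mem_nhdsLT hpg.pos] with t h1 h2 h3
        have h4 := hlip (extChartAt (𝓡∂ m) x₀ (geo g p t))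
          ⟨Metric.ball_subset_ball (min_le_right _ _) h2,
            ((extChartAt_mem_interiorTarget_iff h1).2 (hpg.interior t h3)).2⟩ z hz
        simp only [hf, (extChartAt (𝓡∂ m) x₀).left_inv h1] at h4
        exact h4
      refine hlim.trans (mul_le_mul_of_nonneg_left ?_ hC0)
      have h5 : ‖y - extChartAt (𝓡∂ m) x₀ (scatteringMap g p)‖ ≤ δ := by
        have h6 : dist (extChartAt (𝓡∂ m) x₀ (scatteringMap g p)) y < min δ r := hq2
        rw [dist_comm, dist_eq_norm] at h6
        exact h6.le.trans (min_le_left _ _)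
      calc _ = ‖(z - y) + (y - extChartAt (𝓡∂ m) x₀ (scatteringMap g p))‖ := by
            rw [sub_add_sub_cancel]
        _ ≤ _ := (norm_add_le _ _).trans (by gcongr)
    refine ge_of_tendsto (x := 𝓝[>] (0 : ℝ)) (f := fun δ => C * (‖z - y‖ + δ)) ?_
      (eventually_mem_nhdsWithin.mono fun δ h => hδ δ h)
    have : Continuous fun δ : ℝ => C * (‖z - y‖ + δ) := by fun_prop
    have h7 := (this.tendsto 0).mono_left (nhdsWithin_le_nhds (s := Ioi 0))
    rwa [add_zero] at h7
  rw [ContinuousWithinAt, hf1 y hy hy0, tendsto_iff_norm_sub_tendsto_zero]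
  have hz : Tendsto (fun z : Model m => C * ‖z - y‖) (𝓝[range (𝓡∂ m)] y) (𝓝 0) := by
    have : Continuous fun z : Model m => C * ‖z - y‖ := by fun_prop
    have h7 := (this.tendsto y).mono_left (nhdsWithin_le_nhds (s := range (𝓡∂ m)))
    rwa [sub_self, norm_zero, mul_zero] at h7
  refine squeeze_zero' (Eventually.of_forall fun z => norm_nonneg _) ?_ hz
  filter_upwards [extChartAt_target_mem_nhdsWithin_of_mem hy,
    mem_nhdsWithin_of_mem_nhds (Metric.ball_mem_nhds y hr)] with z hzt hzb
  have hz0 : 0 ≤ z 0 := by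
    have := extChartAt_target_subset_range (I := 𝓡∂ m) x₀ hzt
    rwa [range_modelWithCornersEuclideanHalfSpace] at this
  rcases hz0.eq_or_lt with h | h
  · rw [hf1 z hzt h.symm, sub_self, norm_zero]
    positivity
  · exact key z ⟨hzb, h⟩

theorem IsRelativeGauge.continuousWithinAt (hφ : IsRelativeGauge A₁ A₂ G φ)
    (hG : G.IsComplete) {x₀ : M} {y : Model m} (hy : y ∈ (extChartAt (𝓡∂ m) x₀).target) :
    ContinuousWithinAt
      (fun z => tsq (φ ((extChartAt (𝓡∂ m) x₀).symm z) : Matrix (Fin n) (Fin n) ℂ))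
      (range (𝓡∂ m)) y := by
  have hy0 : 0 ≤ y 0 := by
    have := extChartAt_target_subset_range (I := 𝓡∂ m) x₀ hy
    rwa [range_modelWithCornersEuclideanHalfSpace] at this
  rcases hy0.eq_or_lt with h | h
  · exact hφ.continuousWithinAt_boundary hG hy h.symm
  · exact (hφ.hasFDerivAt hG ⟨hy, h⟩).continuousAt.continuousWithinAt

/-- The parallel equation extends to the boundary by continuity. -/
theorem IsRelativeGauge.hasFDerivWithinAt (hφ : IsRelativeGauge A₁ A₂ G φ)
    (hG : G.IsComplete) {x₀ : M} {y : Model m} (hy : y ∈ (extChartAt (𝓡∂ m) x₀).target) :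
    HasFDerivWithinAt
      (fun z => tsq (φ ((extChartAt (𝓡∂ m) x₀).symm z) : Matrix (Fin n) (Fin n) ℂ))
      (parallelL A₁ A₂ x₀ y (tsq (φ ((extChartAt (𝓡∂ m) x₀).symm y) : Matrix (Fin n) (Fin n) ℂ)))
      (range (𝓡∂ m)) y := by
  obtain ⟨r, hr, hball⟩ := Metric.mem_nhdsWithin_iff.1
    (extChartAt_target_mem_nhdsWithin_of_mem hy)
  set s : Set (Model m) := Metric.ball y (r / 2) ∩ interior (range (𝓡∂ m)) with hs
  have hso : IsOpen s := Metric.isOpen_ball.inter isOpen_interior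
  have hsr : s ⊆ range (𝓡∂ m) := inter_subset_right.trans interior_subset
  have hcl : closure s ⊆ (extChartAt (𝓡∂ m) x₀).target := by
    refine fun z hz => hball ⟨?_, ?_⟩
    · exact Metric.closedBall_subset_ball (by linarith)
        (Metric.closure_ball_subset_closedBall (closure_mono inter_subset_left hz))
    · exact closure_minimal hsr (𝓡∂ m).isClosed_range hz
  have hsΩ : s ⊆ interiorTarget x₀ := fun z hz => ⟨hcl (subset_closure hz), by
    have := hz.2
    rwa [interior_range_modelWithCornersEuclideanHalfSpace] at this⟩
  have hconv : Convex ℝ s := (convex_ball y _).inter (𝓡∂ m).convex_range.interior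
  have h := hasFDerivWithinAt_closure_of_tendsto_fderiv (x := y)
    (f := fun z => tsq (φ ((extChartAt (𝓡∂ m) x₀).symm z) : Matrix (Fin n) (Fin n) ℂ))
    (f' := parallelL A₁ A₂ x₀ y
      (tsq (φ ((extChartAt (𝓡∂ m) x₀).symm y) : Matrix (Fin n) (Fin n) ℂ)))
    (fun z hz => (hφ.hasFDerivAt hG (hsΩ hz)).differentiableAt.differentiableWithinAt) hconv hso
    (fun z hz => (hφ.continuousWithinAt hG (hcl hz)).mono hsr) (by
      have h1 := continuousWithinAt_parallelL A₁ A₂ (s := s) (subset_closure.trans hcl) hy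
        ((hφ.continuousWithinAt hG hy).mono hsr)
      refine h1.tendsto.congr' ?_
      filter_upwards [self_mem_nhdsWithin] with z hz
      exact (hφ.hasFDerivAt hG (hsΩ hz)).fderiv.symm)
  refine h.mono_of_mem_nhdsWithin ?_
  have h2 : Metric.ball y (r / 2) ∩ range (𝓡∂ m) ⊆ closure s :=
    (inter_subset_inter_right _ (𝓡∂ m).range_subset_closure_interior).trans
      Metric.isOpen_ball.inter_closure
  exact mem_of_superset (inter_mem (mem_nhdsWithin_of_mem_nhds
    (Metric.ball_mem_nhds y (half_pos hr))) self_mem_nhdsWithin) h2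

theorem IsRelativeGauge.isParallelAt (hφ : IsRelativeGauge A₁ A₂ G φ) (hG : G.IsComplete) (x : M) :
    IsParallelAt A₁ A₂ (fun y => tsq (φ y : Matrix (Fin n) (Fin n) ℂ)) x := by
  have hs := mem_extChartAt_source (I := 𝓡∂ m) x
  have h := hφ.hasFDerivWithinAt hG ((extChartAt (𝓡∂ m) x).map_source hs)
  rw [(extChartAt (𝓡∂ m) x).left_inv hs] at h
  exact isParallelAt_of_hasFDerivWithinAt
    (Q := fun y => tsq (φ y : Matrix (Fin n) (Fin n) ℂ)) hs h

theorem IsRelativeGauge.contMDiff (hφ : IsRelativeGauge A₁ A₂ G φ) (hG : G.IsComplete) :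
    ContMDiff (𝓡∂ m) 𝓘(ℝ, Matrix (Fin n × Fin n) (Fin n × Fin n) ℂ) ∞
      (fun y => tsq (φ y : Matrix (Fin n) (Fin n) ℂ)) := by
  intro x
  have hs := mem_extChartAt_source (I := 𝓡∂ m) x
  have h1 := (contDiffOn_of_hasFDerivWithinAt_parallelL (x₀ := x) (A₁ := A₁) (A₂ := A₂)
    fun y hy => hφ.hasFDerivWithinAt hG hy).contMDiffOn
  have h2 := h1.comp (contMDiffOn_extChartAt (I := 𝓡∂ m) (n := ∞) (x := x)) fun z hz => by
    rw [← extChartAt_source (𝓡∂ m)] at hz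
    exact (extChartAt (𝓡∂ m) x).map_source hz
  rw [← extChartAt_source (𝓡∂ m)] at h2
  refine (h2.contMDiffAt ((isOpen_extChartAt_source x).mem_nhds hs)).congr_of_eventuallyEq ?_
  filter_upwards [(isOpen_extChartAt_source (I := 𝓡∂ m) x).mem_nhds hs] with z hz
  simp only [Function.comp]
  rw [(extChartAt (𝓡∂ m) x).left_inv hz]

end Boundary

/-! ### Smooth lifts and gauge transformations -/

section Lift
variable {n : ℕ}

/-- The contraction `(q_{(k,l),(i,j)}) ↦ (q_{(k,i₀),(l,j₀)})` which maps `u ⊗ u` to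
`u_{i₀ j₀} u`. -/
noncomputable def contractL (i j : Fin n) :
    Matrix (Fin n × Fin n) (Fin n × Fin n) ℂ →L[ℝ] Matrix (Fin n) (Fin n) ℂ :=
  LinearMap.toContinuousLinearMap
    { toFun := fun q => Matrix.of fun k l => q (k, i) (l, j)
      map_add' := fun _ _ => rfl
      map_smul' := fun _ _ => rfl }

/-- An entry of a matrix, as a continuous real linear map. -/
noncomputable def entryL (i j : Fin n) : Matrix (Fin n) (Fin n) ℂ →L[ℝ] ℂ :=
  LinearMap.toContinuousLinearMap
    { toFun := fun q => q i j
      map_add' := fun _ _ => rfl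
      map_smul' := fun _ _ => rfl }

theorem contDiffAt_smul_inv_sqrt {E F : Type*} [NormedAddCommGroup E] [NormedSpace ℝ E]
    [NormedAddCommGroup F] [NormedSpace ℝ F] [NormedSpace ℂ F] [IsScalarTower ℝ ℂ F] (e : E →L[ℝ] ℂ)
    (T : E →L[ℝ] F) (s : ℂ) {q : E} (hq : e q / s ^ 2 ∈ Complex.slitPlane) :
    ContDiffAt ℝ ∞ (fun q => (s * Complex.exp (Complex.log (e q / s ^ 2) / 2))⁻¹ • T q) q := by
  have hs : s ≠ 0 := by
    rintro rfl
    simp at hq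
  have h1 : ContDiffAt ℝ ∞ (fun q => e q / s ^ 2) q := e.contDiff.contDiffAt.div_const _
  have h2 : ContDiffAt ℝ ∞ Complex.log (e q / s ^ 2) :=
    (Complex.contDiffAt_log hq).restrict_scalars ℝ
  have h3 : ContDiffAt ℝ ∞ (fun q => Complex.log (e q / s ^ 2)) q :=
    ContDiffAt.comp (g := Complex.log) (f := fun q => e q / s ^ 2) q h2 h1
  have h4 : ContDiffAt ℝ ∞ (fun q => s * Complex.exp (Complex.log (e q / s ^ 2) / 2)) q :=
    contDiffAt_const.mul ((h3.div_const 2).cexp)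
  exact (h4.inv (mul_ne_zero hs (Complex.exp_ne_zero _))).smul T.contDiff.contDiffAt

/-- Near a unitary matrix, `u` can be recovered from `u ⊗ u` up to sign in a smooth way. -/
theorem exists_contDiffOn_section (u₀ : U n) :
    ∃ (O : Set (Matrix (Fin n × Fin n) (Fin n × Fin n) ℂ))
      (F : Matrix (Fin n × Fin n) (Fin n × Fin n) ℂ → Matrix (Fin n) (Fin n) ℂ),
      IsOpen O ∧ tsq (u₀ : Matrix (Fin n) (Fin n) ℂ) ∈ O ∧ ContDiffOn ℝ ∞ F O ∧
      ∀ w, tsq w ∈ O → F (tsq w) = w ∨ F (tsq w) = -w := by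
  by_cases hu : (u₀ : Matrix (Fin n) (Fin n) ℂ) = 0
  · have h1 : (1 : Matrix (Fin n) (Fin n) ℂ) = 0 := by
      rw [← Matrix.UnitaryGroup.star_mul_self u₀, hu, mul_zero]
    have : Subsingleton (Matrix (Fin n) (Fin n) ℂ) := subsingleton_of_zero_eq_one h1.symm
    exact ⟨univ, fun _ => 0, isOpen_univ, mem_univ _, contDiffOn_const,
      fun w _ => Or.inl (Subsingleton.elim _ _)⟩
  obtain ⟨i, j, hij⟩ : ∃ i j, (u₀ : Matrix (Fin n) (Fin n) ℂ) i j ≠ 0 := by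
    by_contra! hcon
    exact hu (by ext i j; exact hcon i j)
  set s := (u₀ : Matrix (Fin n) (Fin n) ℂ) i j with hs
  set e : Matrix (Fin n × Fin n) (Fin n × Fin n) ℂ →L[ℝ] ℂ := (entryL i j).comp (contractL i j)
    with hedef
  have hetsq : ∀ w, e (tsq w) = w i j * w i j := fun _ => rfl
  -- divide `u_{ij} u` by the branch of the square root of `(u_{ij})²` with value `s` at `u₀`
  refine ⟨{q | e q / s ^ 2 ∈ Complex.slitPlane},
    fun q => (s * Complex.exp (Complex.log (e q / s ^ 2) / 2))⁻¹ • contractL i j q,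
    Complex.isOpen_slitPlane.preimage (e.continuous.div_const _), ?_,
    fun q hq => (contDiffAt_smul_inv_sqrt e (contractL i j) s hq).contDiffWithinAt, fun w hw => ?_⟩
  · rw [mem_ofPred_eq, hetsq, ← hs, ← sq, div_self (pow_ne_zero 2 hij)]
    exact Complex.one_mem_slitPlane
  · set σ := s * Complex.exp (Complex.log (e (tsq w) / s ^ 2) / 2) with hσ
    have hσ2 : σ * σ = w i j * w i j := by
      have h1 : σ * σ = s ^ 2 * Complex.exp (Complex.log (e (tsq w) / s ^ 2)) := by
        rw [hσ, mul_mul_mul_comm, ← Complex.exp_add, add_halves, sq]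
      rw [h1, Complex.exp_log (Complex.slitPlane_ne_zero hw), hetsq,
        mul_div_cancel₀ _ (pow_ne_zero 2 hij)]
    have hσ0 : σ ≠ 0 := mul_ne_zero hij (Complex.exp_ne_zero _)
    have hT : contractL i j (tsq w) = w i j • w := by
      ext k l
      change w k l * w i j = w i j * w k l
      ring
    change σ⁻¹ • contractL i j (tsq w) = w ∨ σ⁻¹ • contractL i j (tsq w) = -w
    rw [hT, smul_smul]
    rcases mul_self_eq_mul_self_iff.1 hσ2 with h | h
    · left
      rw [← h, inv_mul_cancel₀ hσ0, one_smul]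
    · right
      rw [show w i j = -σ by rw [h, neg_neg], mul_neg, inv_mul_cancel₀ hσ0, neg_smul, one_smul]

end Lift

section Gauge
variable {m n : ℕ} [NeZero m] {M : Type*} [TopologicalSpace M]
  [ChartedSpace (EuclideanHalfSpace m) M]

theorem mdifferentiableAt_clm_apply_self {E F : Type*} [NormedAddCommGroup E] [NormedSpace ℝ E]
    [NormedAddCommGroup F] [NormedSpace ℝ F] (B : E →L[ℝ] E →L[ℝ] F) {f : M → E} {x : M}
    (hf : MDifferentiableAt (𝓡∂ m) 𝓘(ℝ, E) f x) :
    MDifferentiableAt (𝓡∂ m) 𝓘(ℝ, F) (fun y => B (f y) (f y)) x ∧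
    ∀ v : TangentSpace (𝓡∂ m) x, mfderiv (𝓡∂ m) 𝓘(ℝ, F) (fun y => B (f y) (f y)) x v =
      B (mfderiv (𝓡∂ m) 𝓘(ℝ, E) f x v) (f x) + B (f x) (mfderiv (𝓡∂ m) 𝓘(ℝ, E) f x v) := by
  have h1 : HasFDerivAt (fun u => B u u) (B (f x) + B.flip (f x)) (f x) :=
    (B.hasFDerivAt.clm_apply (hasFDerivAt_id _)).congr_fderiv (by ext; simp)
  have h2 := h1.hasMFDerivAt.comp x hf.hasMFDerivAt
  refine ⟨h2.mdifferentiableAt, fun v => ?_⟩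
  rw [show (fun y => B (f y) (f y)) = (fun u => B u u) ∘ f from rfl, h2.mfderiv]
  exact add_comm _ _

theorem exists_isSmoothLiftAt {φ : M → U n}
    (h : ContMDiff (𝓡∂ m) 𝓘(ℝ, Matrix (Fin n × Fin n) (Fin n × Fin n) ℂ) ∞
      (fun y => tsq (φ y : Matrix (Fin n) (Fin n) ℂ))) (x : M) :
    ∃ φ', IsSmoothLiftAt (m := m) (fun y => cls (φ y)) x φ' := by
  classical
  obtain ⟨O, F, hO, hx, hF, hFw⟩ := exists_contDiffOn_section (φ x)
  have hval : ∀ y, tsq (φ y : Matrix (Fin n) (Fin n) ℂ) ∈ O →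
      ((if F (tsq (φ y : Matrix (Fin n) (Fin n) ℂ)) = φ y then φ y else -φ y : U n) :
        Matrix (Fin n) (Fin n) ℂ) = F (tsq (φ y : Matrix (Fin n) (Fin n) ℂ)) := by
    intro y hy
    split_ifs with hif
    · exact hif.symm
    · rw [unitary_neg_coe]
      exact ((hFw _ hy).resolve_left hif).symm
  refine ⟨fun y => if F (tsq (φ y : Matrix (Fin n) (Fin n) ℂ)) = φ y then φ y else -φ y,
    (fun y => tsq (φ y : Matrix (Fin n) (Fin n) ℂ)) ⁻¹' O, hO.preimage h.continuous, hx, ?_,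
    fun y hy => ?_⟩
  · exact (hF.contMDiffOn.comp h.contMDiffOn fun y hy => hy).congr fun y hy => hval y hy
  · refine cls_eq_iff.2 ?_
    dsimp only
    split_ifs with hif
    · exact Or.inl rfl
    · exact Or.inr (neg_neg _).symm

variable [IsManifold (𝓡∂ m) ∞ M] {A₁ A₂ : HermitianConnection m M n}

theorem IsParallelAt.congr {Q Q' : M → Matrix (Fin n × Fin n) (Fin n × Fin n) ℂ} {x : M}
    (h : IsParallelAt A₁ A₂ Q x) (hQ : Q' =ᶠ[𝓝 x] Q) : IsParallelAt A₁ A₂ Q' x := by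
  refine ⟨h.1.congr_of_eventuallyEq hQ, fun v => ?_⟩
  rw [hQ.mfderiv_eq, hQ.eq_of_nhds]
  exact h.2 v

/-- `A₂ = A₁ ◁ φ` at `x` if and only if `φ ⊗ φ` is parallel at `x`. -/
theorem isParallelAt_tsq_iff {φ : M → U n} {x : M}
    (hφ : MDifferentiableAt (𝓡∂ m) 𝓘(ℝ, Matrix (Fin n) (Fin n) ℂ)
      (fun y => (φ y : Matrix (Fin n) (Fin n) ℂ)) x) :
    IsParallelAt A₁ A₂ (fun y => tsq (φ y : Matrix (Fin n) (Fin n) ℂ)) x ↔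
      ∀ v : TangentSpace (𝓡∂ m) x, A₂.form x v = gaugeAct A₁ φ x v := by
  obtain ⟨h1, h2⟩ := mdifferentiableAt_clm_apply_self (m := m) kronL hφ
  set u : Matrix (Fin n) (Fin n) ℂ := (φ x : Matrix (Fin n) (Fin n) ℂ) with hu
  have e1 : u * u⁻¹ = 1 := Matrix.mul_nonsing_inv _ (Matrix.UnitaryGroup.det_isUnit (φ x))
  have e2 : u⁻¹ * u = 1 := Matrix.nonsing_inv_mul _ (Matrix.UnitaryGroup.det_isUnit (φ x))
  have e3 : tsq u⁻¹ * tsq u = 1 := by rw [← tsq_mul, e2, tsq_one]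
  have hd : ∀ v : TangentSpace (𝓡∂ m) x,
      mfderiv (𝓡∂ m) 𝓘(ℝ, Matrix (Fin n × Fin n) (Fin n × Fin n) ℂ)
        (fun y => tsq (φ y : Matrix (Fin n) (Fin n) ℂ)) x v =
      tsq u * dtsq (u⁻¹ * matrixDifferential φ x v) := by
    intro v
    rw [← tsq_mul_dtsq, ← mul_assoc, e1, one_mul]
    exact h2 v
  have hc : ∀ v : TangentSpace (𝓡∂ m) x,
      dtsq (A₁.form x v) * tsq u = tsq u * dtsq (u⁻¹ * A₁.form x v * u) := by
    intro v
    rw [← tsq_mul_dtsq, ← dtsq_mul_tsq, ← mul_assoc, ← mul_assoc, e1, one_mul]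
  have key : ∀ v : TangentSpace (𝓡∂ m) x,
      (tsq u * dtsq (u⁻¹ * matrixDifferential φ x v) =
        tsq u * dtsq (A₂.form x v) - dtsq (A₁.form x v) * tsq u) ↔
      A₂.form x v = gaugeAct A₁ φ x v := by
    intro v
    have e4 : dtsq (gaugeAct A₁ φ x v) = dtsq (u⁻¹ * matrixDifferential φ x v) +
        dtsq (u⁻¹ * A₁.form x v * u) := map_add dtsqL _ _
    have e5 : dtsq (A₂.form x v - gaugeAct A₁ φ x v) =
        dtsq (A₂.form x v) - dtsq (gaugeAct A₁ φ x v) := map_sub dtsqL _ _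
    rw [← sub_eq_zero (a := A₂.form x v), ← dtsq_eq_zero_iff, e5, e4, hc, ← mul_sub]
    constructor
    · intro h
      have h' := congrArg (tsq u⁻¹ * ·) h
      simp only [← mul_assoc, e3, one_mul] at h'
      rw [mul_assoc u⁻¹, ← mul_assoc, h', mul_assoc]
      abel
    · intro h
      rw [sub_eq_zero] at h
      rw [h, add_sub_cancel_right]
  refine ⟨fun h v => (key v).1 ((hd v).symm.trans (h.2 v)), fun h => ⟨h1, fun v => ?_⟩⟩
  exact (hd v).trans ((key v).2 (h v))

/-- `A₂ = A₁ ◁ [φ]` at `x` if and only if `φ ⊗ φ` is parallel at `x`. -/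
theorem isParallelAt_tsq_iff_gaugeActPm {φ : M → U n} {x : M}
    (h : ∃ φ', IsSmoothLiftAt (m := m) (fun y => cls (φ y)) x φ') :
    IsParallelAt A₁ A₂ (fun y => tsq (φ y : Matrix (Fin n) (Fin n) ℂ)) x ↔
      ∀ v : TangentSpace (𝓡∂ m) x, A₂.form x v = gaugeActPm A₁ (fun y => cls (φ y)) x v := by
  obtain ⟨φ', hφ'⟩ := h
  obtain ⟨O, hO, hx, hs, hc⟩ := id hφ'
  have hQ : (fun y => tsq (φ' y : Matrix (Fin n) (Fin n) ℂ)) =ᶠ[𝓝 x]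
      fun y => tsq (φ y : Matrix (Fin n) (Fin n) ℂ) := by
    filter_upwards [hO.mem_nhds hx] with y hy
    rw [tsq_eq_iff]
    exact (cls_eq_iff.1 (hc y hy)).imp (congrArg Subtype.val) (congrArg Subtype.val)
  have h1 := isParallelAt_tsq_iff (A₁ := A₁) (A₂ := A₂)
    ((hs.contMDiffAt (hO.mem_nhds hx)).mdifferentiableAt (by simp))
  simp only [gaugeActPm_eq A₁ hφ']
  rw [← h1]
  exact ⟨fun h => h.congr hQ, fun h => h.congr hQ.symm⟩

/-- A gauge equivalence which is trivial at the boundary conjugates the transports along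
nontangential geodesics, up to sign. -/
theorem tsq_eq_of_isParallelAt {g : SmoothMetric m M} {φ : M → U n}
    (h : ∀ x, IsParallelAt A₁ A₂ (fun y => tsq (φ y : Matrix (Fin n) (Fin n) ℂ)) x)
    (hb : ∀ x ∈ (𝓡∂ m).boundary M, tsq (φ x : Matrix (Fin n) (Fin n) ℂ) = 1)
    {p : TangentBundle (𝓡∂ m) M} (hp : IsNontangential g p) :
    tsq (φ p.proj : Matrix (Fin n) (Fin n) ℂ) =
      tsq ((geodesicTransport g A₁ p)ᴴ * geodesicTransport g A₂ p) := by
  have h1 := tendsto_of_isParallelAt hp fun x _ => h x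
  have h2 := tendsto_geo_scatteringMap hp
  have h3 := (h (scatteringMap g p)).1.continuousAt.tendsto.comp h2
  have h4 := tendsto_nhds_unique h1 h3
  rw [hb (scatteringMap g p) (isNontangentialGeodesic_geo hp).boundary] at h4
  have h5 := congrArg (fun X => tsq (geodesicTransport g A₁ p)ᴴ * X *
    tsq (geodesicTransport g A₂ p)) h4
  have e1 : tsq (geodesicTransport g A₁ p)ᴴ * tsq (geodesicTransport g A₁ p) = 1 := by
    rw [← tsq_mul, conjTranspose_mul_geodesicTransport A₁ hp, tsq_one]
  have e2 : tsq (geodesicTransport g A₂ p)ᴴ * tsq (geodesicTransport g A₂ p) = 1 := by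
    rw [← tsq_mul, conjTranspose_mul_geodesicTransport A₂ hp, tsq_one]
  simp only [mul_one] at h5
  rw [show ∀ a b c d e : Matrix (Fin n × Fin n) (Fin n × Fin n) ℂ,
      a * (b * c * d) * e = (a * b) * c * (d * e) by intros; noncomm_ring, e1, e2, one_mul,
    mul_one] at h5
  rw [h5, tsq_mul]

end Gauge

end BrokenXRay

end

theorem mainTheorem9 {m n : ℕ} [NeZero m] {M : Type*} [TopologicalSpace M] [T2Space M]
    [CompactSpace M] [ChartedSpace (EuclideanHalfSpace m) M] [IsManifold (𝓡∂ m) ∞ M]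
    (g : SmoothMetric m M) (A₁ A₂ : HermitianConnection m M n)
    (G : GeodesicGraph g) (hG : G.IsComplete) :
    (∀ (x : M), ∀ e ∈ G.E x,
        scatteringData g A₁ x e.1 e.2 = scatteringData g A₂ x e.1 e.2 ∨
        scatteringData g A₁ x e.1 e.2 = -scatteringData g A₂ x e.1 e.2) ↔
      ∃ ψ : M → Upm n, IsSmoothUpm (m := m) ψ ∧
        (∀ (x : M) (v : TangentSpace (𝓡∂ m) x), A₂.form x v = gaugeActPm A₁ ψ x v) ∧
        ∀ x ∈ (𝓡∂ m).boundary M, ψ x = cls 1 := by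
  constructor
  · intro h
    obtain ⟨φ, hφ⟩ := exists_isRelativeGauge A₁ A₂ hG h
    have hs := exists_isSmoothLiftAt (hφ.contMDiff hG)
    exact ⟨fun x => cls (φ x), hs,
      fun x => (isParallelAt_tsq_iff_gaugeActPm (hs x)).1 (hφ.isParallelAt hG x),
      fun x hx => congrArg cls (hφ.boundary x hx)⟩
  · rintro ⟨ψ, hs, hA, hb⟩ x e he
    obtain ⟨φ, rfl⟩ : ∃ φ : M → U n, (fun x => cls (φ x)) = ψ :=
      ⟨fun x => (QuotientGroup.mk_surjective (ψ x)).choose,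
        funext fun x => (QuotientGroup.mk_surjective (ψ x)).choose_spec⟩
    have hpar : ∀ x, IsParallelAt A₁ A₂ (fun y => tsq (φ y : Matrix (Fin n) (Fin n) ℂ)) x :=
      fun x => (isParallelAt_tsq_iff_gaugeActPm (hs x)).2 (hA x)
    have hb' : ∀ x ∈ (𝓡∂ m).boundary M, tsq (φ x : Matrix (Fin n) (Fin n) ℂ) = 1 := by
      intro x hx
      rw [← tsq_one, tsq_eq_iff]
      exact (cls_eq_iff.1 (hb x hx)).imp (congrArg Subtype.val) (congrArg Subtype.val)
    obtain ⟨h1, h2, -, -⟩ := G.edges x e he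
    rw [scatteringData_eq_or_eq_neg_iff A₁ A₂ (G.nontangential x _ h1) (G.nontangential x _ h2)]
    have hv := tsq_eq_of_isParallelAt (g := g) (p := ⟨x, e.1⟩) hpar hb' (G.nontangential x _ h1)
    have hw := tsq_eq_of_isParallelAt (g := g) (p := ⟨x, e.2⟩) hpar hb' (G.nontangential x _ h2)
    exact hv.symm.trans hw
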